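/- Let $\mathbb S^3\times\mathbb R=\{(p_1,\dots,p_5)\in\mathbb E^5:\ p_1^2+p_2^2+p_3^2+p_4^2=1\}$ with the induced (product) Riemannian metric, let $\partial_t=(0,0,0,0,1)$, and let $\theta\in(0,\frac\pi2)$. An immersed surface $M$ in $\mathbb S^3\times\mathbb R$ has constant angle $\theta$ if at each of its points $\partial_t=\sin\theta\,T+\cos\theta\,\xi$ with a unit tangent vector $T$ and a unit normal vector $\xi$ of $M$ in $\mathbb S^3\times\mathbb R$; it is minimal if its mean curvature vector in $\mathbb S^3\times\mathbb R$ vanishes identically. For $\nu_1\in[1,\sqrt{1+\cos^2\theta}]$ put $$F_{\theta,\nu_1}(x,y)=\bigl(c_1\cos(\mu_1x+\nu_2y),\ c_1\sin(\mu_1x+\nu_2y),\ c_2\cos(\mu_2x-\nu_1y),\ c_2\sin(\mu_2x-\nu_1y),\ x\sin\theta\bigr),$$ where $\nu_2,\mu_1,\mu_2,c_1,c_2$ are the nonnegative constants given by $$\nu_2^2=\frac{1+\cos^2\theta-\nu_1^2}{1-\nu_1^2\sin^2\theta},\quad \mu_1^2=\frac{\nu_1^2\cos^4\theta}{1-\nu_1^2\sin^2\theta},\quad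 \mu_2^2=1+\cos^2\theta-\nu_1^2,$$ $$c_1^2=\frac{1-\nu_1^2\sin^2\theta}{1+\cos^2\theta-\nu_1^2\sin^2\theta},\quad c_2^2=\frac{\cos^2\theta}{1+\cos^2\theta-\nu_1^2\sin^2\theta}.$$ Let $M$ be a smooth $2$-manifold and $F:M\to\mathbb S^3\times\mathbb R$ a map. Then $F$ is a smooth immersion which is minimal with constant angle $\theta$ if and only if, up to isometries of $\mathbb S^3\times\mathbb R$, it is locally given by some $F_{\theta,\nu_1}$: for every $p\in M$ there are a constant $\nu_1\in[1,\sqrt{1+\cos^2\theta}]$, an isometry $\Phi$ of $\mathbb S^3\times\mathbb R$ and smooth local coordinates $(x,y)$ of $M$ around $p$ in which $\Phi\circ F=F_{\theta,\nu_1}(x,y)$. If $M$ is connected, then this holds if and only if it holds with one constant $\nu_1$ and one isometry $\Phi$ for all points $p\in M$. -/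

import Mathlib

open scoped Manifold ContDiff

noncomputable section

namespace S3R

/-- Euclidean five-space `𝔼⁵`. -/
abbrev E5 : Type := EuclideanSpace ℝ (Fin 5)

/-- The coordinate plane `ℝ²`, on which surfaces are modelled. -/
abbrev Plane : Type := EuclideanSpace ℝ (Fin 2)

/-- The first four components of a vector of `𝔼⁵`. -/
def horiz (x : E5) : EuclideanSpace ℝ (Fin 4) := WithLp.toLp 2 (fun i => x i.castSucc)

/-- The unit vector `∂/∂t = (0,0,0,0,1)` tangent to the `ℝ`-direction. -/
def dt : E5 := EuclideanSpace.single 4 1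

/-- `𝕊³ × ℝ` as a hypersurface of `𝔼⁵`. -/
def S3xR : Set E5 := {x | ‖horiz x‖ = 1}

/-- The vector `N(x) = (x₁, x₂, x₃, x₄, 0)`, the unit normal of `𝕊³ × ℝ` in `𝔼⁵` at `x`. -/
def unitN (x : E5) : E5 := !₂[x 0, x 1, x 2, x 3, 0]

/-- The tangent space of `𝕊³ × ℝ` at `x`, as a subspace of `𝔼⁵`. -/
def ambientTangent (x : E5) : Submodule ℝ E5 := (Submodule.span ℝ {unitN x})ᗮ

/-- The distance of the Riemannian product `𝕊³ × ℝ`: the geodesic distance of two points of the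
unit sphere is the angle between them, and distances of the two factors add by Pythagoras. -/
def geoDist (x y : S3xR) : ℝ :=
  √ (InnerProductGeometry.angle (horiz x) (horiz y) ^ 2 + ((x : E5) 4 - (y : E5) 4) ^ 2)

/-- Isometries of the Riemannian manifold `𝕊³ × ℝ`: bijections preserving the Riemannian
distance. -/
structure Isom where
  toEquiv : S3xR ≃ S3xR
  geoDist_map : ∀ x y, geoDist (toEquiv x) (toEquiv y) = geoDist x y

variable {M : Type*} [TopologicalSpace M] [ChartedSpace Plane M]

/-- The map `F : M → 𝕊³ × ℝ`, regarded as a map into `𝔼⁵`. -/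
def incl (F : M → S3xR) (p : M) : E5 := (F p : E5)

/-- `F : M → 𝕊³ × ℝ ⊂ 𝔼⁵` is a smooth immersion. -/
def IsImmersed (F : M → S3xR) : Prop :=
  ContMDiff (𝓡 2) 𝓘(ℝ, E5) ∞ (incl F) ∧
    ∀ p : M, Function.Injective (mfderiv (𝓡 2) 𝓘(ℝ, E5) (incl F) p)

/-- The differential of `F` at `p`, in the coordinates of the preferred chart at `p`. -/
def differential (F : M → S3xR) (p : M) : Plane →L[ℝ] E5 :=
  mfderiv (𝓡 2) 𝓘(ℝ, E5) (incl F) p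

/-- The tangent plane `dF(T_pM)` of the surface at `p`. -/
def tangentPlane (F : M → S3xR) (p : M) : Submodule ℝ E5 :=
  LinearMap.range (differential F p).toLinearMap

/-- The normal plane of the surface in `𝕊³ × ℝ` at `p`. -/
def normalPlane (F : M → S3xR) (p : M) : Submodule ℝ E5 :=
  ambientTangent (F p) ⊓ (tangentPlane F p)ᗮ

/-- The surface read in the preferred chart at `p`, as a parametrized surface in `𝔼⁵`. -/
def localParam (F : M → S3xR) (p : M) (u : Plane) : E5 := incl F ((chartAt Plane p).symm u)

/-- The second fundamental form at `p` of the surface in `𝕊³ × ℝ`, in the coordinates of the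
preferred chart at `p`: the normal component in `T(𝕊³ × ℝ)` of the second derivative of `F`.
Its value on coordinate vector fields is the normal part of `∇̃_{∂ᵢ} ∂ⱼ`, since the Levi-Civita
connection `∇̃` of `𝕊³ × ℝ` is the tangential part of the flat connection of `𝔼⁵`. -/
def secondFundamentalForm (F : M → S3xR) (p : M) (v w : Plane) : E5 :=
  (normalPlane F p).starProjection
    (fderiv ℝ (fderiv ℝ (localParam F p)) (chartAt Plane p p) v w)

/-- The `i`-th coordinate vector. -/
def coordVec (i : Fin 2) : Plane := EuclideanSpace.single i 1

/-- The matrix `(g_{ij})` at `p` of the metric induced on the surface, in the preferred chart. -/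
def metricMatrix (F : M → S3xR) (p : M) : Matrix (Fin 2) (Fin 2) ℝ :=
  Matrix.of fun i j => inner ℝ (differential F p (coordVec i)) (differential F p (coordVec j))

/-- The mean curvature vector `H = ½ ∑ g^{ij} h(∂ᵢ, ∂ⱼ)` of the surface in `𝕊³ × ℝ`. -/
def meanCurvature (F : M → S3xR) (p : M) : E5 :=
  (1 / 2 : ℝ) • ∑ i, ∑ j, (metricMatrix F p)⁻¹ i j •
    secondFundamentalForm F p (coordVec i) (coordVec j)

/-- The surface is minimal in `𝕊³ × ℝ`. -/
def IsMinimal (F : M → S3xR) : Prop := ∀ p : M, meanCurvature F p = 0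

/-- The surface has constant angle `θ`: at every point `∂/∂t = sin θ T + cos θ ξ` with a unit
tangent vector `T` and a unit normal vector `ξ` of the surface in `𝕊³ × ℝ`. -/
def HasConstantAngle (F : M → S3xR) (θ : ℝ) : Prop :=
  ∀ p : M, ∃ T ∈ tangentPlane F p, ∃ ξ ∈ normalPlane F p,
    ‖T‖ = 1 ∧ ‖ξ‖ = 1 ∧ dt = Real.sin θ • T + Real.cos θ • ξ

def nu2 (θ ν₁ : ℝ) : ℝ :=
  √ ((1 + Real.cos θ ^ 2 - ν₁ ^ 2) / (1 - ν₁ ^ 2 * Real.sin θ ^ 2))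

def mu1 (θ ν₁ : ℝ) : ℝ :=
  √ (ν₁ ^ 2 * Real.cos θ ^ 4 / (1 - ν₁ ^ 2 * Real.sin θ ^ 2))

def mu2 (θ ν₁ : ℝ) : ℝ := √ (1 + Real.cos θ ^ 2 - ν₁ ^ 2)

def c1 (θ ν₁ : ℝ) : ℝ :=
  √ ((1 - ν₁ ^ 2 * Real.sin θ ^ 2) / (1 + Real.cos θ ^ 2 - ν₁ ^ 2 * Real.sin θ ^ 2))

def c2 (θ ν₁ : ℝ) : ℝ :=
  √ (Real.cos θ ^ 2 / (1 + Real.cos θ ^ 2 - ν₁ ^ 2 * Real.sin θ ^ 2))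

/-- The explicit map `F(x, y)`. -/
def model (θ ν₁ x y : ℝ) : E5 :=
  !₂[c1 θ ν₁ * Real.cos (mu1 θ ν₁ * x + nu2 θ ν₁ * y),
     c1 θ ν₁ * Real.sin (mu1 θ ν₁ * x + nu2 θ ν₁ * y),
     c2 θ ν₁ * Real.cos (mu2 θ ν₁ * x - ν₁ * y),
     c2 θ ν₁ * Real.sin (mu2 θ ν₁ * x - ν₁ * y),
     x * Real.sin θ]

/-- In suitable smooth local coordinates `(x, y)` of `M` around `p`, the map `Φ ∘ F` is the
explicit map with parameters `θ`, `ν₁`. -/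
def IsModelNear (F : M → S3xR) (Φ : Isom) (θ ν₁ : ℝ) (p : M) : Prop :=
  ∃ e ∈ IsManifold.maximalAtlas (𝓡 2) ∞ M, p ∈ e.source ∧
    ∀ q ∈ e.source, (Φ.toEquiv (F q) : E5) = model θ ν₁ (e q 0) (e q 1)

end S3R

end

/-!
Write `F = (g, t)` with `g` in `𝕊³`. On a minimal surface of constant angle `θ`, the one-forms dual
to `T` and to its orthogonal unit tangent field are closed, so there are isometric coordinates
`(x, y)` with `t = x sin θ`. Then `g` takes values in `𝕊³`, its induced metric is
`cos² θ dx² + dy²`, and minimality of `F` says exactly that `g_xx + g_yy = -(1 + cos² θ) g`.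

For such a map `g` the Codazzi equations are the Cauchy-Riemann equations of the square of the Hopf
differential, and the Gauss equation says that this square has constant modulus. It is therefore
constant, the frame of `g` solves a linear system with constant coefficients, and `g` is determined
up to an orthogonal map and the reflection `y ↦ -y` by the value of `|g_xx|²`, which lies in
`[cos⁴ θ, cos⁴ θ + cos² θ]`. By the intermediate value theorem the explicit maps attain every value
in this interval.

Where two explicit maps represent the same piece of surface, their coordinates differ by signs and
translations, and the resulting identity between the two maps holds on the whole plane by
analyticity. Hence the points near which given constants and a given isometry represent the surface
form an open and closed set.
-/

namespace S3R

open scoped InnerProductSpace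

/-- The Euclidean space `𝔼⁴` containing `𝕊³`. -/
abbrev E4 : Type := EuclideanSpace ℝ (Fin 4)

section PartialDerivatives

section NormedSpace

variable {W : Type*} [NormedAddCommGroup W] [NormedSpace ℝ W] {U : Set Plane} {h k : Plane → W}
  {u : Plane}

/-- The partial derivative of a map defined on the plane in its `i`-th coordinate. -/
noncomputable def pd (i : Fin 2) (h : Plane → W) (u : Plane) : W :=
  fderiv ℝ h u (coordVec i)

theorem contDiffOn_fderiv (hU : IsOpen U) (hh : ContDiffOn ℝ ∞ h U) :
    ContDiffOn ℝ ∞ (fderiv ℝ h) U :=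
  hh.fderiv_of_isOpen hU (by simp)

theorem contDiffOn_pd (hU : IsOpen U) (hh : ContDiffOn ℝ ∞ h U) (i : Fin 2) :
    ContDiffOn ℝ ∞ (pd i h) U :=
  (contDiffOn_fderiv hU hh).clm_apply contDiffOn_const

theorem differentiableAt_of_contDiffOn (hU : IsOpen U) (hh : ContDiffOn ℝ ∞ h U) (hu : u ∈ U) :
    DifferentiableAt ℝ h u :=
  (hh.contDiffAt (hU.mem_nhds hu)).differentiableAt (by simp)

theorem fderiv_fderiv_clm_apply (hU : IsOpen U) (hh : ContDiffOn ℝ ∞ h U) (hu : u ∈ U)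
    {w : Plane → Plane} (hw : DifferentiableAt ℝ w u) (z : Plane) :
    fderiv ℝ (fun u => fderiv ℝ h u (w u)) u z
      = fderiv ℝ h u (fderiv ℝ w u z) + fderiv ℝ (fderiv ℝ h) u z (w u) := by
  rw [fderiv_clm_apply (differentiableAt_of_contDiffOn hU (contDiffOn_fderiv hU hh) hu) hw]
  rfl

theorem pd_pd_eq_fderiv_fderiv (hU : IsOpen U) (hh : ContDiffOn ℝ ∞ h U) (hu : u ∈ U)
    (i j : Fin 2) :
    pd i (pd j h) u = fderiv ℝ (fderiv ℝ h) u (coordVec i) (coordVec j) := by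
  have := fderiv_fderiv_clm_apply hU hh hu (differentiableAt_const (coordVec j)) (coordVec i)
  rwa [fderiv_fun_const, Pi.zero_apply, zero_apply, map_zero, zero_add] at this

theorem fderiv_fderiv_comm (hU : IsOpen U) (hh : ContDiffOn ℝ ∞ h U) (hu : u ∈ U)
    (v w : Plane) : fderiv ℝ (fderiv ℝ h) u v w = fderiv ℝ (fderiv ℝ h) u w v :=
  ((hh.contDiffAt (hU.mem_nhds hu)).isSymmSndFDerivAt
    (by simpa using WithTop.coe_le_coe.2 (le_top (a := (2 : ℕ∞))))) v w

theorem pd_comm (hU : IsOpen U) (hh : ContDiffOn ℝ ∞ h U) (hu : u ∈ U) (i j : Fin 2) :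
    pd i (pd j h) u = pd j (pd i h) u := by
  rw [pd_pd_eq_fderiv_fderiv hU hh hu, pd_pd_eq_fderiv_fderiv hU hh hu, fderiv_fderiv_comm hU hh hu]

theorem pd_congr (hU : IsOpen U) (hk : ∀ u ∈ U, h u = k u) (hu : u ∈ U) (i : Fin 2) :
    pd i h u = pd i k u := by
  unfold pd
  rw [Filter.EventuallyEq.fderiv_eq (Filter.eventuallyEq_of_mem (hU.mem_nhds hu) hk)]

theorem pd_eq_zero_of_const {w : W} (hU : IsOpen U) (hw : ∀ u ∈ U, h u = w) (hu : u ∈ U)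
    (i : Fin 2) : pd i h u = 0 := by
  rw [pd_congr hU hw hu]
  simp [pd]

theorem pd_add (hh : DifferentiableAt ℝ h u) (hk : DifferentiableAt ℝ k u) (i : Fin 2) :
    pd i (fun u => h u + k u) u = pd i h u + pd i k u := by
  simp [pd, fderiv_fun_add hh hk]

theorem pd_sub (hh : DifferentiableAt ℝ h u) (hk : DifferentiableAt ℝ k u) (i : Fin 2) :
    pd i (fun u => h u - k u) u = pd i h u - pd i k u := by
  simp [pd, fderiv_fun_sub hh hk]

theorem pd_const_smul (r : ℝ) (h : Plane → W) (i : Fin 2) (u : Plane) :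
    pd i (fun u => r • h u) u = r • pd i h u := by
  change pd i (r • h) u = _
  simp [pd, fderiv_const_smul_field]

theorem fderiv_apply_eq_pd (h : Plane → W) (u z : Plane) :
    fderiv ℝ h u z = z 0 • pd 0 h u + z 1 • pd 1 h u := by
  have hz : z = z 0 • coordVec 0 + z 1 • coordVec 1 := by
    ext j; fin_cases j <;> simp [coordVec]
  conv_lhs => rw [hz]
  simp only [map_add, map_smul, pd]

theorem exists_const_of_pd_eq_zero (hU : IsOpen U) (hc : IsPreconnected U)
    (hh : DifferentiableOn ℝ h U) (h0 : ∀ u ∈ U, ∀ i, pd i h u = 0) : ∃ k, ∀ u ∈ U, h u = k :=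
  hU.exists_is_const_of_fderiv_eq_zero hc hh fun u hu => by
    ext z
    simp [fderiv_apply_eq_pd, h0 u hu]

end NormedSpace

section InnerProductSpace

variable {W : Type*} [NormedAddCommGroup W] [InnerProductSpace ℝ W] {U : Set Plane}
  {p q : Plane → W} {u : Plane}

theorem pd_inner (hp : DifferentiableAt ℝ p u) (hq : DifferentiableAt ℝ q u) (i : Fin 2) :
    pd i (fun u => ⟪p u, q u⟫_ℝ) u = ⟪pd i p u, q u⟫_ℝ + ⟪p u, pd i q u⟫_ℝ := by
  unfold pd
  rw [fderiv_inner_apply ℝ hp hq, add_comm]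

theorem inner_fderiv_add_inner_fderiv_of_const (hU : IsOpen U) (hp : ContDiffOn ℝ ∞ p U)
    (hq : ContDiffOn ℝ ∞ q U) {k : ℝ} (hk : ∀ u ∈ U, ⟪p u, q u⟫_ℝ = k) (hu : u ∈ U) (z : Plane) :
    ⟪fderiv ℝ p u z, q u⟫_ℝ + ⟪p u, fderiv ℝ q u z⟫_ℝ = 0 := by
  rw [add_comm, ← fderiv_inner_apply ℝ (differentiableAt_of_contDiffOn hU hp hu)
    (differentiableAt_of_contDiffOn hU hq hu),
    (Filter.eventuallyEq_of_mem (hU.mem_nhds hu) hk).fderiv_eq]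
  simp

theorem inner_pd_add_inner_pd_of_const (hU : IsOpen U) (hp : ContDiffOn ℝ ∞ p U)
    (hq : ContDiffOn ℝ ∞ q U) {k : ℝ} (hk : ∀ u ∈ U, ⟪p u, q u⟫_ℝ = k) (i : Fin 2) (hu : u ∈ U) :
    ⟪pd i p u, q u⟫_ℝ + ⟪p u, pd i q u⟫_ℝ = 0 :=
  inner_fderiv_add_inner_fderiv_of_const hU hp hq hk hu (coordVec i)

end InnerProductSpace

theorem pd_eq_zero_of_cauchyRiemann {U : Set Plane} (hU : IsOpen U) {P Q : Plane → ℝ}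
    (hP : DifferentiableOn ℝ P U) (hQ : DifferentiableOn ℝ Q U) {r : ℝ}
    (hr : ∀ u ∈ U, P u ^ 2 + Q u ^ 2 = r) (h₀ : ∀ u ∈ U, pd 0 P u = -pd 1 Q u)
    (h₁ : ∀ u ∈ U, pd 1 P u = pd 0 Q u) {u : Plane} (hu : u ∈ U) (i : Fin 2) :
    pd i P u = 0 ∧ pd i Q u = 0 := by
  have hP' := hP.differentiableAt (hU.mem_nhds hu)
  have hQ' := hQ.differentiableAt (hU.mem_nhds hu)
  have radial : ∀ j, P u * pd j P u + Q u * pd j Q u = 0 := fun j => by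
    have := pd_eq_zero_of_const (h := fun u => ⟪P u, P u⟫_ℝ + ⟪Q u, Q u⟫_ℝ) hU
      (fun v hv => by simpa [← sq] using hr v hv) hu j
    rw [pd_add (hP'.inner ℝ hP') (hQ'.inner ℝ hQ'), pd_inner hP' hP', pd_inner hQ' hQ'] at this
    simp only [RCLike.inner_apply, conj_trivial] at this
    linarith
  rcases eq_or_ne r 0 with rfl | hr0
  · have hPQ : ∀ v ∈ U, P v = 0 ∧ Q v = 0 := fun v hv =>
      ⟨by nlinarith [hr v hv, sq_nonneg (P v), sq_nonneg (Q v)],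
        by nlinarith [hr v hv, sq_nonneg (P v), sq_nonneg (Q v)]⟩
    exact ⟨pd_eq_zero_of_const hU (fun v hv => (hPQ v hv).1) hu i,
      pd_eq_zero_of_const hU (fun v hv => (hPQ v hv).2) hu i⟩
  have e₀ := h₀ u hu
  have e₁ := h₁ u hu
  have hPx : pd 0 P u = 0 := (mul_eq_zero_iff_left hr0).1 (by
    rw [← hr u hu]; linear_combination P u * radial 0 - Q u * radial 1 + P u * Q u * e₁ +
      Q u ^ 2 * e₀)
  have hPy : pd 1 P u = 0 := (mul_eq_zero_iff_left hr0).1 (by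
    rw [← hr u hu]; linear_combination P u * radial 1 + Q u * radial 0 - P u * Q u * e₀ +
      Q u ^ 2 * e₁)
  fin_cases i
  · exact ⟨hPx, e₁.symm.trans hPy⟩
  · exact ⟨hPy, neg_eq_zero.1 (e₀.symm.trans hPx)⟩

end PartialDerivatives

section LinearAlgebra

theorem inner_sq_eq_of_finrank_le_one {W : Type*} [NormedAddCommGroup W] [InnerProductSpace ℝ W]
    {K : Submodule ℝ W} [FiniteDimensional ℝ K] (hK : Module.finrank ℝ K ≤ 1) {A B : W}
    (hA : A ∈ K) (hB : B ∈ K) : ⟪A, B⟫_ℝ ^ 2 = ⟪A, A⟫_ℝ * ⟪B, B⟫_ℝ := by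
  obtain ⟨v, hv⟩ := finrank_le_one_iff.1 hK
  obtain ⟨a, ha⟩ := hv ⟨A, hA⟩
  obtain ⟨b, hb⟩ := hv ⟨B, hB⟩
  obtain rfl : a • (v : W) = A := congrArg Subtype.val ha
  obtain rfl : b • (v : W) = B := congrArg Subtype.val hb
  simp only [inner_smul_left, inner_smul_right, conj_trivial]
  ring

theorem inner_sq_eq_of_orthogonal {W ι : Type*} [NormedAddCommGroup W] [InnerProductSpace ℝ W]
    [FiniteDimensional ℝ W] [Fintype ι] {e : ι → W} (he : LinearIndependent ℝ e)
    (hcard : Module.finrank ℝ W ≤ Fintype.card ι + 1) {A B : W} (hA : ∀ i, ⟪e i, A⟫_ℝ = 0)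
    (hB : ∀ i, ⟪e i, B⟫_ℝ = 0) : ⟪A, B⟫_ℝ ^ 2 = ⟪A, A⟫_ℝ * ⟪B, B⟫_ℝ := by
  have mem_orthogonal : ∀ {x : W}, (∀ i, ⟪e i, x⟫_ℝ = 0) → x ∈ (Submodule.span ℝ (Set.range e))ᗮ :=
    fun {x} hx => Submodule.isOrtho_span.2
      (by rintro _ rfl _ ⟨i, rfl⟩; rw [real_inner_comm]; exact hx i)
      (Submodule.mem_span_singleton_self x)
  refine inner_sq_eq_of_finrank_le_one ?_ (mem_orthogonal hA) (mem_orthogonal hB)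
  have := (Submodule.span ℝ (Set.range e)).finrank_add_finrank_orthogonal
  rw [finrank_span_eq_card he] at this
  omega

theorem exists_sq_eq_sq_eq_mul_eq {α β γ : ℝ} (hα : 0 ≤ α) (hβ : 0 ≤ β) (h : γ ^ 2 = α * β) :
    ∃ a b : ℝ, a ^ 2 = α ∧ b ^ 2 = β ∧ a * b = γ := by
  have hm : √α * √β = |γ| := by rw [← Real.sqrt_mul hα, ← h, Real.sqrt_sq_eq_abs]
  rcases le_total 0 γ with hγ | hγ
  · exact ⟨√α, √β, Real.sq_sqrt hα, Real.sq_sqrt hβ, by rw [hm, abs_of_nonneg hγ]⟩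
  · exact ⟨√α, -√β, Real.sq_sqrt hα, by rw [neg_sq, Real.sq_sqrt hβ], by
      rw [mul_neg, hm, abs_of_nonpos hγ, neg_neg]⟩

end LinearAlgebra

section FlatSpherical

variable {W : Type*} [NormedAddCommGroup W] [InnerProductSpace ℝ W]
  {G : Matrix (Fin 2) (Fin 2) ℝ} {g : Plane → W} {U : Set Plane} {u : Plane}

/-- A map from an open set of the plane to the unit sphere whose induced metric has the constant
coefficients `G`; the surface is therefore flat and its Christoffel symbols vanish. -/
structure FlatSpherical (G : Matrix (Fin 2) (Fin 2) ℝ) (g : Plane → W) (U : Set Plane) : Prop where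
  isOpen : IsOpen U
  smooth : ContDiffOn ℝ ∞ g U
  unit : ∀ u ∈ U, ⟪g u, g u⟫_ℝ = 1
  metric : ∀ u ∈ U, ∀ i j, ⟪pd i g u, pd j g u⟫_ℝ = G i j

/-- The second fundamental form on the `i`-th and `j`-th coordinate fields, in the sphere, of a map
as in `FlatSpherical`. Neither Christoffel symbols nor a tangential projection occur because the
metric is constant. -/
noncomputable def secondForm (i j : Fin 2) (g : Plane → W) (u : Plane) : W :=
  pd i (pd j g) u + ⟪pd i g u, pd j g u⟫_ℝ • g u

namespace FlatSpherical

theorem contDiffOn_pd (h : FlatSpherical G g U) (i : Fin 2) : ContDiffOn ℝ ∞ (pd i g) U :=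
  S3R.contDiffOn_pd h.isOpen h.smooth i

theorem contDiffOn_pd_pd (h : FlatSpherical G g U) (i j : Fin 2) :
    ContDiffOn ℝ ∞ (pd i (pd j g)) U :=
  S3R.contDiffOn_pd h.isOpen (h.contDiffOn_pd j) i

theorem pd_pd_comm (h : FlatSpherical G g U) (hu : u ∈ U) (i j : Fin 2) :
    pd i (pd j g) u = pd j (pd i g) u :=
  pd_comm h.isOpen h.smooth hu i j

theorem inner_pd (h : FlatSpherical G g U) (hu : u ∈ U) (i : Fin 2) : ⟪g u, pd i g u⟫_ℝ = 0 := by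
  have := inner_pd_add_inner_pd_of_const h.isOpen h.smooth h.smooth h.unit i hu
  rw [real_inner_comm] at this
  linarith

theorem inner_pd_pd (h : FlatSpherical G g U) (hu : u ∈ U) (i j : Fin 2) :
    ⟪g u, pd i (pd j g) u⟫_ℝ = -G i j := by
  have := inner_pd_add_inner_pd_of_const h.isOpen h.smooth (h.contDiffOn_pd j)
    (fun v hv => h.inner_pd hv j) i hu
  rw [h.metric u hu] at this
  linarith

theorem inner_pd_pd_pd (h : FlatSpherical G g U) (hu : u ∈ U) (i j k : Fin 2) :
    ⟪pd i g u, pd j (pd k g) u⟫_ℝ = 0 := by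
  have antisymm : ∀ i j k, ⟪pd k g u, pd j (pd i g) u⟫_ℝ + ⟪pd i g u, pd j (pd k g) u⟫_ℝ = 0 :=
    fun i j k => by
      rw [real_inner_comm]
      exact inner_pd_add_inner_pd_of_const h.isOpen (h.contDiffOn_pd i) (h.contDiffOn_pd k)
        (fun v hv => h.metric v hv i k) j hu
  have h₁ := antisymm i j k
  have h₂ := antisymm j k i
  have h₃ := antisymm k i j
  rw [h.pd_pd_comm hu j i] at h₁
  rw [h.pd_pd_comm hu k j] at h₂
  rw [h.pd_pd_comm hu i k] at h₃
  linarith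

theorem contDiffOn_secondForm (h : FlatSpherical G g U) (i j : Fin 2) :
    ContDiffOn ℝ ∞ (secondForm i j g) U :=
  (h.contDiffOn_pd_pd i j).add
    (((h.contDiffOn_pd i).inner ℝ (h.contDiffOn_pd j)).smul h.smooth)

theorem secondForm_eq (h : FlatSpherical G g U) (hu : u ∈ U) (i j : Fin 2) :
    secondForm i j g u = pd i (pd j g) u + G i j • g u := by
  rw [secondForm, h.metric u hu]

theorem inner_secondForm (h : FlatSpherical G g U) (hu : u ∈ U) (i j : Fin 2) :
    ⟪g u, secondForm i j g u⟫_ℝ = 0 := by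
  rw [h.secondForm_eq hu, inner_add_right, inner_smul_right, h.inner_pd_pd hu, h.unit u hu]
  ring

theorem inner_pd_secondForm (h : FlatSpherical G g U) (hu : u ∈ U) (k i j : Fin 2) :
    ⟪pd k g u, secondForm i j g u⟫_ℝ = 0 := by
  rw [h.secondForm_eq hu, inner_add_right, inner_smul_right, h.inner_pd_pd_pd hu,
    real_inner_comm, h.inner_pd hu]
  ring

theorem pd_secondForm (h : FlatSpherical G g U) (hu : u ∈ U) (k i j : Fin 2) :
    pd k (secondForm i j g) u = pd k (pd i (pd j g)) u + G i j • pd k g u := by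
  have hg := differentiableAt_of_contDiffOn h.isOpen h.smooth hu
  rw [pd_congr h.isOpen (fun v hv => h.secondForm_eq hv i j) hu,
    pd_add (differentiableAt_of_contDiffOn h.isOpen (h.contDiffOn_pd_pd i j) hu)
      (hg.fun_const_smul _), pd_const_smul]

theorem codazzi (h : FlatSpherical G g U) (hu : u ∈ U) {N : W} (hN : ∀ k, ⟪N, pd k g u⟫_ℝ = 0)
    (k i j : Fin 2) :
    ⟪N, pd k (secondForm i j g) u⟫_ℝ = ⟪N, pd i (secondForm k j g) u⟫_ℝ := by
  rw [h.pd_secondForm hu, h.pd_secondForm hu, pd_comm h.isOpen (h.contDiffOn_pd j) hu k i]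
  simp only [inner_add_right, inner_smul_right, hN, mul_zero]

theorem gauss (h : FlatSpherical G g U) (hu : u ∈ U) (i j k l : Fin 2) :
    ⟪secondForm i j g u, secondForm k l g u⟫_ℝ - ⟪secondForm k j g u, secondForm i l g u⟫_ℝ
      = G k j * G i l - G i j * G k l := by
  have inner_third : ∀ i k, ⟪pd i (pd j g) u, pd k (pd l g) u⟫_ℝ
      = -⟪pd j g u, pd i (pd k (pd l g)) u⟫_ℝ := fun i k =>
    eq_neg_of_add_eq_zero_left (inner_pd_add_inner_pd_of_const h.isOpen (h.contDiffOn_pd j)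
      (h.contDiffOn_pd_pd k l) (fun v hv => h.inner_pd_pd_pd hv j k l) i hu)
  have hpos : ∀ i j, ⟪pd i (pd j g) u, g u⟫_ℝ = -G i j := fun i j => by
    rw [real_inner_comm, h.inner_pd_pd hu]
  have second : ∀ i k, ⟪secondForm i j g u, secondForm k l g u⟫_ℝ
      = -⟪pd j g u, pd i (pd k (pd l g)) u⟫_ℝ - G i j * G k l := fun i k => by
    simp only [h.secondForm_eq hu, inner_add_left, inner_add_right, inner_smul_left,
      inner_smul_right, conj_trivial, inner_third i k, hpos, h.inner_pd_pd hu, h.unit u hu]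
    ring
  rw [second i k, second k i, pd_comm h.isOpen (h.contDiffOn_pd l) hu k i]
  ring

theorem mono (h : FlatSpherical G g U) {V : Set Plane} (hV : IsOpen V) (hVU : V ⊆ U) :
    FlatSpherical G g V :=
  ⟨hV, h.smooth.mono hVU, fun u hu => h.unit u (hVU hu), fun u hu => h.metric u (hVU hu)⟩

end FlatSpherical

end FlatSpherical

/-- A map from an open set of the plane to the unit sphere that is the first factor of an
isometric parametrization `(g, √(1 - c²) x)` of a minimal surface of the product of the sphere with
`ℝ`. In the theorem `c = cos θ`. -/
structure FlatMinimal {W : Type*} [NormedAddCommGroup W] [InnerProductSpace ℝ W] (c : ℝ)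
    (g : Plane → W) (U : Set Plane) : Prop extends FlatSpherical !![c ^ 2, 0; 0, 1] g U where
  harmonic : ∀ u ∈ U, pd 0 (pd 0 g) u + pd 1 (pd 1 g) u = -(1 + c ^ 2) • g u

/-- A unit normal field of a flat minimal map, for which the second fundamental form has the
constant coefficients `a, b, -a`. -/
structure IsNormalField {W : Type*} [NormedAddCommGroup W] [InnerProductSpace ℝ W] (c : ℝ)
    (g : Plane → W) (U : Set Plane) (a b : ℝ) (η : Plane → W) : Prop where
  smooth : ContDiffOn ℝ ∞ η U
  unit : ∀ u ∈ U, ⟪η u, η u⟫_ℝ = 1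
  pos : ∀ u ∈ U, ⟪g u, η u⟫_ℝ = 0
  tangent : ∀ u ∈ U, ∀ i, ⟪pd i g u, η u⟫_ℝ = 0
  xx : ∀ u ∈ U, pd 0 (pd 0 g) u = -c ^ 2 • g u + a • η u
  xy : ∀ u ∈ U, pd 0 (pd 1 g) u = b • η u

namespace FlatMinimal

section

variable {W : Type*} [NormedAddCommGroup W] [InnerProductSpace ℝ W] {c : ℝ} {g : Plane → W}
  {U : Set Plane} {u : Plane}

theorem inner_pd_zero_pd_zero (h : FlatMinimal c g U) (hu : u ∈ U) :
    ⟪pd 0 g u, pd 0 g u⟫_ℝ = c ^ 2 := by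
  simpa using h.metric u hu 0 0

theorem inner_pd_zero_pd_one (h : FlatMinimal c g U) (hu : u ∈ U) :
    ⟪pd 0 g u, pd 1 g u⟫_ℝ = 0 := by
  simpa using h.metric u hu 0 1

theorem inner_pd_one_pd_one (h : FlatMinimal c g U) (hu : u ∈ U) :
    ⟪pd 1 g u, pd 1 g u⟫_ℝ = 1 := by
  simpa using h.metric u hu 1 1

theorem secondForm_zero_zero (h : FlatMinimal c g U) (hu : u ∈ U) :
    secondForm 0 0 g u = pd 0 (pd 0 g) u + c ^ 2 • g u := by
  simpa using h.secondForm_eq hu 0 0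

theorem secondForm_zero_one (h : FlatMinimal c g U) (hu : u ∈ U) :
    secondForm 0 1 g u = pd 0 (pd 1 g) u := by
  simpa using h.secondForm_eq hu 0 1

theorem secondForm_one_zero (h : FlatMinimal c g U) (hu : u ∈ U) :
    secondForm 1 0 g u = secondForm 0 1 g u := by
  rw [secondForm, secondForm, h.pd_pd_comm hu, real_inner_comm]

theorem secondForm_one_one (h : FlatMinimal c g U) (hu : u ∈ U) :
    secondForm 1 1 g u = -secondForm 0 0 g u := by
  have := h.harmonic u hu
  rw [← eq_sub_iff_add_eq'] at this
  rw [h.secondForm_eq hu, h.secondForm_zero_zero hu, this]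
  simp only [Matrix.of_apply, Matrix.cons_val]
  module

theorem inner_secondForm_add_inner_secondForm (h : FlatMinimal c g U) (hu : u ∈ U) :
    ⟪secondForm 0 0 g u, secondForm 0 0 g u⟫_ℝ + ⟪secondForm 0 1 g u, secondForm 0 1 g u⟫_ℝ
      = c ^ 2 := by
  have := h.gauss hu 0 0 1 1
  rw [h.secondForm_one_one hu, h.secondForm_one_zero hu, inner_neg_right] at this
  simp only [Matrix.of_apply, Matrix.cons_val, mul_one, mul_zero] at this
  linarith

theorem linearIndependent (h : FlatMinimal c g U) (hc : c ≠ 0) (hu : u ∈ U) :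
    LinearIndependent ℝ ![g u, pd 0 g u, pd 1 g u] := by
  have orth := h.inner_pd hu
  have orth' : ∀ i, ⟪pd i g u, g u⟫_ℝ = 0 := fun i => (real_inner_comm _ _).trans (orth i)
  have hxy := h.inner_pd_zero_pd_one hu
  have hyx := (real_inner_comm _ _).trans hxy
  refine linearIndependent_of_ne_zero_of_inner_eq_zero (fun i => ?_) fun i j hij => ?_
  · have h₀ : g u ≠ 0 := fun h0 => by simpa [h0] using h.unit u hu
    have h₁ : pd 0 g u ≠ 0 := fun h0 => hc (by simpa [h0] using (h.inner_pd_zero_pd_zero hu).symm)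
    have h₂ : pd 1 g u ≠ 0 := fun h0 => by simpa [h0] using h.inner_pd_one_pd_one hu
    fin_cases i <;> simpa
  · fin_cases i <;> fin_cases j <;> simp_all

/-- The real part of the square of the Hopf differential `h₁₁ - i h₁₂`. Unlike the Hopf differential
itself, its square needs no choice of a unit normal. -/
noncomputable def hopfSqRe (g : Plane → W) (u : Plane) : ℝ :=
  ⟪secondForm 0 0 g u, secondForm 0 0 g u⟫_ℝ - ⟪secondForm 0 1 g u, secondForm 0 1 g u⟫_ℝ

/-- The imaginary part, up to sign, of the square of the Hopf differential, see `hopfSqRe`. -/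
noncomputable def hopfSqIm (g : Plane → W) (u : Plane) : ℝ :=
  2 * ⟪secondForm 0 0 g u, secondForm 0 1 g u⟫_ℝ

theorem differentiableOn_hopfSqRe (h : FlatMinimal c g U) : DifferentiableOn ℝ (hopfSqRe g) U := by
  have hA := (h.contDiffOn_secondForm 0 0).differentiableOn (by simp)
  have hB := (h.contDiffOn_secondForm 0 1).differentiableOn (by simp)
  exact (hA.inner ℝ hA).sub (hB.inner ℝ hB)

theorem differentiableOn_hopfSqIm (h : FlatMinimal c g U) : DifferentiableOn ℝ (hopfSqIm g) U := by
  have hA := (h.contDiffOn_secondForm 0 0).differentiableOn (by simp)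
  have hB := (h.contDiffOn_secondForm 0 1).differentiableOn (by simp)
  exact (hA.inner ℝ hB).const_mul 2

theorem pd_hopfSqRe (h : FlatMinimal c g U) (hu : u ∈ U) (i : Fin 2) :
    pd i (hopfSqRe g) u = 2 * ⟪secondForm 0 0 g u, pd i (secondForm 0 0 g) u⟫_ℝ
      - 2 * ⟪secondForm 0 1 g u, pd i (secondForm 0 1 g) u⟫_ℝ := by
  have hA := differentiableAt_of_contDiffOn h.isOpen (h.contDiffOn_secondForm 0 0) hu
  have hB := differentiableAt_of_contDiffOn h.isOpen (h.contDiffOn_secondForm 0 1) hu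
  have := pd_sub (hA.inner ℝ hA) (hB.inner ℝ hB) i
  rw [pd_inner hA hA, pd_inner hB hB, real_inner_comm _ (pd i _ u),
    real_inner_comm _ (pd i _ u), ← two_mul, ← two_mul] at this
  exact this

theorem pd_hopfSqIm (h : FlatMinimal c g U) (hu : u ∈ U) (i : Fin 2) :
    pd i (hopfSqIm g) u = 2 * ⟪secondForm 0 1 g u, pd i (secondForm 0 0 g) u⟫_ℝ
      + 2 * ⟪secondForm 0 0 g u, pd i (secondForm 0 1 g) u⟫_ℝ := by
  have hA := differentiableAt_of_contDiffOn h.isOpen (h.contDiffOn_secondForm 0 0) hu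
  have hB := differentiableAt_of_contDiffOn h.isOpen (h.contDiffOn_secondForm 0 1) hu
  have := pd_const_smul 2 (fun u => ⟪secondForm 0 0 g u, secondForm 0 1 g u⟫_ℝ) i u
  rw [pd_inner hA hB, real_inner_comm _ (pd i _ u), smul_eq_mul, mul_add] at this
  exact this

theorem inner_pd_one_secondForm (h : FlatMinimal c g U) (hu : u ∈ U) {N : W}
    (hN : ∀ k, ⟪N, pd k g u⟫_ℝ = 0) :
    ⟪N, pd 1 (secondForm 0 0 g) u⟫_ℝ = ⟪N, pd 0 (secondForm 0 1 g) u⟫_ℝ ∧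
      ⟪N, pd 1 (secondForm 0 1 g) u⟫_ℝ = -⟪N, pd 0 (secondForm 0 0 g) u⟫_ℝ := by
  constructor
  · rw [h.codazzi hu hN, pd_congr h.isOpen fun v hv => h.secondForm_one_zero hv]
    exact hu
  · rw [h.codazzi hu hN, pd_congr h.isOpen
      (fun v hv => (h.secondForm_one_one hv).trans (neg_one_smul ℝ _).symm) hu,
      pd_const_smul, neg_one_smul, inner_neg_right]

theorem cauchyRiemann_hopfSq (h : FlatMinimal c g U) (hu : u ∈ U) :
    pd 0 (hopfSqRe g) u = -pd 1 (hopfSqIm g) u ∧ pd 1 (hopfSqRe g) u = pd 0 (hopfSqIm g) u := by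
  have normal : ∀ i j k, ⟪secondForm i j g u, pd k g u⟫_ℝ = 0 := fun i j k =>
    (real_inner_comm _ _).trans (h.inner_pd_secondForm hu k i j)
  have hA := h.inner_pd_one_secondForm hu (normal 0 0)
  have hB := h.inner_pd_one_secondForm hu (normal 0 1)
  rw [h.pd_hopfSqRe hu, h.pd_hopfSqRe hu, h.pd_hopfSqIm hu, h.pd_hopfSqIm hu, hA.1, hA.2, hB.1,
    hB.2]
  constructor <;> ring

end

section

variable {c : ℝ} {g : Plane → E4} {U : Set Plane}

theorem inner_secondForm_sq (h : FlatMinimal c g U) (hc : c ≠ 0) {u : Plane} (hu : u ∈ U) :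
    ⟪secondForm 0 0 g u, secondForm 0 1 g u⟫_ℝ ^ 2
      = ⟪secondForm 0 0 g u, secondForm 0 0 g u⟫_ℝ
        * ⟪secondForm 0 1 g u, secondForm 0 1 g u⟫_ℝ := by
  refine inner_sq_eq_of_orthogonal (h.linearIndependent hc hu) (by simp) ?_ ?_ <;>
  · intro i
    fin_cases i <;>
    simp [h.inner_secondForm hu, h.inner_pd_secondForm hu]

theorem hopfSqRe_sq_add_hopfSqIm_sq (h : FlatMinimal c g U) (hc : c ≠ 0) {u : Plane}
    (hu : u ∈ U) : hopfSqRe g u ^ 2 + hopfSqIm g u ^ 2 = c ^ 4 := by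
  have hpar := h.inner_secondForm_sq hc hu
  have hgauss := h.inner_secondForm_add_inner_secondForm hu
  calc hopfSqRe g u ^ 2 + hopfSqIm g u ^ 2
      = (⟪secondForm 0 0 g u, secondForm 0 0 g u⟫_ℝ
          + ⟪secondForm 0 1 g u, secondForm 0 1 g u⟫_ℝ) ^ 2 := by
        rw [hopfSqRe, hopfSqIm]
        linear_combination 4 * hpar
    _ = c ^ 4 := by rw [hgauss]; ring

theorem exists_inner_secondForm_eq (h : FlatMinimal c g U) (hc : c ≠ 0) (hU : IsPreconnected U)
    (hne : U.Nonempty) :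
    ∃ a b : ℝ, ∀ u ∈ U, ⟪secondForm 0 0 g u, secondForm 0 0 g u⟫_ℝ = a ^ 2 ∧
      ⟪secondForm 0 0 g u, secondForm 0 1 g u⟫_ℝ = a * b ∧
      ⟪secondForm 0 1 g u, secondForm 0 1 g u⟫_ℝ = b ^ 2 := by
  have pd_eq_zero := fun u (hu : u ∈ U) => pd_eq_zero_of_cauchyRiemann h.isOpen
    h.differentiableOn_hopfSqRe h.differentiableOn_hopfSqIm
    (fun v hv => h.hopfSqRe_sq_add_hopfSqIm_sq hc hv) (fun v hv => (h.cauchyRiemann_hopfSq hv).1)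
    (fun v hv => (h.cauchyRiemann_hopfSq hv).2) hu
  obtain ⟨ρ, hρ⟩ := exists_const_of_pd_eq_zero h.isOpen hU h.differentiableOn_hopfSqRe
    fun u hu i => (pd_eq_zero u hu i).1
  obtain ⟨σ, hσ⟩ := exists_const_of_pd_eq_zero h.isOpen hU h.differentiableOn_hopfSqIm
    fun u hu i => (pd_eq_zero u hu i).2
  obtain ⟨u₀, hu₀⟩ := hne
  obtain ⟨a, b, ha, hb, hab⟩ := exists_sq_eq_sq_eq_mul_eq real_inner_self_nonneg
    real_inner_self_nonneg (h.inner_secondForm_sq hc hu₀)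
  refine ⟨a, b, fun u hu => ?_⟩
  have hRe := (hρ u hu).trans (hρ u₀ hu₀).symm
  have hIm := (hσ u hu).trans (hσ u₀ hu₀).symm
  have hsum := h.inner_secondForm_add_inner_secondForm hu
  have hsum₀ := h.inner_secondForm_add_inner_secondForm hu₀
  simp only [hopfSqRe, hopfSqIm] at hRe hIm
  exact ⟨by linarith, by linarith, by linarith⟩

end

end FlatMinimal

theorem smul_eq_smul_of_inner_eq {W : Type*} [NormedAddCommGroup W] [InnerProductSpace ℝ W]
    {a b : ℝ} {A B : W} (hAA : ⟪A, A⟫_ℝ = a ^ 2) (hAB : ⟪A, B⟫_ℝ = a * b)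
    (hBB : ⟪B, B⟫_ℝ = b ^ 2) : b • A = a • B := by
  have hBA : ⟪B, A⟫_ℝ = a * b := (real_inner_comm _ _).trans hAB
  rw [← sub_eq_zero, ← inner_self_eq_zero (𝕜 := ℝ)]
  simp only [inner_sub_left, inner_sub_right, inner_smul_left, inner_smul_right, hAA, hAB, hBA,
    hBB, conj_trivial]
  ring

theorem exists_common_direction {W : Type*} [NormedAddCommGroup W] [InnerProductSpace ℝ W]
    {a b r : ℝ} (hr : r ≠ 0) (hab : a ^ 2 + b ^ 2 = r) {A B : W} (hAA : ⟪A, A⟫_ℝ = a ^ 2)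
    (hAB : ⟪A, B⟫_ℝ = a * b) (hBB : ⟪B, B⟫_ℝ = b ^ 2) :
    let η := r⁻¹ • (a • A + b • B)
    ⟪η, η⟫_ℝ = 1 ∧ A = a • η ∧ B = b • η := by
  intro η
  have hprop := smul_eq_smul_of_inner_eq hAA hAB hBB
  have hA : A = a • η := by
    rw [smul_comm, eq_inv_smul_iff₀ hr, smul_add, smul_comm a b B, ← hprop, ← hab]
    module
  have hB : B = b • η := by
    rw [smul_comm, eq_inv_smul_iff₀ hr, smul_add, smul_comm b a A, hprop, ← hab]
    module
  refine ⟨?_, hA, hB⟩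
  have hη : ⟪a • η, a • η⟫_ℝ + ⟪b • η, b • η⟫_ℝ = a ^ 2 + b ^ 2 := by rw [← hA, ← hB, hAA, hBB]
  simp only [inner_smul_left, inner_smul_right, conj_trivial] at hη
  refine mul_left_cancel₀ (hab ▸ hr : a ^ 2 + b ^ 2 ≠ 0) ?_
  linear_combination hη

namespace FlatMinimal

theorem exists_normalField {c : ℝ} {g : Plane → E4} {U : Set Plane} (h : FlatMinimal c g U)
    (hc : c ≠ 0) (hU : IsPreconnected U) (hne : U.Nonempty) :
    ∃ a b η, a ^ 2 + b ^ 2 = c ^ 2 ∧ IsNormalField c g U a b η := by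
  obtain ⟨a, b, hab⟩ := h.exists_inner_secondForm_eq hc hU hne
  obtain ⟨u₀, hu₀⟩ := hne
  have hsum : a ^ 2 + b ^ 2 = c ^ 2 := by
    rw [← h.inner_secondForm_add_inner_secondForm hu₀, (hab u₀ hu₀).1, (hab u₀ hu₀).2.2]
  have direction := fun u hu => exists_common_direction (pow_ne_zero 2 hc) hsum (hab u hu).1
    (hab u hu).2.1 (hab u hu).2.2
  refine ⟨a, b, fun u => (c ^ 2)⁻¹ • (a • secondForm 0 0 g u + b • secondForm 0 1 g u), hsum,
    (((h.contDiffOn_secondForm 0 0).const_smul a).add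
      ((h.contDiffOn_secondForm 0 1).const_smul b)).const_smul _,
    fun u hu => (direction u hu).1, fun u hu => ?_, fun u hu i => ?_, fun u hu => ?_,
    fun u hu => ?_⟩
  · simp [inner_add_right, inner_smul_right, h.inner_secondForm hu]
  · simp [inner_add_right, inner_smul_right, h.inner_pd_secondForm hu]
  · rw [← (direction u hu).2.1, h.secondForm_zero_zero hu]
    module
  · rw [← (direction u hu).2.2, h.secondForm_zero_one hu]

end FlatMinimal

section Frames

variable {ι W : Type*} [NormedAddCommGroup W] [InnerProductSpace ℝ W] {U : Set Plane}
  {E E' : ι → Plane → W} {u : Plane}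

theorem inner_pd_eq_neg_of_orthonormal (hU : IsOpen U) (hE : ∀ i, ContDiffOn ℝ ∞ (E i) U)
    (oE : ∀ u ∈ U, Orthonormal ℝ fun i => E i u) (hu : u ∈ U) (k : Fin 2) (i j : ι) :
    ⟪pd k (E i) u, E j u⟫_ℝ = -⟪pd k (E j) u, E i u⟫_ℝ := by
  classical
  have := inner_pd_add_inner_pd_of_const hU (hE i) (hE j) (k := if i = j then 1 else 0)
    (fun u hu => orthonormal_iff_ite.1 (oE u hu) i j) k hu
  rw [real_inner_comm (E i u)]
  exact eq_neg_of_add_eq_zero_left this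

theorem inner_pd_eq_of_lt [LinearOrder ι] (hU : IsOpen U) (hE : ∀ i, ContDiffOn ℝ ∞ (E i) U)
    (hE' : ∀ i, ContDiffOn ℝ ∞ (E' i) U) (oE : ∀ u ∈ U, Orthonormal ℝ fun i => E i u)
    (oE' : ∀ u ∈ U, Orthonormal ℝ fun i => E' i u) (hu : u ∈ U) {k : Fin 2}
    (hlt : ∀ i j, i < j → ⟪pd k (E i) u, E j u⟫_ℝ = ⟪pd k (E' i) u, E' j u⟫_ℝ) (i j : ι) :
    ⟪pd k (E i) u, E j u⟫_ℝ = ⟪pd k (E' i) u, E' j u⟫_ℝ := by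
  have skew := inner_pd_eq_neg_of_orthonormal hU hE oE hu k
  have skew' := inner_pd_eq_neg_of_orthonormal hU hE' oE' hu k
  rcases lt_trichotomy i j with h | rfl | h
  · exact hlt i j h
  · linarith [skew i i, skew' i i]
  · rw [skew, skew', hlt j i h]

variable [Fintype ι]

theorem sum_inner_smul_add_inner_smul_eq_zero (b b' : OrthonormalBasis ι ℝ W) {X X' : ι → W}
    (hX : ∀ i j, ⟪X i, b j⟫_ℝ = -⟪X j, b i⟫_ℝ) (hX' : ∀ i j, ⟪X i, b j⟫_ℝ = ⟪X' i, b' j⟫_ℝ)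
    (v : W) : ∑ i, (⟪X i, v⟫_ℝ • b' i + ⟪b i, v⟫_ℝ • X' i) = 0 := by
  classical
  refine InnerProductSpace.ext_inner_right_basis (𝕜 := ℝ) b'.toBasis fun k => ?_
  have hv : ∑ i, ⟪b i, v⟫_ℝ * ⟪X k, b i⟫_ℝ = ⟪X k, v⟫_ℝ := by
    rw [← b.sum_inner_mul_inner (X k) v]
    exact Finset.sum_congr rfl fun i _ => mul_comm _ _
  simp only [OrthonormalBasis.coe_toBasis, sum_inner, inner_add_left, inner_smul_left, ← hX',
    conj_trivial, Finset.sum_add_distrib, b'.inner_eq_ite, mul_ite, mul_one, mul_zero,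
    Finset.sum_ite_eq', Finset.mem_univ, if_true, inner_zero_left, hX _ k, mul_neg,
    Finset.sum_neg_distrib, hv, add_neg_cancel]

theorem exists_orthonormalBasis_of_orthonormal [FiniteDimensional ℝ W] {v : ι → W}
    (hv : Orthonormal ℝ v) (hcard : Fintype.card ι = Module.finrank ℝ W) :
    ∃ b : OrthonormalBasis ι ℝ W, ∀ i, b i = v i :=
  ⟨OrthonormalBasis.mk hv (hv.linearIndependent.span_eq_top_of_card_eq_finrank' hcard).ge,
    fun i => by simp⟩

theorem pd_inner_smul {p q : Plane → W} (hp : DifferentiableAt ℝ p u)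
    (hq : DifferentiableAt ℝ q u) (v : W) (k : Fin 2) :
    pd k (fun u => ⟪p u, v⟫_ℝ • q u) u = ⟪pd k p u, v⟫_ℝ • q u + ⟪p u, v⟫_ℝ • pd k q u := by
  have hv := differentiableAt_const (𝕜 := ℝ) (x := u) v
  rw [pd, fderiv_fun_smul (hp.inner ℝ hv) hq]
  simp [pd, fderiv_inner_apply ℝ hp hv, add_comm]

theorem pd_sum {f : ι → Plane → W} (hf : ∀ i, DifferentiableAt ℝ (f i) u) (k : Fin 2) :
    pd k (fun u => ∑ i, f i u) u = ∑ i, pd k (f i) u := by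
  rw [pd, fderiv_fun_sum fun i _ => hf i]
  simp [pd]

theorem exists_sum_inner_smul_eq [FiniteDimensional ℝ W]
    (hcard : Fintype.card ι = Module.finrank ℝ W) (hU : IsOpen U) (hc : IsPreconnected U)
    (hE : ∀ i, ContDiffOn ℝ ∞ (E i) U) (hE' : ∀ i, ContDiffOn ℝ ∞ (E' i) U)
    (oE : ∀ u ∈ U, Orthonormal ℝ fun i => E i u) (oE' : ∀ u ∈ U, Orthonormal ℝ fun i => E' i u)
    (hEE' : ∀ u ∈ U, ∀ k i j, ⟪pd k (E i) u, E j u⟫_ℝ = ⟪pd k (E' i) u, E' j u⟫_ℝ) (v : W) :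
    ∃ w, ∀ u ∈ U, ∑ i, ⟪E i u, v⟫_ℝ • E' i u = w := by
  have smooth : ∀ i, ContDiffOn ℝ ∞ (fun u => ⟪E i u, v⟫_ℝ • E' i u) U :=
    fun i => ((hE i).inner ℝ contDiffOn_const).smul (hE' i)
  refine exists_const_of_pd_eq_zero hU hc
    ((ContDiffOn.sum fun i _ => smooth i).differentiableOn (by simp)) fun u hu k => ?_
  obtain ⟨b, hb⟩ := exists_orthonormalBasis_of_orthonormal (oE u hu) hcard
  obtain ⟨b', hb'⟩ := exists_orthonormalBasis_of_orthonormal (oE' u hu) hcard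
  rw [pd_sum fun i => differentiableAt_of_contDiffOn hU (smooth i) hu,
    ← sum_inner_smul_add_inner_smul_eq_zero b b' (X := fun i => pd k (E i) u)
      (X' := fun i => pd k (E' i) u) (fun i j => ?_) (fun i j => ?_) v]
  · refine Finset.sum_congr rfl fun i _ => ?_
    rw [pd_inner_smul (differentiableAt_of_contDiffOn hU (hE i) hu)
      (differentiableAt_of_contDiffOn hU (hE' i) hu), hb, hb']
  · rw [hb, hb, inner_pd_eq_neg_of_orthonormal hU hE oE hu]
  · rw [hb, hb', hEE' u hu]

theorem exists_isometry_of_frames [FiniteDimensional ℝ W]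
    (hcard : Fintype.card ι = Module.finrank ℝ W) (hU : IsOpen U) (hc : IsPreconnected U)
    (hne : U.Nonempty) (hE : ∀ i, ContDiffOn ℝ ∞ (E i) U) (hE' : ∀ i, ContDiffOn ℝ ∞ (E' i) U)
    (oE : ∀ u ∈ U, Orthonormal ℝ fun i => E i u) (oE' : ∀ u ∈ U, Orthonormal ℝ fun i => E' i u)
    (hEE' : ∀ u ∈ U, ∀ k i j, ⟪pd k (E i) u, E j u⟫_ℝ = ⟪pd k (E' i) u, E' j u⟫_ℝ) :
    ∃ L : W ≃ₗᵢ[ℝ] W, ∀ u ∈ U, ∀ i, L (E i u) = E' i u := by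
  classical
  obtain ⟨u₀, hu₀⟩ := hne
  obtain ⟨b, hb⟩ := exists_orthonormalBasis_of_orthonormal (oE u₀ hu₀) hcard
  obtain ⟨b', hb'⟩ := exists_orthonormalBasis_of_orthonormal (oE' u₀ hu₀) hcard
  refine ⟨b.equiv b' (Equiv.refl ι), fun u hu j => ?_⟩
  obtain ⟨w, hw⟩ := exists_sum_inner_smul_eq hcard hU hc hE hE' oE oE' hEE' (E j u)
  calc b.equiv b' (Equiv.refl ι) (E j u)
      = b.equiv b' (Equiv.refl ι) (∑ i, ⟪b i, E j u⟫_ℝ • b i) := by rw [b.sum_repr']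
    _ = ∑ i, ⟪b i, E j u⟫_ℝ • b' i := by simp
    _ = ∑ i, ⟪E i u₀, E j u⟫_ℝ • E' i u₀ := by simp only [hb, hb']
    _ = ∑ i, ⟪E i u, E j u⟫_ℝ • E' i u := (hw u₀ hu₀).trans (hw u hu).symm
    _ = E' j u := by simp [orthonormal_iff_ite.1 (oE u hu)]

end Frames

section Rigidity

variable {W : Type*} [NormedAddCommGroup W] [InnerProductSpace ℝ W] {c a b : ℝ}
  {g g' η η' : Plane → W} {U V : Set Plane} {u : Plane}

theorem FlatMinimal.mono (h : FlatMinimal c g U) (hV : IsOpen V) (hVU : V ⊆ U) :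
    FlatMinimal c g V :=
  ⟨h.toFlatSpherical.mono hV hVU, fun u hu => h.harmonic u (hVU hu)⟩

namespace IsNormalField

theorem mono (h : IsNormalField c g U a b η) (hVU : V ⊆ U) : IsNormalField c g V a b η :=
  ⟨h.smooth.mono hVU, fun u hu => h.unit u (hVU hu), fun u hu => h.pos u (hVU hu),
    fun u hu => h.tangent u (hVU hu), fun u hu => h.xx u (hVU hu), fun u hu => h.xy u (hVU hu)⟩

theorem neg (h : IsNormalField c g U a b η) : IsNormalField c g U (-a) (-b) fun u => -η u :=
  ⟨h.smooth.neg, fun u hu => by simpa using h.unit u hu, fun u hu => by simpa using h.pos u hu,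
    fun u hu => by simpa using h.tangent u hu, fun u hu => by simpa using h.xx u hu,
    fun u hu => by simpa using h.xy u hu⟩

theorem pd_one_pd_one (hη : IsNormalField c g U a b η) (h : FlatMinimal c g U) (hu : u ∈ U) :
    pd 1 (pd 1 g) u = -g u - a • η u := by
  have := h.harmonic u hu
  rw [hη.xx u hu, ← eq_sub_iff_add_eq'] at this
  rw [this]
  module

theorem inner_pd_pd (hη : IsNormalField c g U a b η) (h : FlatMinimal c g U) (hu : u ∈ U) :
    ⟪pd 0 (pd 0 g) u, pd 0 (pd 0 g) u⟫_ℝ = c ^ 4 + a ^ 2 := by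
  rw [hη.xx u hu]
  simp only [inner_add_left, inner_add_right, inner_smul_left, inner_smul_right, h.unit u hu,
    hη.unit u hu, hη.pos u hu, real_inner_comm (g u) (η u), conj_trivial]
  ring

end IsNormalField

namespace FlatMinimal

/-- The orthonormal frame consisting of the position, the normalized coordinate fields and the
unit normal `η` of a flat minimal map. -/
noncomputable def frame (c : ℝ) (g η : Plane → W) : Fin 4 → Plane → W :=
  ![g, fun u => c⁻¹ • pd 0 g u, pd 1 g, η]

/-- The connection coefficients of `frame` in the `k`-th coordinate direction, above the
diagonal. -/
noncomputable def frameCoeff (c a b : ℝ) (k : Fin 2) : Fin 4 → Fin 4 → ℝ :=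
  ![![0, ![c, 0] k, ![0, 1] k, 0], ![0, 0, 0, ![c⁻¹ * a, c⁻¹ * b] k], ![0, 0, 0, ![b, -a] k], 0]

theorem contDiffOn_frame (h : FlatMinimal c g U) (hη : ContDiffOn ℝ ∞ η U) (i : Fin 4) :
    ContDiffOn ℝ ∞ (frame c g η i) U := by
  fin_cases i
  · exact h.smooth
  · exact (h.contDiffOn_pd 0).const_smul _
  · exact h.contDiffOn_pd 1
  · exact hη

theorem orthonormal_frame (h : FlatMinimal c g U) (hη : IsNormalField c g U a b η) (hc : c ≠ 0)
    (hu : u ∈ U) : Orthonormal ℝ fun i => frame c g η i u := by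
  have hpd := h.inner_pd hu
  have hpd' : ∀ i, ⟪pd i g u, g u⟫_ℝ = 0 := fun i => (real_inner_comm _ _).trans (hpd i)
  have htan := hη.tangent u hu
  have htan' : ∀ i, ⟪η u, pd i g u⟫_ℝ = 0 := fun i => (real_inner_comm _ _).trans (htan i)
  have hpos := hη.pos u hu
  have hpos' := (real_inner_comm _ _).trans hpos
  have hxy := h.inner_pd_zero_pd_one hu
  have hyx := (real_inner_comm _ _).trans hxy
  have hxx : c⁻¹ * (c⁻¹ * c ^ 2) = 1 := by field_simp
  rw [orthonormal_iff_ite]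
  intro i j
  fin_cases i <;> fin_cases j <;>
    simp [frame, inner_smul_left, inner_smul_right, hpd, hpd', htan, htan', hpos, hpos', hxy, hyx,
      hxx, h.unit u hu, h.inner_pd_zero_pd_zero hu, h.inner_pd_one_pd_one hu, hη.unit u hu,
      -inner_self_eq_norm_sq_to_K]

theorem inner_pd_frame (h : FlatMinimal c g U) (hη : IsNormalField c g U a b η) (hc : c ≠ 0)
    (hu : u ∈ U) (k : Fin 2) {i j : Fin 4} (hij : i < j) :
    ⟪pd k (frame c g η i) u, frame c g η j u⟫_ℝ = frameCoeff c a b k i j := by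
  have hyx := (real_inner_comm _ _).trans (h.inner_pd_zero_pd_one hu)
  have htan : ∀ i, ⟪η u, pd i g u⟫_ℝ = 0 :=
    fun i => (real_inner_comm _ _).trans (hη.tangent u hu i)
  have hxx : c⁻¹ * c ^ 2 = c := by field_simp
  fin_cases k <;> fin_cases i <;> fin_cases j <;> first
    | exact absurd hij (by decide)
    | simp [frame, frameCoeff, pd_const_smul, h.pd_pd_comm hu 1 0, hη.xx u hu, hη.xy u hu,
        hη.pd_one_pd_one h hu, inner_add_left, inner_sub_left, inner_smul_left, inner_smul_right,
        h.inner_pd hu, h.inner_pd_zero_pd_zero hu, h.inner_pd_zero_pd_one hu,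
        h.inner_pd_one_pd_one hu, hyx, hη.tangent u hu, htan, hη.pos u hu, hxx,
        hη.unit u hu, -inner_self_eq_norm_sq_to_K]

theorem exists_isometry [FiniteDimensional ℝ W] (hW : Module.finrank ℝ W = 4)
    (h : FlatMinimal c g U) (h' : FlatMinimal c g' U) (hη : IsNormalField c g U a b η)
    (hη' : IsNormalField c g' U a b η') (hc : c ≠ 0) (hU : IsPreconnected U)
    (hne : U.Nonempty) : ∃ L : W ≃ₗᵢ[ℝ] W, ∀ u ∈ U, L (g u) = g' u := by
  have smooth := h.contDiffOn_frame hη.smooth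
  have smooth' := h'.contDiffOn_frame hη'.smooth
  have ortho := fun u (hu : u ∈ U) => h.orthonormal_frame hη hc hu
  have ortho' := fun u (hu : u ∈ U) => h'.orthonormal_frame hη' hc hu
  obtain ⟨L, hL⟩ := exists_isometry_of_frames (by simp [hW]) h.isOpen hU hne smooth smooth' ortho
    ortho' fun u hu k => inner_pd_eq_of_lt h.isOpen smooth smooth' ortho ortho' hu
      fun i j hij => by rw [h.inner_pd_frame hη hc hu k hij, h'.inner_pd_frame hη' hc hu k hij]
  exact ⟨L, fun u hu => hL u hu 0⟩

end FlatMinimal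

/-- The reflection `(x, y) ↦ (x, -y)` of the plane. -/
noncomputable def reflect : Plane ≃ₗᵢ[ℝ] Plane :=
  LinearIsometryEquiv.piLpCongrRight 2 ![LinearIsometryEquiv.refl ℝ ℝ, LinearIsometryEquiv.neg ℝ]

theorem reflect_apply_zero (u : Plane) : reflect u 0 = u 0 := rfl

theorem reflect_apply_one (u : Plane) : reflect u 1 = -u 1 := rfl

theorem reflect_coordVec (i : Fin 2) : reflect (coordVec i) = (![1, -1] i : ℝ) • coordVec i := by
  ext j
  fin_cases i <;> fin_cases j <;> simp [coordVec, reflect_apply_zero, reflect_apply_one]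

theorem pd_comp_reflect (h : Plane → W) (i : Fin 2) :
    (pd i fun u => h (reflect u)) = fun u => (![1, -1] i : ℝ) • pd i h (reflect u) := by
  funext u
  have chain : fderiv ℝ (fun u => h (reflect u)) u
      = (fderiv ℝ h (reflect u)).comp (reflect.toContinuousLinearEquiv : Plane →L[ℝ] Plane) :=
    reflect.toContinuousLinearEquiv.comp_right_fderiv
  simp [pd, chain, reflect_coordVec]

theorem pd_pd_comp_reflect (h : Plane → W) (i j : Fin 2) :
    (pd i (pd j fun u => h (reflect u)))
      = fun u => (![1, -1] i * ![1, -1] j : ℝ) • pd i (pd j h) (reflect u) := by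
  funext u
  rw [pd_comp_reflect, pd_const_smul, pd_comp_reflect, smul_smul, mul_comm]

theorem FlatMinimal.comp_reflect (h : FlatMinimal c g U) :
    FlatMinimal c (fun u => g (reflect u)) (reflect ⁻¹' U) := by
  refine ⟨⟨h.isOpen.preimage reflect.continuous,
    h.smooth.comp reflect.contDiff.contDiffOn fun u hu => hu, fun u hu => h.unit _ hu,
    fun u hu i j => ?_⟩, fun u hu => ?_⟩
  · rw [pd_comp_reflect, pd_comp_reflect, inner_smul_left, inner_smul_right, h.metric _ hu]
    fin_cases i <;> fin_cases j <;> simp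
  · simpa [pd_pd_comp_reflect] using h.harmonic _ hu

theorem IsNormalField.comp_reflect (hη : IsNormalField c g U a b η) :
    IsNormalField c (fun u => g (reflect u)) (reflect ⁻¹' U) a (-b) fun u => η (reflect u) := by
  refine ⟨hη.smooth.comp reflect.contDiff.contDiffOn fun u hu => hu, fun u hu => hη.unit _ hu,
    fun u hu => hη.pos _ hu, fun u hu i => ?_, fun u hu => ?_, fun u hu => ?_⟩
  · rw [pd_comp_reflect, inner_smul_left, hη.tangent _ hu, mul_zero]
  · simpa [pd_pd_comp_reflect] using hη.xx _ hu
  · simpa [pd_pd_comp_reflect] using hη.xy _ hu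

end Rigidity

namespace FlatMinimal

variable {c : ℝ} {g g' : Plane → E4} {U : Set Plane} {u v : Plane}

theorem inner_pd_pd_mem_Icc (h : FlatMinimal c g U) (hc : c ≠ 0) (hU : IsPreconnected U)
    (hu : u ∈ U) :
    ⟪pd 0 (pd 0 g) u, pd 0 (pd 0 g) u⟫_ℝ ∈ Set.Icc (c ^ 4) (c ^ 4 + c ^ 2) := by
  obtain ⟨a, b, η, hab, hη⟩ := h.exists_normalField hc hU ⟨u, hu⟩
  rw [hη.inner_pd_pd h hu]
  constructor <;> nlinarith [sq_nonneg a, sq_nonneg b]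

theorem exists_isometry_or_reflect (h : FlatMinimal c g U) (h' : FlatMinimal c g' Set.univ)
    (hc : c ≠ 0) (hU : IsPreconnected U) (hu : u ∈ U)
    (huv : ⟪pd 0 (pd 0 g) u, pd 0 (pd 0 g) u⟫_ℝ = ⟪pd 0 (pd 0 g') v, pd 0 (pd 0 g') v⟫_ℝ) :
    ∃ L : E4 ≃ₗᵢ[ℝ] E4, (∀ u ∈ U, L (g u) = g' u) ∨ (∀ u ∈ U, L (g u) = g' (reflect u)) := by
  obtain ⟨a, b, η, hab, hη⟩ := h.exists_normalField hc hU ⟨u, hu⟩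
  obtain ⟨a', b', η', hab', hη'⟩ := h'.exists_normalField hc isPreconnected_univ ⟨v, trivial⟩
  rw [hη.inner_pd_pd h hu, hη'.inner_pd_pd h' trivial] at huv
  obtain ⟨b'', η'', hab'', hη''⟩ : ∃ b'' η'', a ^ 2 + b'' ^ 2 = c ^ 2 ∧
      IsNormalField c g' Set.univ a b'' η'' := by
    rcases sq_eq_sq_iff_eq_or_eq_neg.1 (add_left_cancel huv) with rfl | rfl
    · exact ⟨b', η', hab', hη'⟩
    · exact ⟨-b', _, by simpa using hab', hη'.neg⟩
  have hmono := h'.mono h.isOpen (Set.subset_univ U)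
  rcases sq_eq_sq_iff_eq_or_eq_neg.1 (add_left_cancel (hab.trans hab''.symm)) with rfl | rfl
  · obtain ⟨L, hL⟩ := h.exists_isometry (by simp) hmono hη (hη''.mono (Set.subset_univ _)) hc hU
      ⟨u, hu⟩
    exact ⟨L, Or.inl hL⟩
  · obtain ⟨L, hL⟩ := h.exists_isometry (by simp)
      (h'.comp_reflect.mono h.isOpen (Set.subset_univ _)) hη
      (hη''.comp_reflect.mono (Set.subset_univ _)) hc hU ⟨u, hu⟩
    exact ⟨L, Or.inr hL⟩

end FlatMinimal

section Components

/-- The point of `𝔼⁵ = 𝔼⁴ × ℝ` with given components. -/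
noncomputable def pair (g : E4) (t : ℝ) : E5 :=
  WithLp.toLp 2 (Fin.snoc (α := fun _ => ℝ) (fun i => g i) t)

@[simp] theorem horiz_apply (x : E5) (i : Fin 4) : horiz x i = x i.castSucc := rfl

@[simp] theorem horiz_pair (g : E4) (t : ℝ) : horiz (pair g t) = g := by
  ext i
  simp [pair]

@[simp] theorem pair_apply_four (g : E4) (t : ℝ) : pair g t 4 = t :=
  Fin.snoc_last (n := 4) (α := fun _ => ℝ) t (fun i => g i)

theorem ext_horiz {x y : E5} (h : horiz x = horiz y) (h4 : x 4 = y 4) : x = y := by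
  ext i
  refine Fin.lastCases h4 (fun j => ?_) i
  rw [← horiz_apply, ← horiz_apply, h]

theorem inner_eq_horiz (x y : E5) : ⟪x, y⟫_ℝ = ⟪horiz x, horiz y⟫_ℝ + x 4 * y 4 := by
  simp only [PiLp.inner_apply, Fin.sum_univ_castSucc (n := 4), horiz_apply]
  congr 1
  exact mul_comm _ _

/-- The point of `𝕊³ × ℝ` with given components. -/
noncomputable def point (p : Metric.sphere (0 : E4) 1) (t : ℝ) : S3xR :=
  ⟨pair p t, by rw [S3xR, Set.mem_ofPred_eq, horiz_pair, norm_eq_of_mem_sphere]⟩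

@[simp] theorem horiz_point (p : Metric.sphere (0 : E4) 1) (t : ℝ) : horiz (point p t) = p :=
  horiz_pair _ _

@[simp] theorem point_apply_four (p : Metric.sphere (0 : E4) 1) (t : ℝ) :
    (point p t : E5) 4 = t :=
  pair_apply_four _ _

/-- The component in `𝕊³` of a point of `𝕊³ × ℝ`. -/
noncomputable def toSphere (x : S3xR) : Metric.sphere (0 : E4) 1 :=
  ⟨horiz x, mem_sphere_zero_iff_norm.2 x.2⟩

theorem point_toSphere (x : S3xR) : point (toSphere x) ((x : E5) 4) = x :=
  Subtype.ext (ext_horiz (horiz_point _ _) (point_apply_four _ _))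

theorem geoDist_point_sq (p q : Metric.sphere (0 : E4) 1) (s t : ℝ) :
    geoDist (point p s) (point q t) ^ 2
      = InnerProductGeometry.angle (p : E4) q ^ 2 + (s - t) ^ 2 := by
  rw [geoDist, Real.sq_sqrt (by positivity), horiz_point, horiz_point, point_apply_four,
    point_apply_four]

end Components

section Sphere

variable {W : Type*} [NormedAddCommGroup W] [InnerProductSpace ℝ W]

theorem inner_eq_cos_angle_of_norm_eq_one {p q : W} (hp : ‖p‖ = 1) (hq : ‖q‖ = 1) :
    ⟪p, q⟫_ℝ = Real.cos (InnerProductGeometry.angle p q) := by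
  simp [InnerProductGeometry.cos_angle, hp, hq]

theorem eq_of_angle_eq_zero {p q : W} (hp : ‖p‖ = 1) (hq : ‖q‖ = 1)
    (h : InnerProductGeometry.angle p q = 0) : p = q := by
  rw [← inner_eq_one_iff_of_norm_eq_one (𝕜 := ℝ) hp hq, inner_eq_cos_angle_of_norm_eq_one hp hq, h,
    Real.cos_zero]

theorem angle_sq_le_pi_sq (p q : W) : InnerProductGeometry.angle p q ^ 2 ≤ Real.pi ^ 2 :=
  pow_le_pow_left₀ (InnerProductGeometry.angle_nonneg p q)
    (InnerProductGeometry.angle_le_pi p q) 2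

theorem exists_linearIsometryEquiv_of_sphere [FiniteDimensional ℝ W]
    {α : Metric.sphere (0 : W) 1 → W} (hα : ∀ p q, ⟪α p, α q⟫_ℝ = ⟪(p : W), q⟫_ℝ) :
    ∃ L : W ≃ₗᵢ[ℝ] W, ∀ p, α p = L p := by
  set e := stdOrthonormalBasis ℝ W
  have he : ∀ i, e i ∈ Metric.sphere (0 : W) 1 :=
    fun i => mem_sphere_zero_iff_norm.2 (e.norm_eq_one i)
  obtain ⟨b, hb⟩ := exists_orthonormalBasis_of_orthonormal (v := fun i => α ⟨e i, he i⟩)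
    (orthonormal_iff_ite.2 fun i j => by rw [hα, e.inner_eq_ite]) (by simp)
  refine ⟨e.equiv b (Equiv.refl _), fun p => ?_⟩
  calc α p = ∑ i, ⟪b i, α p⟫_ℝ • b i := (b.sum_repr' _).symm
    _ = ∑ i, ⟪e i, p⟫_ℝ • b i := by simp only [hb, hα]
    _ = e.equiv b (Equiv.refl _) (∑ i, ⟪e i, p⟫_ℝ • e i) := by simp
    _ = e.equiv b (Equiv.refl _) p := by rw [e.sum_repr']

end Sphere

section RealLine

variable {h : ℝ → ℝ} {K : ℝ}

theorem le_abs_sub_of_bounded_defect (hle : ∀ s t, (h s - h t) ^ 2 ≤ (s - t) ^ 2)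
    (hge : ∀ s t, (s - t) ^ 2 ≤ (h s - h t) ^ 2 + K) {s t : ℝ} (hst : s ≤ t) :
    t - s ≤ |h s - h t| := by
  by_contra! hlt
  obtain ⟨n, hn⟩ := exists_nat_gt (K / (t - s - |h s - h t|))
  rw [div_lt_iff₀ (sub_pos.2 hlt)] at hn
  have hfar : |h t - h (t + n)| ≤ n :=
    abs_le_of_sq_le_sq (by simpa using hle t (t + n)) n.cast_nonneg
  have htri : |h s - h (t + n)| ≤ |h s - h t| + n := (abs_sub_le _ _ _).trans (by gcongr)
  have hsq : (s - (t + n)) ^ 2 ≤ (|h s - h t| + n) ^ 2 + K := by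
    refine (hge s (t + n)).trans (add_le_add_left ?_ K)
    rw [← sq_abs]
    gcongr
  nlinarith [abs_nonneg (h s - h t), (n.cast_nonneg : (0 : ℝ) ≤ n)]

theorem sub_sq_eq_of_bounded_defect (hle : ∀ s t, (h s - h t) ^ 2 ≤ (s - t) ^ 2)
    (hge : ∀ s t, (s - t) ^ 2 ≤ (h s - h t) ^ 2 + K) (s t : ℝ) :
    (h s - h t) ^ 2 = (s - t) ^ 2 := by
  refine (hle s t).antisymm (sq_le_sq.2 ?_)
  rcases le_total s t with hst | hst
  · rw [abs_sub_comm s, abs_of_nonneg (sub_nonneg.2 hst)]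
    exact le_abs_sub_of_bounded_defect hle hge hst
  · rw [abs_of_nonneg (sub_nonneg.2 hst), abs_sub_comm]
    exact le_abs_sub_of_bounded_defect hle hge hst

theorem exists_affine_of_sub_sq_eq (hh : ∀ s t, (h s - h t) ^ 2 = (s - t) ^ 2) :
    ∃ ε τ : ℝ, ε ^ 2 = 1 ∧ ∀ t, h t = ε * t + τ := by
  refine ⟨h 1 - h 0, h 0, by simpa using hh 1 0, fun t => ?_⟩
  have hmul : (h t - h 0) * (h 1 - h 0) = t := by
    linear_combination (hh t 0 + hh 1 0 - hh t 1) / 2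
  linear_combination (h 1 - h 0) * hmul - (h t - h 0) * hh 1 0

theorem affine_eq_of_add_sub_sq_eq {ε ε' τ τ' A B : ℝ} (hε : ε ^ 2 = 1) (hε' : ε' ^ 2 = 1)
    (hAB : ∀ s t, A + (ε * s + τ - (ε' * t + τ')) ^ 2 = B + (s - t) ^ 2) :
    ε = ε' ∧ τ = τ' ∧ A = B := by
  have hτ : τ = τ' := by linear_combination ε / 4 * (hAB 1 0 - hAB (-1) 0) - (τ - τ') * hε
  subst hτ
  refine ⟨?_, rfl, by simpa using hAB 0 0⟩
  linear_combination ε' / 2 * (hAB 0 0 - hAB 1 1 + hε + hε') - ε * hε'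

end RealLine

namespace Isom

theorem angle_sq_add_height_sub_sq (Φ : Isom) (p q : Metric.sphere (0 : E4) 1) (s t : ℝ) :
    InnerProductGeometry.angle (horiz (Φ.toEquiv (point p s))) (horiz (Φ.toEquiv (point q t))) ^ 2
      + ((Φ.toEquiv (point p s) : E5) 4 - (Φ.toEquiv (point q t) : E5) 4) ^ 2
    = InnerProductGeometry.angle (p : E4) q ^ 2 + (s - t) ^ 2 := by
  rw [← geoDist_point_sq, ← Φ.geoDist_map, geoDist, Real.sq_sqrt (by positivity)]

theorem height_sub_sq (Φ : Isom) (p : Metric.sphere (0 : E4) 1) (s t : ℝ) :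
    ((Φ.toEquiv (point p s) : E5) 4 - (Φ.toEquiv (point p t) : E5) 4) ^ 2 = (s - t) ^ 2 := by
  have hdist : ∀ s t, _ = (s - t) ^ 2 := fun s t =>
    (Φ.angle_sq_add_height_sub_sq p p s t).trans <| by
      rw [InnerProductGeometry.angle_self (x := (p : E4)) (ne_zero_of_mem_unit_sphere p),
        zero_pow two_ne_zero, zero_add]
  refine sub_sq_eq_of_bounded_defect (h := fun t => (Φ.toEquiv (point p t) : E5) 4)
    (K := Real.pi ^ 2) (fun s t => ?_) (fun s t => ?_) s t
  · rw [← hdist s t]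
    exact le_add_of_nonneg_left (sq_nonneg _)
  · rw [← hdist s t, add_comm]
    exact add_le_add_right (angle_sq_le_pi_sq _ _) _

theorem horiz_apply_point (Φ : Isom) (p : Metric.sphere (0 : E4) 1) (s t : ℝ) :
    horiz (Φ.toEquiv (point p s)) = horiz (Φ.toEquiv (point p t)) := by
  have hdist := Φ.angle_sq_add_height_sub_sq p p s t
  rw [Φ.height_sub_sq,
    InnerProductGeometry.angle_self (x := (p : E4)) (ne_zero_of_mem_unit_sphere p)] at hdist
  exact eq_of_angle_eq_zero (W := E4) (Φ.toEquiv _).2 (Φ.toEquiv _).2 (by simpa using hdist)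

theorem exists_height_eq (Φ : Isom) : ∃ ε τ : ℝ, ε ^ 2 = 1 ∧
    ∀ x, (Φ.toEquiv x : E5) 4 = ε * (x : E5) 4 + τ := by
  choose ε τ hε hτ using fun p => exists_affine_of_sub_sq_eq (Φ.height_sub_sq p)
  set p₀ : Metric.sphere (0 : E4) 1 := ⟨EuclideanSpace.single 0 1, by simp⟩
  refine ⟨ε p₀, τ p₀, hε p₀, fun x => ?_⟩
  have hdist := Φ.angle_sq_add_height_sub_sq (toSphere x) p₀
  simp only [hτ, Φ.horiz_apply_point _ _ 0] at hdist
  obtain ⟨h₁, h₂, -⟩ := affine_eq_of_add_sub_sq_eq (hε (toSphere x)) (hε p₀) hdist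
  rw [← h₁, ← h₂, ← hτ, point_toSphere]

theorem exists_eq (Φ : Isom) : ∃ (L : E4 ≃ₗᵢ[ℝ] E4) (ε τ : ℝ), ε ^ 2 = 1 ∧
    ∀ x, horiz (Φ.toEquiv x) = L (horiz x) ∧ (Φ.toEquiv x : E5) 4 = ε * (x : E5) 4 + τ := by
  obtain ⟨ε, τ, hε, hheight⟩ := Φ.exists_height_eq
  obtain ⟨L, hL⟩ := exists_linearIsometryEquiv_of_sphere
    (α := fun p => horiz (Φ.toEquiv (point p 0))) fun p q => by
      have hangle := Φ.angle_sq_add_height_sub_sq p q 0 0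
      rw [hheight, hheight, point_apply_four, point_apply_four, sub_self, sub_self, add_left_inj,
        sq_eq_sq₀ (InnerProductGeometry.angle_nonneg _ _)
          (InnerProductGeometry.angle_nonneg _ _)] at hangle
      rw [inner_eq_cos_angle_of_norm_eq_one (Φ.toEquiv _).2 (Φ.toEquiv _).2, hangle,
        inner_eq_cos_angle_of_norm_eq_one (norm_eq_of_mem_sphere p) (norm_eq_of_mem_sphere q)]
  refine ⟨L, ε, τ, hε, fun x => ⟨?_, hheight x⟩⟩
  calc horiz (Φ.toEquiv x)
      = horiz (Φ.toEquiv (point (toSphere x) ((x : E5) 4))) := by rw [point_toSphere]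
    _ = horiz (Φ.toEquiv (point (toSphere x) 0)) := Φ.horiz_apply_point _ _ _
    _ = L (horiz x) := hL _

/-- The isometry of `𝕊³ × ℝ` induced by an orthogonal map of `𝔼⁴`. -/
noncomputable def ofLinearIsometry (L : E4 ≃ₗᵢ[ℝ] E4) : Isom where
  toEquiv :=
    { toFun x := ⟨pair (L (horiz x)) ((x : E5) 4), by
        change ‖horiz _‖ = 1
        rw [horiz_pair, L.norm_map, x.2]⟩
      invFun x := ⟨pair (L.symm (horiz x)) ((x : E5) 4), by
        change ‖horiz _‖ = 1
        rw [horiz_pair, L.symm.norm_map, x.2]⟩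
      left_inv x := Subtype.ext (ext_horiz (by simp) (by simp))
      right_inv x := Subtype.ext (ext_horiz (by simp) (by simp)) }
  geoDist_map x y := by simp [geoDist, InnerProductGeometry.angle]

theorem coe_ofLinearIsometry (L : E4 ≃ₗᵢ[ℝ] E4) (x : S3xR) :
    ((ofLinearIsometry L).toEquiv x : E5) = pair (L (horiz x)) ((x : E5) 4) := rfl

end Isom

section Torus

/-- The linear form `(x, y) ↦ kx + ly` on the plane. -/
noncomputable def phase (k l : ℝ) : Plane →L[ℝ] ℝ :=
  k • EuclideanSpace.proj 0 + l • EuclideanSpace.proj 1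

@[simp] theorem phase_apply (k l : ℝ) (u : Plane) : phase k l u = k * u 0 + l * u 1 := by
  simp [phase]

/-- The map of the plane to a product of two circles of radii `a` and `b` whose angles are the
linear forms `φ` and `χ`. -/
noncomputable def torus (φ χ : Plane →L[ℝ] ℝ) (a b : ℝ) (u : Plane) : E4 :=
  !₂[a * Real.cos (φ u), a * Real.sin (φ u), b * Real.cos (χ u), b * Real.sin (χ u)]

/-- The map `torus`, turned by a right angle in both circles. -/
noncomputable def torusTurn (φ χ : Plane →L[ℝ] ℝ) (a b : ℝ) (u : Plane) : E4 :=
  !₂[-a * Real.sin (φ u), a * Real.cos (φ u), -b * Real.sin (χ u), b * Real.cos (χ u)]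

variable (φ χ : Plane →L[ℝ] ℝ) (a b a' b' : ℝ)

theorem contDiff_torus {n : WithTop ℕ∞} : ContDiff ℝ n (torus φ χ a b) := by
  refine contDiff_euclidean.2 fun i => ?_
  fin_cases i <;> simp only [torus] <;> dsimp <;> fun_prop

theorem contDiff_torusTurn {n : WithTop ℕ∞} : ContDiff ℝ n (torusTurn φ χ a b) := by
  refine contDiff_euclidean.2 fun i => ?_
  fin_cases i <;> simp only [torusTurn] <;> dsimp <;> fun_prop

theorem fderiv_euclidean_apply {ι : Type*} [Finite ι] {h : Plane → EuclideanSpace ℝ ι} {u : Plane}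
    (hh : DifferentiableAt ℝ h u) (z : Plane) (j : ι) :
    fderiv ℝ h u z j = fderiv ℝ (fun u => h u j) u z := by
  have := Fintype.ofFinite ι
  have hcomp := (EuclideanSpace.proj (𝕜 := ℝ) j).hasFDerivAt.comp u hh.hasFDerivAt
  exact (congr($(hcomp.fderiv) z)).symm

theorem pd_apply {ι : Type*} [Fintype ι] {h : Plane → EuclideanSpace ℝ ι} {u : Plane}
    (hh : DifferentiableAt ℝ h u) (i : Fin 2) (j : ι) :
    pd i h u j = pd i (fun u => h u j) u :=
  fderiv_euclidean_apply hh (coordVec i) j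

theorem pd_mul_cos (i : Fin 2) (u : Plane) :
    pd i (fun u => a * Real.cos (φ u)) u = -(a * φ (coordVec i)) * Real.sin (φ u) := by
  rw [pd, (φ.hasFDerivAt.cos.const_mul a).fderiv, smul_apply, smul_apply,
    smul_eq_mul, smul_eq_mul]
  ring

theorem pd_mul_sin (i : Fin 2) (u : Plane) :
    pd i (fun u => a * Real.sin (φ u)) u = a * φ (coordVec i) * Real.cos (φ u) := by
  rw [pd, (φ.hasFDerivAt.sin.const_mul a).fderiv, smul_apply, smul_apply,
    smul_eq_mul, smul_eq_mul]
  ring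

theorem pd_torus (i : Fin 2) : pd i (torus φ χ a b) =
    torusTurn φ χ (a * φ (coordVec i)) (b * χ (coordVec i)) := by
  ext u j
  rw [pd_apply ((contDiff_torus φ χ a b).differentiable one_ne_zero u)]
  fin_cases j
  · exact pd_mul_cos φ a i u
  · exact pd_mul_sin φ a i u
  · exact pd_mul_cos χ b i u
  · exact pd_mul_sin χ b i u

theorem pd_torusTurn (i : Fin 2) : pd i (torusTurn φ χ a b) =
    torus φ χ (-a * φ (coordVec i)) (-b * χ (coordVec i)) := by
  ext u j
  rw [pd_apply ((contDiff_torusTurn φ χ a b).differentiable one_ne_zero u)]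
  fin_cases j
  · exact pd_mul_sin φ (-a) i u
  · exact (pd_mul_cos φ a i u).trans (by simp [torus])
  · exact pd_mul_sin χ (-b) i u
  · exact (pd_mul_cos χ b i u).trans (by simp [torus])

theorem inner_torus (u : Plane) :
    ⟪torus φ χ a b u, torus φ χ a' b' u⟫_ℝ = a * a' + b * b' := by
  simp only [torus, PiLp.inner_apply, Fin.sum_univ_four, RCLike.inner_apply, conj_trivial,
    Matrix.cons_val]
  linear_combination a * a' * Real.sin_sq_add_cos_sq (φ u) + b * b' * Real.sin_sq_add_cos_sq (χ u)

theorem inner_torusTurn (u : Plane) :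
    ⟪torusTurn φ χ a b u, torusTurn φ χ a' b' u⟫_ℝ = a * a' + b * b' := by
  simp only [torusTurn, PiLp.inner_apply, Fin.sum_univ_four, RCLike.inner_apply, conj_trivial,
    Matrix.cons_val]
  linear_combination a * a' * Real.sin_sq_add_cos_sq (φ u) + b * b' * Real.sin_sq_add_cos_sq (χ u)

theorem torus_add (u : Plane) :
    torus φ χ a b u + torus φ χ a' b' u = torus φ χ (a + a') (b + b') u := by
  ext j
  fin_cases j <;> simp [torus, add_mul]

theorem smul_torus (r : ℝ) (u : Plane) : r • torus φ χ a b u = torus φ χ (r * a) (r * b) u := by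
  ext j
  fin_cases j <;> simp [torus, mul_assoc]

variable {a b} {c k l k' l' : ℝ}

theorem phase_coordVec (k l : ℝ) (i : Fin 2) : phase k l (coordVec i) = ![k, l] i := by
  fin_cases i <;> simp [coordVec]

theorem flatMinimal_torus (h0 : a ^ 2 + b ^ 2 = 1)
    (hxx : a ^ 2 * k ^ 2 + b ^ 2 * k' ^ 2 = c ^ 2) (hxy : a ^ 2 * (k * l) + b ^ 2 * (k' * l') = 0)
    (hyy : a ^ 2 * l ^ 2 + b ^ 2 * l' ^ 2 = 1) (h1 : k ^ 2 + l ^ 2 = 1 + c ^ 2)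
    (h2 : k' ^ 2 + l' ^ 2 = 1 + c ^ 2) :
    FlatMinimal c (torus (phase k l) (phase k' l') a b) Set.univ where
  isOpen := isOpen_univ
  smooth := (contDiff_torus _ _ _ _).contDiffOn
  unit u _ := by rw [inner_torus, ← sq, ← sq, h0]
  metric u _ i j := by
    rw [pd_torus, pd_torus, inner_torusTurn]
    revert i j
    simp only [Fin.forall_fin_two, phase_coordVec, Matrix.of_apply, Matrix.cons_val]
    refine ⟨⟨?_, ?_⟩, ?_, ?_⟩
    · linear_combination hxx
    · linear_combination hxy
    · linear_combination hxy
    · linear_combination hyy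
  harmonic u _ := by
    simp only [pd_torus, pd_torusTurn, torus_add, smul_torus, phase_coordVec, Matrix.cons_val]
    congr 1
    · linear_combination -a * h1
    · linear_combination -b * h2

theorem inner_pd_pd_torus (u : Plane) :
    ⟪pd 0 (pd 0 (torus (phase k l) (phase k' l') a b)) u,
      pd 0 (pd 0 (torus (phase k l) (phase k' l') a b)) u⟫_ℝ
    = a ^ 2 * (k ^ 2) ^ 2 + b ^ 2 * (k' ^ 2) ^ 2 := by
  simp only [pd_torus, pd_torusTurn, inner_torus, phase_coordVec, Matrix.cons_val]
  ring

end Torus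

section Model

/-- The component in `𝕊³` of the explicit map `model`. -/
noncomputable def modelS3 (θ ν : ℝ) (u : Plane) : E4 := horiz (model θ ν (u 0) (u 1))

theorem modelS3_eq (θ ν : ℝ) : modelS3 θ ν =
    torus (phase (mu1 θ ν) (nu2 θ ν)) (phase (mu2 θ ν) (-ν)) (c1 θ ν) (c2 θ ν) := by
  ext u j
  fin_cases j <;> simp [modelS3, model, torus, horiz, sub_eq_add_neg]

theorem model_apply_four (θ ν x y : ℝ) : model θ ν x y 4 = x * Real.sin θ := by
  simp [model]

theorem model_eq_pair (θ ν : ℝ) (u : Plane) :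
    model θ ν (u 0) (u 1) = pair (modelS3 θ ν u) (u 0 * Real.sin θ) :=
  ext_horiz (horiz_pair _ _).symm (by rw [pair_apply_four, model_apply_four])

variable {θ ν : ℝ}

theorem one_sub_sq_mul_sin_sq_pos (hθ : Real.cos θ ≠ 0) (hν : ν ^ 2 ≤ 1 + Real.cos θ ^ 2) :
    0 < 1 - ν ^ 2 * Real.sin θ ^ 2 := by
  calc 0 < Real.cos θ ^ 2 * Real.cos θ ^ 2 := by positivity
    _ = 1 - (1 + Real.cos θ ^ 2) * Real.sin θ ^ 2 := by rw [Real.sin_sq]; ring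
    _ ≤ 1 - ν ^ 2 * Real.sin θ ^ 2 := by gcongr

theorem add_one_sub_sq_mul_sin_sq_pos (hθ : Real.cos θ ≠ 0) (hν : ν ^ 2 ≤ 1 + Real.cos θ ^ 2) :
    0 < 1 + Real.cos θ ^ 2 - ν ^ 2 * Real.sin θ ^ 2 := by
  linarith [one_sub_sq_mul_sin_sq_pos hθ hν, sq_nonneg (Real.cos θ)]

theorem c1_sq (hθ : Real.cos θ ≠ 0) (hν : ν ^ 2 ≤ 1 + Real.cos θ ^ 2) :
    c1 θ ν ^ 2 = (1 - ν ^ 2 * Real.sin θ ^ 2) / (1 + Real.cos θ ^ 2 - ν ^ 2 * Real.sin θ ^ 2) :=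
  Real.sq_sqrt (div_nonneg (one_sub_sq_mul_sin_sq_pos hθ hν).le
    (add_one_sub_sq_mul_sin_sq_pos hθ hν).le)

theorem c2_sq (hθ : Real.cos θ ≠ 0) (hν : ν ^ 2 ≤ 1 + Real.cos θ ^ 2) :
    c2 θ ν ^ 2 = Real.cos θ ^ 2 / (1 + Real.cos θ ^ 2 - ν ^ 2 * Real.sin θ ^ 2) :=
  Real.sq_sqrt (div_nonneg (sq_nonneg _) (add_one_sub_sq_mul_sin_sq_pos hθ hν).le)

theorem mu1_sq (hθ : Real.cos θ ≠ 0) (hν : ν ^ 2 ≤ 1 + Real.cos θ ^ 2) :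
    mu1 θ ν ^ 2 = ν ^ 2 * Real.cos θ ^ 4 / (1 - ν ^ 2 * Real.sin θ ^ 2) :=
  Real.sq_sqrt (div_nonneg (by positivity) (one_sub_sq_mul_sin_sq_pos hθ hν).le)

theorem mu2_sq (hν : ν ^ 2 ≤ 1 + Real.cos θ ^ 2) : mu2 θ ν ^ 2 = 1 + Real.cos θ ^ 2 - ν ^ 2 :=
  Real.sq_sqrt (sub_nonneg.2 hν)

theorem nu2_sq (hθ : Real.cos θ ≠ 0) (hν : ν ^ 2 ≤ 1 + Real.cos θ ^ 2) :
    nu2 θ ν ^ 2 = (1 + Real.cos θ ^ 2 - ν ^ 2) / (1 - ν ^ 2 * Real.sin θ ^ 2) :=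
  Real.sq_sqrt (div_nonneg (sub_nonneg.2 hν) (one_sub_sq_mul_sin_sq_pos hθ hν).le)

theorem mu1_mul_nu2 (hθ : Real.cos θ ≠ 0) (hν0 : 0 ≤ ν) (hν : ν ^ 2 ≤ 1 + Real.cos θ ^ 2) :
    mu1 θ ν * nu2 θ ν = ν * Real.cos θ ^ 2 * mu2 θ ν / (1 - ν ^ 2 * Real.sin θ ^ 2) := by
  have hD := one_sub_sq_mul_sin_sq_pos hθ hν
  have hr : 0 ≤ ν * Real.cos θ ^ 2 * mu2 θ ν / (1 - ν ^ 2 * Real.sin θ ^ 2) :=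
    div_nonneg (mul_nonneg (by positivity) (Real.sqrt_nonneg _)) hD.le
  have hl : 0 ≤ mu1 θ ν * nu2 θ ν := mul_nonneg (Real.sqrt_nonneg _) (Real.sqrt_nonneg _)
  rw [← sq_eq_sq₀ hl hr, mul_pow, div_pow, mul_pow, mu1_sq hθ hν, nu2_sq hθ hν, mu2_sq hν]
  field_simp

theorem flatMinimal_modelS3 (hθ : Real.cos θ ≠ 0) (hν0 : 0 ≤ ν) (hν : ν ^ 2 ≤ 1 + Real.cos θ ^ 2) :
    FlatMinimal (Real.cos θ) (modelS3 θ ν) Set.univ := by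
  have hD := (one_sub_sq_mul_sin_sq_pos hθ hν).ne'
  have hE := (add_one_sub_sq_mul_sin_sq_pos hθ hν).ne'
  rw [modelS3_eq]
  apply flatMinimal_torus
  · rw [c1_sq hθ hν, c2_sq hθ hν]
    field_simp
    ring
  · rw [c1_sq hθ hν, c2_sq hθ hν, mu1_sq hθ hν, mu2_sq hν]
    field_simp
    rw [Real.sin_sq]
    ring
  · rw [c1_sq hθ hν, c2_sq hθ hν, mu1_mul_nu2 hθ hν0 hν]
    field_simp
    ring
  · rw [c1_sq hθ hν, c2_sq hθ hν, nu2_sq hθ hν, neg_sq]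
    field_simp
    rw [Real.sin_sq]
    ring
  · rw [mu1_sq hθ hν, nu2_sq hθ hν]
    field_simp
    rw [Real.sin_sq]
    ring
  · rw [mu2_sq hν]
    ring

theorem inner_pd_pd_modelS3 (hθ : Real.cos θ ≠ 0) (hν : ν ^ 2 ≤ 1 + Real.cos θ ^ 2) (u : Plane) :
    ⟪pd 0 (pd 0 (modelS3 θ ν)) u, pd 0 (pd 0 (modelS3 θ ν)) u⟫_ℝ
    = Real.cos θ ^ 2 * (1 + Real.cos θ ^ 2 - ν ^ 2)
      + ν ^ 2 * Real.cos θ ^ 4 * (ν ^ 2 - 1) / (1 - ν ^ 2 * Real.sin θ ^ 2) := by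
  have hD := (one_sub_sq_mul_sin_sq_pos hθ hν).ne'
  have hE := (add_one_sub_sq_mul_sin_sq_pos hθ hν).ne'
  rw [modelS3_eq, inner_pd_pd_torus, c1_sq hθ hν, c2_sq hθ hν, mu1_sq hθ hν, mu2_sq hν]
  field_simp
  rw [Real.sin_sq]
  ring

theorem sq_le_of_mem_Icc (hν : ν ∈ Set.Icc 1 √(1 + Real.cos θ ^ 2)) :
    ν ^ 2 ≤ 1 + Real.cos θ ^ 2 :=
  (Real.le_sqrt' (zero_lt_one.trans_le hν.1)).1 hν.2

theorem exists_inner_pd_pd_modelS3_eq (hθ : Real.cos θ ≠ 0) {r : ℝ}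
    (hr : r ∈ Set.Icc (Real.cos θ ^ 4) (Real.cos θ ^ 4 + Real.cos θ ^ 2)) :
    ∃ ν ∈ Set.Icc 1 √(1 + Real.cos θ ^ 2), ∀ u,
      ⟪pd 0 (pd 0 (modelS3 θ ν)) u, pd 0 (pd 0 (modelS3 θ ν)) u⟫_ℝ = r := by
  set ψ : ℝ → ℝ := fun ν => Real.cos θ ^ 2 * (1 + Real.cos θ ^ 2 - ν ^ 2)
      + ν ^ 2 * Real.cos θ ^ 4 * (ν ^ 2 - 1) / (1 - ν ^ 2 * Real.sin θ ^ 2) with hψ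
  have hcont : ContinuousOn ψ (Set.Icc 1 √(1 + Real.cos θ ^ 2)) :=
    ContinuousOn.add (by fun_prop) (ContinuousOn.div (by fun_prop) (by fun_prop)
      fun ν hν => (one_sub_sq_mul_sin_sq_pos hθ (sq_le_of_mem_Icc hν)).ne')
  have hleft : ψ 1 = Real.cos θ ^ 4 := by
    rw [hψ]
    ring
  have hright : ψ √(1 + Real.cos θ ^ 2) = Real.cos θ ^ 4 + Real.cos θ ^ 2 := by
    have hD : 1 - (1 + Real.cos θ ^ 2) * Real.sin θ ^ 2 = Real.cos θ ^ 4 := by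
      rw [Real.sin_sq]
      ring
    simp only [hψ, Real.sq_sqrt (show 0 ≤ 1 + Real.cos θ ^ 2 by positivity), hD]
    field_simp
    ring
  obtain ⟨ν, hν, hψν⟩ := intermediate_value_Icc
    (Real.one_le_sqrt.2 (le_add_of_nonneg_right (sq_nonneg _))) hcont
    (show r ∈ Set.Icc _ _ by rwa [hleft, hright])
  exact ⟨ν, hν, fun u => (inner_pd_pd_modelS3 hθ (sq_le_of_mem_Icc hν) u).trans hψν⟩

end Model

section SecondDerivative

variable {V W X : Type*} [NormedAddCommGroup V] [NormedSpace ℝ V] [NormedAddCommGroup W]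
  [NormedSpace ℝ W] [NormedAddCommGroup X] [NormedSpace ℝ X]

theorem fderiv_fderiv_comp {f : W → X} {τ : V → W} {u : V} (hf : ContDiffAt ℝ 2 f (τ u))
    (hτ : ContDiffAt ℝ 2 τ u) (v w : V) :
    fderiv ℝ (fderiv ℝ (f ∘ τ)) u v w
      = fderiv ℝ (fderiv ℝ f) (τ u) (fderiv ℝ τ u v) (fderiv ℝ τ u w)
        + fderiv ℝ f (τ u) (fderiv ℝ (fderiv ℝ τ) u v w) := by
  have hchain : fderiv ℝ (f ∘ τ) =ᶠ[nhds u] fun x => (fderiv ℝ f (τ x)).comp (fderiv ℝ τ x) := by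
    filter_upwards [hτ.continuousAt.eventually (hf.eventually (by simp)),
      hτ.eventually (by simp)] with x hx hx'
    exact fderiv_comp x (hx.differentiableAt two_ne_zero) (hx'.differentiableAt two_ne_zero)
  have hf' : DifferentiableAt ℝ (fderiv ℝ f) (τ u) :=
    (hf.fderiv_right (m := 1) (by norm_num)).differentiableAt one_ne_zero
  have hτ' : DifferentiableAt ℝ (fderiv ℝ τ) u :=
    (hτ.fderiv_right (m := 1) (by norm_num)).differentiableAt one_ne_zero
  have hcomp := hf'.hasFDerivAt.comp u (hτ.differentiableAt two_ne_zero).hasFDerivAt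
  rw [((hcomp.clm_comp hτ'.hasFDerivAt).congr_of_eventuallyEq hchain).fderiv, add_comm]
  rfl

end SecondDerivative

section Gram

variable {V W X ι : Type*} [NormedAddCommGroup V] [NormedSpace ℝ V] [NormedAddCommGroup W]
  [InnerProductSpace ℝ W] [NormedAddCommGroup X] [NormedSpace ℝ X] [Fintype ι]

theorem transpose_toMatrix_mul_gram_mul (b : Module.Basis ι ℝ V) (D : V →L[ℝ] W) (v : ι → V) :
    (b.toMatrix v).transpose * Matrix.gram ℝ (D ∘ b) * b.toMatrix v = Matrix.gram ℝ (D ∘ v) := by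
  ext k l
  simp only [Matrix.gram_apply, Function.comp_apply]
  conv_rhs => rw [← b.sum_toMatrix_smul_self v k, ← b.sum_toMatrix_smul_self v l]
  simp only [Matrix.mul_apply, Matrix.transpose_apply, Matrix.gram_apply, map_sum, map_smul,
    sum_inner, inner_sum, real_inner_smul_left, real_inner_smul_right, Finset.sum_mul,
    Function.comp_apply]
  exact Finset.sum_congr rfl fun i _ => Finset.sum_congr rfl fun j _ => by ring

theorem sum_inv_gram_smul [DecidableEq ι] (b : Module.Basis ι ℝ V) {D : V →L[ℝ] W}
    (B : V →L[ℝ] V →L[ℝ] X) {v : ι → V} (hv : Orthonormal ℝ (D ∘ v)) :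
    ∑ i, ∑ j, (Matrix.gram ℝ (D ∘ b))⁻¹ i j • B (b i) (b j) = ∑ k, B (v k) (v k) := by
  set K := b.toMatrix v
  have hgram : Matrix.gram ℝ (D ∘ v) = 1 := by
    ext k l
    rw [Matrix.gram_apply, orthonormal_iff_ite.1 hv, Matrix.one_apply]
  have hinv : K * K.transpose * Matrix.gram ℝ (D ∘ b) = 1 := by
    rw [Matrix.mul_assoc, mul_eq_one_comm, transpose_toMatrix_mul_gram_mul, hgram]
  have hB : ∀ k, B (v k) (v k) = ∑ i, ∑ j, (K i k * K j k) • B (b i) (b j) := fun k => by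
    conv_lhs => rw [← b.sum_toMatrix_smul_self v k]
    simp only [map_sum, map_smul, sum_apply, smul_apply, Finset.smul_sum, mul_smul, K]
    exact Finset.sum_comm.trans
      (Finset.sum_congr rfl fun i _ => Finset.sum_congr rfl fun j _ => smul_comm _ _ _)
  simp only [Matrix.inv_eq_left_inv hinv, hB, Matrix.mul_apply, Matrix.transpose_apply,
    Finset.sum_smul]
  rw [Finset.sum_comm_cycle]

end Gram

section Charts

variable {M : Type*} [TopologicalSpace M] {F : M → S3xR} {e e' : OpenPartialHomeomorph M Plane}
  {q : M}

/-- The surface read in the chart `e`, as a parametrized surface in `𝔼⁵`. -/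
noncomputable def param (F : M → S3xR) (e : OpenPartialHomeomorph M Plane) (u : Plane) : E5 :=
  incl F (e.symm u)

theorem param_apply (F : M → S3xR) (hq : q ∈ e.source) : param F e (e q) = incl F q := by
  rw [param, e.left_inv hq]

theorem norm_horiz_param (F : M → S3xR) (e : OpenPartialHomeomorph M Plane) (u : Plane) :
    ‖horiz (param F e u)‖ = 1 := (F (e.symm u)).2

theorem eventually_symm_mem_source (hq : q ∈ e.source) (hq' : q ∈ e'.source) :
    ∀ᶠ u in nhds (e' q), u ∈ e'.target ∧ e'.symm u ∈ e.source := by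
  refine Filter.Eventually.and (e'.open_target.mem_nhds (e'.map_source hq'))
    ((e'.continuousAt_symm (e'.map_source hq')).eventually ?_)
  rw [e'.left_inv hq']
  exact e.open_source.mem_nhds hq

theorem param_eventuallyEq (F : M → S3xR) (hq : q ∈ e.source) (hq' : q ∈ e'.source) :
    param F e' =ᶠ[nhds (e' q)] param F e ∘ (e ∘ e'.symm) := by
  filter_upwards [eventually_symm_mem_source hq hq'] with u hu
  simp [param, e.left_inv hu.2]

theorem contDiffAt_param (hs : ContDiffOn ℝ ∞ (param F e) e.target) (hq : q ∈ e.source) :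
    ContDiffAt ℝ ∞ (param F e) (e q) :=
  hs.contDiffAt (e.open_target.mem_nhds (e.map_source hq))

variable [ChartedSpace Plane M]

theorem contDiffOn_param (he : e ∈ IsManifold.maximalAtlas (𝓡 2) ∞ M)
    (hF : ContMDiff (𝓡 2) 𝓘(ℝ, E5) ∞ (incl F)) : ContDiffOn ℝ ∞ (param F e) e.target :=
  contMDiffOn_iff_contDiffOn.1 (hF.comp_contMDiffOn (contMDiffOn_symm_of_mem_maximalAtlas he))

theorem contMDiffAt_of_param (he : e ∈ IsManifold.maximalAtlas (𝓡 2) ∞ M)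
    (h : ContDiffOn ℝ ∞ (param F e) e.target) (hq : q ∈ e.source) :
    ContMDiffAt (𝓡 2) 𝓘(ℝ, E5) ∞ (incl F) q := by
  refine ((contDiffAt_param h hq).contMDiffAt.comp q
    (contMDiffAt_of_mem_maximalAtlas he hq)).congr_of_eventuallyEq ?_
  filter_upwards [e.open_source.mem_nhds hq] with x hx
  exact (param_apply F hx).symm

theorem contDiffAt_transition (he : e ∈ IsManifold.maximalAtlas (𝓡 2) ∞ M)
    (he' : e' ∈ IsManifold.maximalAtlas (𝓡 2) ∞ M) (hq : q ∈ e.source) (hq' : q ∈ e'.source) :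
    ContDiffAt ℝ ∞ (e ∘ e'.symm) (e' q) := by
  refine contMDiffAt_iff_contDiffAt.1 (ContMDiffAt.comp (I' := 𝓡 2) (e' q) ?_
    (contMDiffAt_symm_of_mem_maximalAtlas he' (e'.map_source hq')))
  rw [e'.left_inv hq']
  exact contMDiffAt_of_mem_maximalAtlas he hq

theorem fderiv_transition_fderiv_transition (he : e ∈ IsManifold.maximalAtlas (𝓡 2) ∞ M)
    (he' : e' ∈ IsManifold.maximalAtlas (𝓡 2) ∞ M) (hq : q ∈ e.source) (hq' : q ∈ e'.source)
    (v : Plane) : fderiv ℝ (e ∘ e'.symm) (e' q) (fderiv ℝ (e' ∘ e.symm) (e q) v) = v := by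
  have hid : (e ∘ e'.symm) ∘ (e' ∘ e.symm) =ᶠ[nhds (e q)] id := by
    filter_upwards [eventually_symm_mem_source hq' hq] with u hu
    simp [e'.left_inv hu.2, e.right_inv hu.1]
  have hpt : (e' ∘ e.symm) (e q) = e' q := by simp [e.left_inv hq]
  have hcomp := fderiv_comp (e q)
    (hpt ▸ (contDiffAt_transition he he' hq hq').differentiableAt (by simp))
    ((contDiffAt_transition he' he hq' hq).differentiableAt (by simp))
  rw [hid.fderiv_eq, fderiv_id, hpt] at hcomp
  exact congr($hcomp.symm v)

/-- The differential of the preferred chart at `q`, read in the chart `e`. -/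
noncomputable def chartDiff (e : OpenPartialHomeomorph M Plane) (q : M) : Plane →L[ℝ] Plane :=
  fderiv ℝ (e ∘ (chartAt Plane q).symm) (chartAt Plane q q)

theorem localParam_eventuallyEq (F : M → S3xR) (hq : q ∈ e.source) :
    localParam F q =ᶠ[nhds (chartAt Plane q q)] param F e ∘ (e ∘ (chartAt Plane q).symm) :=
  param_eventuallyEq F hq (mem_chart_source Plane q)

theorem differential_eq_fderiv_localParam (hF : MDifferentiableAt (𝓡 2) 𝓘(ℝ, E5) (incl F) q) :
    differential F q = fderiv ℝ (localParam F q) (chartAt Plane q q) := by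
  unfold differential
  rw [hF.mfderiv]
  simp only [mfld_simps, fderivWithin_univ]
  rfl

theorem transition_chartAt_apply (e : OpenPartialHomeomorph M Plane) (q : M) :
    (e ∘ (chartAt Plane q).symm) (chartAt Plane q q) = e q := by
  simp

theorem starProjection_normalPlane_eq_zero {x : E5} (hx : x ∈ tangentPlane F q) :
    (normalPlane F q).starProjection x = 0 := by
  rw [Submodule.starProjection_apply_eq_zero_iff, Submodule.mem_orthogonal']
  exact fun n hn => hn.2 x hx

variable [IsManifold (𝓡 2) ∞ M]

theorem chartDiff_bijective (he : e ∈ IsManifold.maximalAtlas (𝓡 2) ∞ M) (hq : q ∈ e.source) :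
    Function.Bijective (chartDiff e q) :=
  have hchart := IsManifold.chart_mem_maximalAtlas (I := 𝓡 2) (n := ∞) q
  ⟨Function.LeftInverse.injective
    (fderiv_transition_fderiv_transition hchart he (mem_chart_source _ q) hq),
  Function.RightInverse.surjective
    (fderiv_transition_fderiv_transition he hchart hq (mem_chart_source _ q))⟩

theorem contDiffAt_transition_chartAt (he : e ∈ IsManifold.maximalAtlas (𝓡 2) ∞ M)
    (hq : q ∈ e.source) :
    ContDiffAt ℝ ∞ (e ∘ (chartAt Plane q).symm) (chartAt Plane q q) :=
  contDiffAt_transition he (IsManifold.chart_mem_maximalAtlas q) hq (mem_chart_source _ q)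

theorem differential_eq_comp_chartDiff (he : e ∈ IsManifold.maximalAtlas (𝓡 2) ∞ M)
    (hs : ContDiffOn ℝ ∞ (param F e) e.target) (hq : q ∈ e.source) :
    differential F q = (fderiv ℝ (param F e) (e q)).comp (chartDiff e q) := by
  have hpt := transition_chartAt_apply e q
  rw [differential_eq_fderiv_localParam
      ((contMDiffAt_of_param he hs hq).mdifferentiableAt (by simp)),
    (localParam_eventuallyEq F hq).fderiv_eq,
    fderiv_comp _ (hpt ▸ (contDiffAt_param hs hq).differentiableAt (by simp))
      ((contDiffAt_transition_chartAt he hq).differentiableAt (by simp)), hpt]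
  rfl

theorem tangentPlane_eq_range (he : e ∈ IsManifold.maximalAtlas (𝓡 2) ∞ M)
    (hs : ContDiffOn ℝ ∞ (param F e) e.target) (hq : q ∈ e.source) :
    tangentPlane F q = LinearMap.range (fderiv ℝ (param F e) (e q)).toLinearMap := by
  rw [tangentPlane, differential_eq_comp_chartDiff he hs hq]
  exact LinearMap.range_comp_of_range_eq_top _
    (LinearMap.range_eq_top.2 (chartDiff_bijective he hq).2)

theorem injective_mfderiv_iff (he : e ∈ IsManifold.maximalAtlas (𝓡 2) ∞ M)
    (hs : ContDiffOn ℝ ∞ (param F e) e.target) (hq : q ∈ e.source) :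
    Function.Injective (mfderiv (𝓡 2) 𝓘(ℝ, E5) (incl F) q) ↔
      Function.Injective (fderiv ℝ (param F e) (e q)) := by
  change Function.Injective (differential F q) ↔ _
  rw [differential_eq_comp_chartDiff he hs hq, ContinuousLinearMap.coe_comp]
  exact Function.Injective.of_comp_iff' _ (chartDiff_bijective he hq)

theorem secondFundamentalForm_eq (he : e ∈ IsManifold.maximalAtlas (𝓡 2) ∞ M)
    (hs : ContDiffOn ℝ ∞ (param F e) e.target) (hq : q ∈ e.source) (v w : Plane) :
    secondFundamentalForm F q v w = (normalPlane F q).starProjection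
      (fderiv ℝ (fderiv ℝ (param F e)) (e q) (chartDiff e q v) (chartDiff e q w)) := by
  have hpt := transition_chartAt_apply e q
  have h2 : (2 : WithTop ℕ∞) ≤ ∞ := WithTop.coe_le_coe.2 le_top
  have hcomp := fderiv_fderiv_comp
    (hpt ▸ (contDiffAt_param hs hq).of_le h2) ((contDiffAt_transition_chartAt he hq).of_le h2) v w
  rw [← (localParam_eventuallyEq F hq).fderiv.fderiv_eq, hpt] at hcomp
  rw [secondFundamentalForm, hcomp, map_add]
  refine add_eq_left.2 (starProjection_normalPlane_eq_zero ?_)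
  rw [tangentPlane_eq_range he hs hq]
  exact ⟨_, rfl⟩

theorem meanCurvature_eq (he : e ∈ IsManifold.maximalAtlas (𝓡 2) ∞ M)
    (hs : ContDiffOn ℝ ∞ (param F e) e.target) (hq : q ∈ e.source) {v : Fin 2 → Plane}
    (hv : Orthonormal ℝ (fderiv ℝ (param F e) (e q) ∘ v)) :
    meanCurvature F q = (1 / 2 : ℝ) • (normalPlane F q).starProjection
      (∑ i, fderiv ℝ (fderiv ℝ (param F e)) (e q) (v i) (v i)) := by
  choose v' hv' using fun i => (chartDiff_bijective he hq).2 (v i)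
  obtain rfl : chartDiff e q ∘ v' = v := funext hv'
  set B := (fderiv ℝ (fderiv ℝ (param F e)) (e q)).bilinearComp (chartDiff e q) (chartDiff e q)
  have hsum := sum_inv_gram_smul (EuclideanSpace.basisFun (Fin 2) ℝ).toBasis
    (D := differential F q) B (v := v')
    (by rw [differential_eq_comp_chartDiff he hs hq]; exact hv)
  rw [meanCurvature]
  simp only [secondFundamentalForm_eq he hs hq, ← map_smul, ← map_sum]
  congr 2
  refine Eq.trans ?_ hsum
  simp [metricMatrix, Matrix.gram, B, coordVec]

theorem meanCurvature_eq_zero_iff (he : e ∈ IsManifold.maximalAtlas (𝓡 2) ∞ M)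
    (hs : ContDiffOn ℝ ∞ (param F e) e.target) (hq : q ∈ e.source) {v : Fin 2 → Plane}
    (hv : Orthonormal ℝ (fderiv ℝ (param F e) (e q) ∘ v)) :
    meanCurvature F q = 0 ↔ ∀ n ∈ normalPlane F q,
      ⟪∑ i, fderiv ℝ (fderiv ℝ (param F e)) (e q) (v i) (v i), n⟫_ℝ = 0 := by
  rw [meanCurvature_eq he hs hq hv, smul_eq_zero_iff_right (by norm_num),
    Submodule.starProjection_apply_eq_zero_iff, Submodule.mem_orthogonal']

end Charts

section Components

/-- The projection `horiz` of `𝔼⁵` to `𝔼⁴`, as a continuous linear map. -/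
noncomputable def horizL : E5 →L[ℝ] E4 :=
  LinearMap.toContinuousLinearMap
    { toFun := horiz
      map_add' := fun _ _ => rfl
      map_smul' := fun _ _ => rfl }

theorem horiz_add (x y : E5) : horiz (x + y) = horiz x + horiz y := rfl

theorem horiz_smul (r : ℝ) (x : E5) : horiz (r • x) = r • horiz x := rfl

@[simp] theorem horiz_dt : horiz dt = 0 := by
  ext i
  fin_cases i <;> simp [dt]

@[simp] theorem dt_apply_four : dt 4 = 1 := by simp [dt]

theorem inner_dt (x : E5) : ⟪dt, x⟫_ℝ = x 4 := by
  rw [inner_eq_horiz, horiz_dt, inner_zero_left, dt_apply_four, zero_add, one_mul]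

@[simp] theorem horiz_unitN (x : E5) : horiz (unitN x) = horiz x := by
  ext i
  fin_cases i <;> simp [unitN]

@[simp] theorem unitN_apply_four (x : E5) : unitN x 4 = 0 := by simp [unitN]

theorem inner_unitN (x y : E5) : ⟪unitN x, y⟫_ℝ = ⟪horiz x, horiz y⟫_ℝ := by
  rw [inner_eq_horiz, horiz_unitN, unitN_apply_four, zero_mul, add_zero]

theorem mem_normalPlane_iff {M : Type*} [TopologicalSpace M] [ChartedSpace Plane M]
    {F : M → S3xR} {p : M} {n : E5} :
    n ∈ normalPlane F p ↔ ⟪unitN (F p), n⟫_ℝ = 0 ∧ ∀ x ∈ tangentPlane F p, ⟪x, n⟫_ℝ = 0 := by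
  rw [normalPlane, Submodule.mem_inf, ambientTangent,
    Submodule.mem_orthogonal_singleton_iff_inner_right, Submodule.mem_orthogonal]

variable {f : Plane → E5} {U : Set Plane} {u : Plane}

theorem pd_horiz (hf : DifferentiableAt ℝ f u) (i : Fin 2) :
    pd i (fun u => horiz (f u)) u = horiz (pd i f u) :=
  congr($((horizL.hasFDerivAt.comp u hf.hasFDerivAt).fderiv) (coordVec i))

theorem contDiffOn_horiz (hf : ContDiffOn ℝ ∞ f U) :
    ContDiffOn ℝ ∞ (fun u => horiz (f u)) U :=
  horizL.contDiff.comp_contDiffOn hf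

theorem pd_pd_horiz (hU : IsOpen U) (hf : ContDiffOn ℝ ∞ f U) (hu : u ∈ U) (i j : Fin 2) :
    pd i (pd j (fun u => horiz (f u))) u = horiz (pd i (pd j f) u) := by
  rw [pd_congr hU (fun v hv => pd_horiz (differentiableAt_of_contDiffOn hU hf hv) j) hu]
  exact pd_horiz (differentiableAt_of_contDiffOn hU (contDiffOn_pd hU hf j) hu) i

end Components

section AffineHeight

variable {f : Plane → E5} {U : Set Plane} {κ τ : ℝ} {u : Plane}

theorem contDiffOn_of_horiz (hg : ContDiffOn ℝ ∞ (fun u => horiz (f u)) U)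
    (h4 : ∀ u ∈ U, f u 4 = κ * u 0 + τ) : ContDiffOn ℝ ∞ f U := by
  rw [contDiffOn_euclidean] at hg ⊢
  refine Fin.lastCases ?_ hg
  have haffine : ContDiffOn ℝ ∞ (fun u : Plane => κ * u 0 + τ) U := by fun_prop
  exact haffine.congr h4

theorem pd_affine (κ τ : ℝ) (i : Fin 2) (u : Plane) :
    pd i (fun u : Plane => κ * u 0 + τ) u = ![κ, 0] i := by
  have hphase : (fun u : Plane => κ * u 0 + τ) = fun u => phase κ 0 u + τ := by
    simp only [phase_apply, zero_mul, add_zero]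
  rw [pd, hphase, ((phase κ 0).hasFDerivAt.add_const τ).fderiv, phase_coordVec]

theorem pd_apply_four (hU : IsOpen U) (hf : ContDiffOn ℝ ∞ f U)
    (h4 : ∀ u ∈ U, f u 4 = κ * u 0 + τ) (hu : u ∈ U) (i : Fin 2) : pd i f u 4 = ![κ, 0] i := by
  rw [pd_apply (differentiableAt_of_contDiffOn hU hf hu), pd_congr hU h4 hu, pd_affine]

theorem pd_pd_apply_four (hU : IsOpen U) (hf : ContDiffOn ℝ ∞ f U)
    (h4 : ∀ u ∈ U, f u 4 = κ * u 0 + τ) (hu : u ∈ U) (i j : Fin 2) : pd i (pd j f) u 4 = 0 := by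
  rw [pd_apply (differentiableAt_of_contDiffOn hU (contDiffOn_pd hU hf j) hu)]
  exact pd_eq_zero_of_const hU (fun v hv => pd_apply_four hU hf h4 hv j) hu i

end AffineHeight

namespace FlatSpherical

variable {f : Plane → E5} {U : Set Plane} {G : Matrix (Fin 2) (Fin 2) ℝ} {c κ τ : ℝ} {u : Plane}

theorem orthonormal_pd (h : FlatSpherical !![c ^ 2, 0; 0, 1] (fun u => horiz (f u)) U)
    (h4 : ∀ u ∈ U, f u 4 = κ * u 0 + τ) (hκ : c ^ 2 + κ ^ 2 = 1) (hu : u ∈ U) :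
    Orthonormal ℝ fun i => pd i f u := by
  have hs := contDiffOn_of_horiz h.smooth h4
  have hf := differentiableAt_of_contDiffOn h.isOpen hs hu
  refine orthonormal_iff_ite.2 fun i j => ?_
  rw [inner_eq_horiz, ← pd_horiz hf, ← pd_horiz hf, h.metric u hu,
    pd_apply_four h.isOpen hs h4 hu, pd_apply_four h.isOpen hs h4 hu]
  fin_cases i <;> fin_cases j <;> simp [← sq, hκ]

theorem inner_dt_fderiv (h : FlatSpherical !![c ^ 2, 0; 0, 1] (fun u => horiz (f u)) U)
    (h4 : ∀ u ∈ U, f u 4 = κ * u 0 + τ) (hκ : c ^ 2 + κ ^ 2 = 1) (hu : u ∈ U) (z : Plane) :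
    ⟪dt, fderiv ℝ f u z⟫_ℝ = κ * ⟪pd 0 f u, fderiv ℝ f u z⟫_ℝ := by
  have hs := contDiffOn_of_horiz h.smooth h4
  have horth := orthonormal_iff_ite.1 (h.orthonormal_pd h4 hκ hu)
  rw [inner_dt, fderiv_apply_eq_pd, inner_add_right, inner_smul_right, inner_smul_right,
    horth 0 0, horth 0 1, PiLp.add_apply, PiLp.smul_apply, PiLp.smul_apply,
    pd_apply_four h.isOpen hs h4 hu, pd_apply_four h.isOpen hs h4 hu]
  simp [mul_comm]

theorem inner_unitN_pd (h : FlatSpherical G (fun u => horiz (f u)) U)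
    (h4 : ∀ u ∈ U, f u 4 = κ * u 0 + τ) (hu : u ∈ U) (i : Fin 2) :
    ⟪unitN (f u), pd i f u⟫_ℝ = 0 := by
  have hs := contDiffOn_of_horiz h.smooth h4
  rw [inner_unitN, ← pd_horiz (differentiableAt_of_contDiffOn h.isOpen hs hu), h.inner_pd hu]

theorem inner_unitN_pd_pd (h : FlatSpherical G (fun u => horiz (f u)) U)
    (h4 : ∀ u ∈ U, f u 4 = κ * u 0 + τ) (hu : u ∈ U) (i j : Fin 2) :
    ⟪unitN (f u), pd i (pd j f) u⟫_ℝ = -G i j := by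
  rw [inner_unitN, ← pd_pd_horiz h.isOpen (contDiffOn_of_horiz h.smooth h4) hu, h.inner_pd_pd hu]

theorem inner_pd_pd_pd_of_horiz (h : FlatSpherical G (fun u => horiz (f u)) U)
    (h4 : ∀ u ∈ U, f u 4 = κ * u 0 + τ) (hu : u ∈ U) (i j k : Fin 2) :
    ⟪pd i f u, pd j (pd k f) u⟫_ℝ = 0 := by
  have hs := contDiffOn_of_horiz h.smooth h4
  rw [inner_eq_horiz, pd_pd_apply_four h.isOpen hs h4 hu, mul_zero, add_zero,
    ← pd_horiz (differentiableAt_of_contDiffOn h.isOpen hs hu), ← pd_pd_horiz h.isOpen hs hu,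
    h.inner_pd_pd_pd hu]

end FlatSpherical

namespace FlatMinimal

variable {W W' : Type*} [NormedAddCommGroup W] [InnerProductSpace ℝ W] [NormedAddCommGroup W']
  [InnerProductSpace ℝ W'] {c : ℝ} {g g' : Plane → W} {U : Set Plane}

theorem congr (h : FlatMinimal c g U) (hg : ∀ u ∈ U, g' u = g u) : FlatMinimal c g' U := by
  have hpd : ∀ u ∈ U, ∀ i, pd i g' u = pd i g u := fun u hu i => pd_congr h.isOpen hg hu i
  have hpd2 : ∀ u ∈ U, ∀ i, pd i (pd i g') u = pd i (pd i g) u := fun u hu i =>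
    pd_congr h.isOpen (fun v hv => hpd v hv i) hu i
  refine ⟨⟨h.isOpen, h.smooth.congr hg, fun u hu => ?_, fun u hu i j => ?_⟩, fun u hu => ?_⟩
  · rw [hg u hu, h.unit u hu]
  · rw [hpd u hu, hpd u hu, h.metric u hu]
  · rw [hpd2 u hu, hpd2 u hu, hg u hu, h.harmonic u hu]

theorem isometry_comp (h : FlatMinimal c g U) (L : W ≃ₗᵢ[ℝ] W') :
    FlatMinimal c (fun u => L (g u)) U := by
  have hpd : ∀ (k : Plane → W) i, pd i (fun u => L (k u)) = fun u => L (pd i k u) := fun k i =>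
    funext fun u => congr($(L.toContinuousLinearEquiv.comp_fderiv (f := k) (x := u)) (coordVec i))
  refine ⟨⟨h.isOpen, L.toContinuousLinearEquiv.contDiff.comp_contDiffOn h.smooth, fun u hu => ?_,
    fun u hu i j => ?_⟩, fun u hu => ?_⟩
  · rw [L.inner_map_map, h.unit u hu]
  · rw [hpd, hpd, L.inner_map_map, h.metric u hu]
  · rw [hpd, hpd, hpd, hpd, ← map_add, h.harmonic u hu, map_smul]

theorem pd_pd_add_pd_pd {f : Plane → E5} {κ τ : ℝ} {u : Plane}
    (h : FlatMinimal c (fun u => horiz (f u)) U)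
    (h4 : ∀ u ∈ U, f u 4 = κ * u 0 + τ) (hu : u ∈ U) :
    pd 0 (pd 0 f) u + pd 1 (pd 1 f) u = -(1 + c ^ 2) • unitN (f u) := by
  have hs := contDiffOn_of_horiz h.smooth h4
  refine ext_horiz ?_ ?_
  · rw [horiz_add, ← pd_pd_horiz h.isOpen hs hu, ← pd_pd_horiz h.isOpen hs hu, h.harmonic u hu,
      horiz_smul, horiz_unitN]
  · rw [PiLp.add_apply, pd_pd_apply_four h.isOpen hs h4 hu, pd_pd_apply_four h.isOpen hs h4 hu,
      PiLp.smul_apply, unitN_apply_four, add_zero, smul_zero]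

end FlatMinimal

section Converse

variable {M : Type*} [TopologicalSpace M] {F : M → S3xR} {e : OpenPartialHomeomorph M Plane}
  {θ ν : ℝ}

theorem exists_flatMinimal_of_eq_model {Φ : Isom} (hθ : Real.cos θ ≠ 0) (hν0 : 0 ≤ ν)
    (hν : ν ^ 2 ≤ 1 + Real.cos θ ^ 2)
    (h : ∀ q ∈ e.source, (Φ.toEquiv (F q) : E5) = model θ ν (e q 0) (e q 1)) :
    FlatMinimal (Real.cos θ) (fun u => horiz (param F e u)) e.target ∧ ∃ ε τ : ℝ, ε ^ 2 = 1 ∧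
      ∀ u ∈ e.target, param F e u 4 = ε * Real.sin θ * u 0 + τ := by
  obtain ⟨L, ε, τ, hε, hΦ⟩ := Φ.exists_eq
  have components : ∀ u ∈ e.target, modelS3 θ ν u = L (horiz (param F e u)) ∧
      u 0 * Real.sin θ = ε * param F e u 4 + τ := fun u hu => by
    have hΦu := hΦ (F (e.symm u))
    rwa [h _ (e.map_target hu), e.right_inv hu, model_eq_pair, horiz_pair,
      pair_apply_four] at hΦu
  refine ⟨?_, ε, -ε * τ, hε, fun u hu => ?_⟩
  · refine (((flatMinimal_modelS3 hθ hν0 hν).isometry_comp L.symm).mono e.open_target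
      (Set.subset_univ _)).congr fun u hu => ?_
    rw [(components u hu).1, L.symm_apply_apply]
  · linear_combination -ε * (components u hu).2 - param F e u 4 * hε

variable [ChartedSpace Plane M]

theorem exists_angle_decomposition {p : M} {T : E5} (hc : Real.cos θ ≠ 0)
    (hT : T ∈ tangentPlane F p) (hT1 : ‖T‖ = 1) (hN : ⟪unitN (F p), T⟫_ℝ = 0)
    (hdt : ∀ x ∈ tangentPlane F p, ⟪dt, x⟫_ℝ = Real.sin θ * ⟪T, x⟫_ℝ) :
    ∃ T ∈ tangentPlane F p, ∃ ξ ∈ normalPlane F p,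
      ‖T‖ = 1 ∧ ‖ξ‖ = 1 ∧ dt = Real.sin θ • T + Real.cos θ • ξ := by
  refine ⟨T, hT, (Real.cos θ)⁻¹ • (dt - Real.sin θ • T),
    Submodule.smul_mem _ _ (mem_normalPlane_iff.2 ⟨?_, fun x hx => ?_⟩), hT1, ?_, ?_⟩
  · rw [inner_sub_right, inner_smul_right, hN, real_inner_comm, inner_dt, unitN_apply_four,
      mul_zero, sub_zero]
  · rw [real_inner_comm, inner_sub_left, hdt x hx, real_inner_smul_left, sub_self]
  · have hnorm : ‖dt - Real.sin θ • T‖ ^ 2 = Real.cos θ ^ 2 := by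
      have hdt1 : ‖dt‖ = 1 := by simp [dt]
      rw [norm_sub_sq_real, real_inner_smul_right, hdt T hT, norm_smul, hdt1, hT1,
        real_inner_self_eq_norm_sq, hT1, mul_one, Real.norm_eq_abs, sq_abs, Real.cos_sq']
      ring
    rw [norm_smul, norm_inv, Real.norm_eq_abs, ← Real.sqrt_sq_eq_abs, ← hnorm,
      Real.sqrt_sq (norm_nonneg _)]
    exact inv_mul_cancel₀ fun h0 => hc (by simpa [h0] using hnorm.symm)
  · rw [smul_inv_smul₀ hc, add_sub_cancel]

variable [IsManifold (𝓡 2) ∞ M] {c κ ε τ : ℝ} {q : M}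

theorem injective_mfderiv_of_flatMinimal (he : e ∈ IsManifold.maximalAtlas (𝓡 2) ∞ M)
    (h : FlatMinimal c (fun u => horiz (param F e u)) e.target)
    (h4 : ∀ u ∈ e.target, param F e u 4 = κ * u 0 + τ) (hκ : c ^ 2 + κ ^ 2 = 1)
    (hq : q ∈ e.source) : Function.Injective (mfderiv (𝓡 2) 𝓘(ℝ, E5) (incl F) q) := by
  rw [injective_mfderiv_iff he (contDiffOn_of_horiz h.smooth h4) hq]
  set b := (EuclideanSpace.basisFun (Fin 2) ℝ).toBasis
  have hb : ⇑b = coordVec := funext fun i => by simp [b, coordVec]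
  exact LinearMap.injective_of_linearIndependent (f := (fderiv ℝ (param F e) (e q)).toLinearMap)
    b.span_eq (hb ▸ (h.orthonormal_pd h4 hκ (e.map_source hq)).linearIndependent)

theorem meanCurvature_eq_zero_of_flatMinimal (he : e ∈ IsManifold.maximalAtlas (𝓡 2) ∞ M)
    (h : FlatMinimal c (fun u => horiz (param F e u)) e.target)
    (h4 : ∀ u ∈ e.target, param F e u 4 = κ * u 0 + τ) (hκ : c ^ 2 + κ ^ 2 = 1)
    (hq : q ∈ e.source) : meanCurvature F q = 0 := by
  have hs := contDiffOn_of_horiz h.smooth h4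
  have hu := e.map_source hq
  rw [meanCurvature_eq_zero_iff he hs hq (v := coordVec) (h.orthonormal_pd h4 hκ hu)]
  intro n hn
  rw [Fin.sum_univ_two, ← pd_pd_eq_fderiv_fderiv e.open_target hs hu,
    ← pd_pd_eq_fderiv_fderiv e.open_target hs hu, h.pd_pd_add_pd_pd h4 hu, param_apply F hq,
    inner_smul_left, incl, (mem_normalPlane_iff.1 hn).1, mul_zero]

theorem exists_angle_decomposition_of_flatMinimal (hc : Real.cos θ ≠ 0)
    (he : e ∈ IsManifold.maximalAtlas (𝓡 2) ∞ M)
    (h : FlatMinimal (Real.cos θ) (fun u => horiz (param F e u)) e.target) (hε : ε ^ 2 = 1)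
    (h4 : ∀ u ∈ e.target, param F e u 4 = ε * Real.sin θ * u 0 + τ) (hq : q ∈ e.source) :
    ∃ T ∈ tangentPlane F q, ∃ ξ ∈ normalPlane F q,
      ‖T‖ = 1 ∧ ‖ξ‖ = 1 ∧ dt = Real.sin θ • T + Real.cos θ • ξ := by
  have hs := contDiffOn_of_horiz h.smooth h4
  have hu := e.map_source hq
  have hκ : Real.cos θ ^ 2 + (ε * Real.sin θ) ^ 2 = 1 := by
    rw [mul_pow, hε, one_mul, Real.cos_sq_add_sin_sq]
  have hT := tangentPlane_eq_range he hs hq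
  refine exists_angle_decomposition hc (T := ε • pd 0 (param F e) (e q)) ?_ ?_ ?_ ?_
  · rw [hT]
    exact Submodule.smul_mem _ _ ⟨coordVec 0, rfl⟩
  · rw [norm_smul, (h.orthonormal_pd h4 hκ hu).1, mul_one, Real.norm_eq_abs,
      ← Real.sqrt_sq_eq_abs, hε, Real.sqrt_one]
  · have hN := h.inner_unitN_pd h4 hu 0
    rw [param_apply F hq] at hN
    rw [inner_smul_right]
    exact mul_eq_zero_of_right ε hN
  · rw [hT]
    rintro _ ⟨z, rfl⟩
    rw [inner_smul_left, conj_trivial, ← mul_assoc, mul_comm (Real.sin θ)]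
    exact h.inner_dt_fderiv h4 hκ hu z

theorem minimal_of_isModelNear (hθ : Real.cos θ ≠ 0)
    (h : ∀ p : M, ∃ ν ∈ Set.Icc 1 √(1 + Real.cos θ ^ 2), ∃ Φ : Isom, IsModelNear F Φ θ ν p) :
    IsImmersed F ∧ IsMinimal F ∧ HasConstantAngle F θ := by
  have flat_chart : ∀ p, ∃ e ∈ IsManifold.maximalAtlas (𝓡 2) ∞ M, p ∈ e.source ∧
      FlatMinimal (Real.cos θ) (fun u => horiz (param F e u)) e.target ∧ ∃ ε τ : ℝ, ε ^ 2 = 1 ∧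
        ∀ u ∈ e.target, param F e u 4 = ε * Real.sin θ * u 0 + τ := fun p => by
    obtain ⟨ν, hν, Φ, e, he, hp, h⟩ := h p
    exact ⟨e, he, hp, exists_flatMinimal_of_eq_model hθ (zero_le_one.trans hν.1)
      (sq_le_of_mem_Icc hν) h⟩
  choose e he hp h ε τ hε h4 using flat_chart
  have hκ : ∀ p, Real.cos θ ^ 2 + (ε p * Real.sin θ) ^ 2 = 1 := fun p => by
    rw [mul_pow, hε, one_mul, Real.cos_sq_add_sin_sq]
  exact ⟨⟨fun p => contMDiffAt_of_param (he p) (contDiffOn_of_horiz (h p).smooth (h4 p)) (hp p),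
    fun p => injective_mfderiv_of_flatMinimal (he p) (h p) (h4 p) (hκ p) (hp p)⟩,
    fun p => meanCurvature_eq_zero_of_flatMinimal (he p) (h p) (h4 p) (hκ p) (hp p),
    fun p => exists_angle_decomposition_of_flatMinimal hθ (he p) (h p) (hε p) (h4 p) (hp p)⟩

end Converse

section AngleSurface

variable {W : Type*} [NormedAddCommGroup W] [InnerProductSpace ℝ W] {a ξ : W} {s c : ℝ}

theorem fderiv_eq_of_eq_sq_add_mul_sq {U : Set Plane} (hU : IsOpen U) {k φ η : Plane → ℝ} {r : ℝ}
    {u : Plane} (hφ : DifferentiableAt ℝ φ u) (hη : DifferentiableAt ℝ η u)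
    (hk : ∀ x ∈ U, k x = φ x ^ 2 + r * η x ^ 2) (hu : u ∈ U) (h0 : η u = 0) (z : Plane) :
    fderiv ℝ k u z = 2 * φ u * fderiv ℝ φ u z := by
  rw [(Filter.eventuallyEq_of_mem (hU.mem_nhds hu) hk).fderiv_eq,
    fderiv_fun_add (hφ.fun_pow 2) ((hη.fun_pow 2).const_mul r), fderiv_const_mul (hη.fun_pow 2),
    fderiv_fun_pow 2 hφ, fderiv_fun_pow 2 hη, h0]
  simp

theorem eq_inner_smul_add {D : Plane →L[ℝ] W} {v w : Plane} (hv : ⟪D v, D v⟫_ℝ = 1)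
    (hvw : ⟪D v, D w⟫_ℝ = 0) (hw : ⟪D w, D w⟫_ℝ = 1) (z : Plane) :
    z = ⟪D v, D z⟫_ℝ • v + ⟪D w, D z⟫_ℝ • w := by
  have hwv : ⟪D w, D v⟫_ℝ = 0 := by rw [real_inner_comm, hvw]
  have hli : LinearIndependent ℝ ![v, w] := by
    refine LinearIndependent.pair_iff.2 fun r t hrt => ?_
    have hD : r • D v + t • D w = 0 := by rw [← map_smul, ← map_smul, ← map_add, hrt, map_zero]
    have h₁ := congrArg (⟪D v, ·⟫_ℝ) hD
    have h₂ := congrArg (⟪D w, ·⟫_ℝ) hD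
    simp only [inner_add_right, inner_smul_right, hv, hvw, hw, hwv, inner_zero_right] at h₁ h₂
    constructor <;> linarith
  have hz : z ∈ Submodule.span ℝ {v, w} := by
    have := hli.span_eq_top_of_card_eq_finrank (by simp)
    rw [Matrix.range_cons_cons_empty] at this
    exact this ▸ Submodule.mem_top
  obtain ⟨r, t, rfl⟩ := Submodule.mem_span_pair.1 hz
  simp only [map_add, map_smul, inner_add_right, inner_smul_right, hv, hvw, hw, hwv]
  module

/-- The decomposition `a = s T + c ξ` of a vector into a multiple of a unit vector `T = D v` tangent
to a surface with differential `D`, and a multiple of a normal vector `ξ`. -/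
structure AngleDecomposition (a : W) (s c : ℝ) (D : Plane →L[ℝ] W) (v : Plane) (ξ : W) : Prop where
  unit : ⟪D v, D v⟫_ℝ = 1
  normal : ∀ z, ⟪ξ, D z⟫_ℝ = 0
  eq_add : a = s • D v + c • ξ

namespace AngleDecomposition

variable {D : Plane →L[ℝ] W} {v w : Plane}

theorem inner_eq (h : AngleDecomposition a s c D v ξ) (x : W) :
    ⟪a, x⟫_ℝ = s * ⟪D v, x⟫_ℝ + c * ⟪ξ, x⟫_ℝ := by
  conv_lhs => rw [h.eq_add]
  rw [inner_add_left, inner_smul_left, inner_smul_left, conj_trivial, conj_trivial]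

theorem inner_apply (h : AngleDecomposition a s c D v ξ) (z : Plane) :
    ⟪a, D z⟫_ℝ = s * ⟪D v, D z⟫_ℝ := by
  rw [h.inner_eq, h.normal, mul_zero, add_zero]

theorem inner_eq_zero (h : AngleDecomposition a s c D v ξ) (hs : s ≠ 0) (hw : ⟪a, D w⟫_ℝ = 0) :
    ⟪D v, D w⟫_ℝ = 0 :=
  (mul_eq_zero_iff_left hs).1 (h.inner_apply w ▸ hw)

theorem sq_mul_inner (h : AngleDecomposition a s c D v ξ) (hs : s ≠ 0) (hw : ⟪a, D w⟫_ℝ = 0)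
    (hw' : ⟪D w, D w⟫_ℝ = 1) (z : Plane) :
    s ^ 2 * ⟪D z, D z⟫_ℝ = ⟪a, D z⟫_ℝ ^ 2 + s ^ 2 * ⟪D w, D z⟫_ℝ ^ 2 := by
  have hz : ⟪D z, D z⟫_ℝ = ⟪D v, D z⟫_ℝ ^ 2 + ⟪D w, D z⟫_ℝ ^ 2 := by
    have := congrArg (⟪D ·, D z⟫_ℝ) (eq_inner_smul_add h.unit (h.inner_eq_zero hs hw) hw' z)
    rwa [map_add, map_smul, map_smul, inner_add_left, real_inner_smul_left, real_inner_smul_left,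
      ← sq, ← sq] at this
  rw [hz, h.inner_apply]
  ring

end AngleDecomposition

/-- A parametrized surface on which a fixed vector `a` decomposes as `s T + c ξ`, with `T` unit
tangent and `ξ` normal, and whose mean curvature vector is orthogonal to `ξ`. The latter is
expressed by the orthonormal frames of the tangent plane containing `T`. -/
structure AngleSurface (a : W) (s c : ℝ) (f : Plane → W) (U : Set Plane) : Prop where
  isOpen : IsOpen U
  smooth : ContDiffOn ℝ ∞ f U
  injective : ∀ u ∈ U, Function.Injective (fderiv ℝ f u)
  angle : ∀ u ∈ U, ∃ v ξ, AngleDecomposition a s c (fderiv ℝ f u) v ξ ∧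
    ∀ w, ⟪fderiv ℝ f u v, fderiv ℝ f u w⟫_ℝ = 0 → ⟪fderiv ℝ f u w, fderiv ℝ f u w⟫_ℝ = 1 →
      ⟪ξ, fderiv ℝ (fderiv ℝ f) u v v + fderiv ℝ (fderiv ℝ f) u w w⟫_ℝ = 0

/-- A smooth unit tangent field of the surface `f`, given in coordinates by `w`, that is orthogonal
to the vector `a`. -/
structure IsOrthogonalUnitField (a : W) (f : Plane → W) (U : Set Plane) (w : Plane → Plane) :
    Prop where
  smooth : ContDiffOn ℝ ∞ w U
  unit : ∀ u ∈ U, ⟪fderiv ℝ f u (w u), fderiv ℝ f u (w u)⟫_ℝ = 1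
  orthogonal : ∀ u ∈ U, ⟪a, fderiv ℝ f u (w u)⟫_ℝ = 0

namespace AngleSurface

variable {f : Plane → W} {U : Set Plane} {w : Plane → Plane} {u v : Plane}

theorem exists_inner_pd_ne_zero (h : AngleSurface a s c f U) (hs : s ≠ 0) (hu : u ∈ U) :
    ∃ i, ⟪a, pd i f u⟫_ℝ ≠ 0 := by
  by_contra! h0
  obtain ⟨v, ξ, hv, -⟩ := h.angle u hu
  have hav : ⟪a, fderiv ℝ f u v⟫_ℝ = s := by rw [hv.inner_apply, hv.unit, mul_one]
  rw [fderiv_apply_eq_pd, inner_add_right, inner_smul_right, inner_smul_right, h0, h0, mul_zero,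
    mul_zero, add_zero] at hav
  exact hs hav.symm

theorem exists_isOrthogonalUnitField (h : AngleSurface a s c f U) (hs : s ≠ 0) :
    ∃ w, IsOrthogonalUnitField a f U w := by
  have smooth_inner_pd : ∀ i, ContDiffOn ℝ ∞ (fun u => ⟪a, pd i f u⟫_ℝ) U := fun i =>
    contDiffOn_const.inner ℝ (contDiffOn_pd h.isOpen h.smooth i)
  set w : Plane → Plane := fun u => !₂[⟪a, pd 1 f u⟫_ℝ, -⟪a, pd 0 f u⟫_ℝ] with hw
  have sw : ContDiffOn ℝ ∞ w U := by
    refine contDiffOn_euclidean.2 fun i => ?_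
    fin_cases i
    · exact smooth_inner_pd 1
    · exact (smooth_inner_pd 0).neg
  have hw0 : ∀ u ∈ U, fderiv ℝ f u (w u) ≠ 0 := fun u hu h0 => by
    have hwu : w u = 0 := h.injective u hu (h0.trans (map_zero _).symm)
    obtain ⟨i, hi⟩ := h.exists_inner_pd_ne_zero hs hu
    fin_cases i
    · exact hi (neg_eq_zero.1 congr($hwu 1))
    · exact hi congr($hwu 0)
  have hnorm : ∀ u ∈ U, ‖fderiv ℝ f u (w u)‖ ≠ 0 := fun u hu => norm_ne_zero_iff.2 (hw0 u hu)
  have sfw := (contDiffOn_fderiv h.isOpen h.smooth).clm_apply sw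
  refine ⟨fun u => ‖fderiv ℝ f u (w u)‖⁻¹ • w u, ((sfw.norm ℝ hw0).inv hnorm).smul sw,
    fun u hu => ?_, fun u _ => ?_⟩
  · rw [map_smul, real_inner_self_eq_norm_sq, norm_smul, norm_inv, norm_norm,
      inv_mul_cancel₀ (hnorm u hu), one_pow]
  · rw [map_smul, inner_smul_right, fderiv_apply_eq_pd, inner_add_right, inner_smul_right,
      inner_smul_right]
    simp only [hw, PiLp.toLp_apply, Matrix.cons_val]
    ring

theorem sq_mul_inner_fderiv (h : AngleSurface a s c f U) (hs : s ≠ 0)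
    (hw : IsOrthogonalUnitField a f U w) (hu : u ∈ U) (z : Plane) :
    s ^ 2 * ⟪fderiv ℝ f u z, fderiv ℝ f u z⟫_ℝ
      = ⟪a, fderiv ℝ f u z⟫_ℝ ^ 2 + s ^ 2 * ⟪fderiv ℝ f u (w u), fderiv ℝ f u z⟫_ℝ ^ 2 := by
  obtain ⟨v, ξ, hv, -⟩ := h.angle u hu
  exact hv.sq_mul_inner hs (hw.orthogonal u hu) (hw.unit u hu) z

theorem contDiffOn_fderiv_field (h : AngleSurface a s c f U)
    (hw : IsOrthogonalUnitField a f U w) : ContDiffOn ℝ ∞ (fun u => fderiv ℝ f u (w u)) U :=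
  (contDiffOn_fderiv h.isOpen h.smooth).clm_apply hw.smooth

theorem inner_normal_fderiv_fderiv_left (h : AngleSurface a s c f U) (hs : s ≠ 0) (hc : c ≠ 0)
    (hw : IsOrthogonalUnitField a f U w) (hu : u ∈ U)
    (hv : AngleDecomposition a s c (fderiv ℝ f u) v ξ) (z : Plane) :
    ⟪ξ, fderiv ℝ (fderiv ℝ f) u z v⟫_ℝ = 0 := by
  set p : Plane → W := fun x => fderiv ℝ f x v with hp
  set Y : Plane → W := fun x => fderiv ℝ f x (w x)
  have dp : DifferentiableAt ℝ p u := differentiableAt_of_contDiffOn h.isOpen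
    ((contDiffOn_fderiv h.isOpen h.smooth).clm_apply contDiffOn_const) hu
  have dY : DifferentiableAt ℝ Y u :=
    differentiableAt_of_contDiffOn h.isOpen (h.contDiffOn_fderiv_field hw) hu
  have hpz : fderiv ℝ p u z = fderiv ℝ (fderiv ℝ f) u z v := by
    rw [hp, fderiv_fderiv_clm_apply h.isOpen h.smooth hu (differentiableAt_const v)]
    simp
  have hpu : p u = fderiv ℝ f u v := rfl
  have hYp : ⟪Y u, p u⟫_ℝ = 0 := by
    rw [real_inner_comm]; exact hv.inner_eq_zero hs (hw.orthogonal u hu)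
  have hap : ⟪a, p u⟫_ℝ = s := by rw [hv.inner_apply, hv.unit, mul_one]
  have hderiv := fderiv_eq_of_eq_sq_add_mul_sq h.isOpen ((differentiableAt_const a).inner ℝ dp)
    (dY.inner ℝ dp) (fun x hx => h.sq_mul_inner_fderiv hs hw hx v) hu hYp z
  rw [fderiv_const_mul (dp.inner ℝ dp), smul_apply, fderiv_inner_apply ℝ dp dp,
    fderiv_inner_apply ℝ (differentiableAt_const a) dp, hpz, real_inner_comm (p u), hap, hpu,
    hv.inner_eq, fderiv_const_apply, zero_apply, inner_zero_left, smul_eq_mul] at hderiv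
  refine (mul_eq_zero_iff_left (mul_ne_zero hs hc)).1 ?_
  linear_combination -hderiv / 2

theorem inner_normal_fderiv_fderiv (h : AngleSurface a s c f U) (hs : s ≠ 0) (hc : c ≠ 0)
    (hw : IsOrthogonalUnitField a f U w) (hu : u ∈ U)
    (hv : AngleDecomposition a s c (fderiv ℝ f u) v ξ)
    (hmin : ⟪ξ, fderiv ℝ (fderiv ℝ f) u v v + fderiv ℝ (fderiv ℝ f) u (w u) (w u)⟫_ℝ = 0)
    (z z' : Plane) : ⟪ξ, fderiv ℝ (fderiv ℝ f) u z z'⟫_ℝ = 0 := by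
  have left : ∀ z, ⟪ξ, fderiv ℝ (fderiv ℝ f) u z v⟫_ℝ = 0 :=
    h.inner_normal_fderiv_fderiv_left hs hc hw hu hv
  have right : ∀ z, ⟪ξ, fderiv ℝ (fderiv ℝ f) u v z⟫_ℝ = 0 := fun z => by
    rw [fderiv_fderiv_comm h.isOpen h.smooth hu, left]
  have ww : ⟪ξ, fderiv ℝ (fderiv ℝ f) u (w u) (w u)⟫_ℝ = 0 := by
    rwa [inner_add_right, left, zero_add] at hmin
  have frame := eq_inner_smul_add hv.unit (hv.inner_eq_zero hs (hw.orthogonal u hu)) (hw.unit u hu)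
  rw [frame z, frame z']
  simp only [map_add, map_smul, add_apply, smul_apply, inner_add_right, inner_smul_right, left,
    right, ww, mul_zero, add_zero]

theorem inner_fderiv_field (h : AngleSurface a s c f U) (hs : s ≠ 0) (hc : c ≠ 0)
    (hw : IsOrthogonalUnitField a f U w) (hu : u ∈ U) (z z' : Plane) :
    ⟪fderiv ℝ (fun x => fderiv ℝ f x (w x)) u z, fderiv ℝ f u z'⟫_ℝ = 0 := by
  have sY := h.contDiffOn_fderiv_field hw
  set Y : Plane → W := fun x => fderiv ℝ f x (w x) with hY
  obtain ⟨v, ξ, hv, hmin⟩ := h.angle u hu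
  have hvw := hv.inner_eq_zero hs (hw.orthogonal u hu)
  have YY : ⟪fderiv ℝ Y u z, Y u⟫_ℝ = 0 := by
    have := inner_fderiv_add_inner_fderiv_of_const h.isOpen sY sY hw.unit hu z
    rw [real_inner_comm (fderiv ℝ Y u z)] at this
    linarith
  have Ya : ⟪a, fderiv ℝ Y u z⟫_ℝ = 0 := by
    have := inner_fderiv_add_inner_fderiv_of_const h.isOpen contDiffOn_const sY hw.orthogonal hu z
    rwa [fderiv_const_apply, zero_apply, inner_zero_left, zero_add] at this
  have Yξ : ⟪ξ, fderiv ℝ Y u z⟫_ℝ = 0 := by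
    rw [hY, fderiv_fderiv_clm_apply h.isOpen h.smooth hu
      (differentiableAt_of_contDiffOn h.isOpen hw.smooth hu), inner_add_right, hv.normal,
      h.inner_normal_fderiv_fderiv hs hc hw hu hv (hmin _ hvw (hw.unit u hu)), add_zero]
  have Yv : ⟪fderiv ℝ Y u z, fderiv ℝ f u v⟫_ℝ = 0 := by
    rw [hv.inner_eq, Yξ, mul_zero, add_zero] at Ya
    rw [real_inner_comm]
    exact (mul_eq_zero_iff_left hs).1 Ya
  rw [eq_inner_smul_add hv.unit hvw (hw.unit u hu) z', map_add, map_smul, map_smul,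
    inner_add_right, inner_smul_right, inner_smul_right, Yv, YY, mul_zero, mul_zero, add_zero]

/-- The one-form dual to a tangent field of the surface `f` given in coordinates by `w`. -/
noncomputable def dualForm (f : Plane → W) (w : Plane → Plane) (u : Plane) : Plane →L[ℝ] ℝ :=
  (innerSL ℝ (fderiv ℝ f u (w u))).comp (fderiv ℝ f u)

theorem contDiffOn_dualForm (h : AngleSurface a s c f U) (hw : IsOrthogonalUnitField a f U w) :
    ContDiffOn ℝ ∞ (dualForm f w) U :=
  ((innerSL ℝ : W →L[ℝ] W →L[ℝ] ℝ).contDiff.comp_contDiffOn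
    (h.contDiffOn_fderiv_field hw)).clm_comp (contDiffOn_fderiv h.isOpen h.smooth)

theorem fderiv_dualForm (h : AngleSurface a s c f U) (hs : s ≠ 0) (hc : c ≠ 0)
    (hw : IsOrthogonalUnitField a f U w) (hu : u ∈ U) (z z' : Plane) :
    fderiv ℝ (dualForm f w) u z z'
      = ⟪fderiv ℝ f u (w u), fderiv ℝ (fderiv ℝ f) u z z'⟫_ℝ := by
  have dY := differentiableAt_of_contDiffOn h.isOpen (h.contDiffOn_fderiv_field hw) hu
  have dz' : DifferentiableAt ℝ (fun x => fderiv ℝ f x z') u := differentiableAt_of_contDiffOn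
    h.isOpen ((contDiffOn_fderiv h.isOpen h.smooth).clm_apply contDiffOn_const) hu
  have hα : fderiv ℝ (fun x => dualForm f w x z') u z = fderiv ℝ (dualForm f w) u z z' := by
    rw [fderiv_clm_apply (differentiableAt_of_contDiffOn h.isOpen (h.contDiffOn_dualForm hw) hu)
      (differentiableAt_const z')]
    simp
  rw [← hα]
  change fderiv ℝ (fun x => ⟪fderiv ℝ f x (w x), fderiv ℝ f x z'⟫_ℝ) u z = _
  rw [fderiv_inner_apply ℝ dY dz', h.inner_fderiv_field hs hc hw hu, add_zero,
    fderiv_fderiv_clm_apply h.isOpen h.smooth hu (differentiableAt_const z')]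
  simp

theorem exists_primitive (h : AngleSurface a s c f U) (hs : s ≠ 0) (hc : c ≠ 0)
    (hw : IsOrthogonalUnitField a f U w) (hu : u ∈ U) :
    ∃ V ⊆ U, u ∈ V ∧ IsOpen V ∧ ∃ y : Plane → ℝ, ContDiffOn ℝ ∞ y V ∧
      ∀ x ∈ V, fderiv ℝ y x = dualForm f w x := by
  obtain ⟨r, hr, hrU⟩ := Metric.isOpen_iff.1 h.isOpen u hu
  have sα := (h.contDiffOn_dualForm hw).mono hrU
  obtain ⟨y, hy⟩ := (convex_ball u r).exists_forall_hasFDerivAt_of_fderiv_symmetric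
    Metric.isOpen_ball (sα.differentiableOn (by simp)) fun x hx z z' => by
      rw [h.fderiv_dualForm hs hc hw (hrU hx), h.fderiv_dualForm hs hc hw (hrU hx),
        fderiv_fderiv_comm h.isOpen h.smooth (hrU hx)]
  refine ⟨Metric.ball u r, hrU, Metric.mem_ball_self hr, Metric.isOpen_ball, y, ?_,
    fun x hx => (hy x hx).fderiv⟩
  rw [contDiffOn_infty_iff_fderiv_of_isOpen Metric.isOpen_ball]
  exact ⟨fun x hx => (hy x hx).differentiableAt.differentiableWithinAt,
    sα.congr fun x hx => (hy x hx).fderiv⟩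

theorem exists_coordinates (h : AngleSurface a s c f U) (hs : s ≠ 0) (hc : c ≠ 0) (hu : u ∈ U) :
    ∃ V ⊆ U, u ∈ V ∧ IsOpen V ∧ ∃ ψ : Plane → Plane, ContDiffOn ℝ ∞ ψ V ∧
      ∀ x ∈ V, ⟪a, f x⟫_ℝ = s * ψ x 0 ∧ ∀ z, ‖fderiv ℝ f x z‖ = ‖fderiv ℝ ψ x z‖ := by
  obtain ⟨w, hw⟩ := h.exists_isOrthogonalUnitField hs
  obtain ⟨V, hVU, huV, hV, y, sy, hy⟩ := h.exists_primitive hs hc hw hu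
  have sf := h.smooth.mono hVU
  have sψ : ContDiffOn ℝ ∞ (fun x => (!₂[s⁻¹ * ⟪a, f x⟫_ℝ, y x] : Plane)) V := by
    refine contDiffOn_euclidean.2 fun i => ?_
    fin_cases i
    · exact contDiffOn_const.mul (contDiffOn_const.inner ℝ sf)
    · exact sy
  refine ⟨V, hVU, huV, hV, _, sψ, fun x hx => ⟨(mul_inv_cancel_left₀ hs _).symm, fun z => ?_⟩⟩
  have df := differentiableAt_of_contDiffOn hV sf hx
  have dψ := differentiableAt_of_contDiffOn hV sψ hx
  have h₀ := fderiv_euclidean_apply dψ z 0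
  have h₁ := fderiv_euclidean_apply dψ z 1
  simp only [Matrix.cons_val] at h₀ h₁
  rw [fderiv_const_mul ((differentiableAt_const a).inner ℝ df), smul_apply,
    fderiv_inner_apply ℝ (differentiableAt_const a) df, fderiv_const_apply, zero_apply,
    inner_zero_left, add_zero, smul_eq_mul] at h₀
  rw [hy x hx] at h₁
  rw [← sq_eq_sq₀ (norm_nonneg _) (norm_nonneg _), EuclideanSpace.real_norm_sq_eq, Fin.sum_univ_two,
    h₀, h₁, ← real_inner_self_eq_norm_sq, ← mul_right_inj' (pow_ne_zero 2 hs),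
    h.sq_mul_inner_fderiv hs hw (hVU hx), mul_add, mul_pow, inv_pow,
    mul_inv_cancel_left₀ (pow_ne_zero 2 hs)]
  rfl

end AngleSurface

end AngleSurface

theorem exists_openPartialHomeomorph {V : Type*} [NormedAddCommGroup V] [NormedSpace ℝ V]
    [FiniteDimensional ℝ V] {U : Set V} (hU : IsOpen U) {ψ : V → V} (hψ : ContDiffOn ℝ ∞ ψ U)
    (hinj : ∀ u ∈ U, Function.Injective (fderiv ℝ ψ u)) {u : V} (hu : u ∈ U) :
    ∃ τ : OpenPartialHomeomorph V V, u ∈ τ.source ∧ τ.source ⊆ U ∧ ⇑τ = ψ ∧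
      ContDiffOn ℝ ∞ τ.symm τ.target := by
  have := FiniteDimensional.complete ℝ V
  have hasFDerivAt_equiv : ∀ x ∈ U, ∃ A : V ≃L[ℝ] V, HasFDerivAt ψ (A : V →L[ℝ] V) x :=
    fun x hx => by
      refine ⟨(LinearEquiv.ofInjectiveEndo (fderiv ℝ ψ x).toLinearMap
        (hinj x hx)).toContinuousLinearEquiv, ?_⟩
      exact ((hψ.contDiffAt (hU.mem_nhds hx)).differentiableAt (by simp)).hasFDerivAt
  obtain ⟨A, hA⟩ := hasFDerivAt_equiv u hu
  have hψu := hψ.contDiffAt (hU.mem_nhds hu)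
  set τ := (hψu.toOpenPartialHomeomorph ψ hA (by simp)).restrOpen U hU
  refine ⟨τ, ⟨hψu.mem_toOpenPartialHomeomorph_source hA (by simp), hu⟩, fun x hx => hx.2, rfl,
    fun x hx => ?_⟩
  have hx' : τ.symm x ∈ U := (τ.map_target hx).2
  obtain ⟨B, hB⟩ := hasFDerivAt_equiv _ hx'
  exact (τ.contDiffAt_symm hx hB (hψ.contDiffAt (hU.mem_nhds hx'))).contDiffWithinAt

theorem norm_fderiv_comp_symm {V W : Type*} [NormedAddCommGroup V] [NormedSpace ℝ V]
    [NormedAddCommGroup W] [NormedSpace ℝ W] {τ : OpenPartialHomeomorph V V} {f : V → W} {u : V}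
    (hu : u ∈ τ.target) (hf : DifferentiableAt ℝ f (τ.symm u))
    (hτ : DifferentiableAt ℝ τ (τ.symm u)) (hτ' : DifferentiableAt ℝ τ.symm u)
    (h : ∀ z, ‖fderiv ℝ f (τ.symm u) z‖ = ‖fderiv ℝ τ (τ.symm u) z‖) (z : V) :
    ‖fderiv ℝ (f ∘ τ.symm) u z‖ = ‖z‖ := by
  have hid : τ ∘ τ.symm =ᶠ[nhds u] id := by
    filter_upwards [τ.open_target.mem_nhds hu] with x hx using τ.right_inv hx
  have hz : fderiv ℝ τ (τ.symm u) (fderiv ℝ τ.symm u z) = z := by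
    rw [← ContinuousLinearMap.comp_apply, ← fderiv_comp u hτ hτ', hid.fderiv_eq, fderiv_id,
      ContinuousLinearMap.id_apply]
  rw [fderiv_comp u hf hτ', ContinuousLinearMap.comp_apply, h, hz]

theorem flatSpherical_of_isometric {f : Plane → E5} {U : Set Plane} {c κ τ : ℝ} (hU : IsOpen U)
    (hf : ContDiffOn ℝ ∞ f U) (hf1 : ∀ u ∈ U, ‖horiz (f u)‖ = 1)
    (hiso : ∀ u ∈ U, ∀ z, ‖fderiv ℝ f u z‖ = ‖z‖) (h4 : ∀ u ∈ U, f u 4 = κ * u 0 + τ)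
    (hκ : c ^ 2 + κ ^ 2 = 1) :
    FlatSpherical !![c ^ 2, 0; 0, 1] (fun u => horiz (f u)) U := by
  refine ⟨hU, contDiffOn_horiz hf, fun u hu => ?_, fun u hu i j => ?_⟩
  · rw [real_inner_self_eq_norm_sq, hf1 u hu, one_pow]
  · have inner_pd : ⟪pd i f u, pd j f u⟫_ℝ = ⟪coordVec i, coordVec j⟫_ℝ :=
      (⟨(fderiv ℝ f u).toLinearMap, hiso u hu⟩ : Plane →ₗᵢ[ℝ] E5).inner_map_map _ _
    have hd := differentiableAt_of_contDiffOn hU hf hu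
    rw [inner_eq_horiz, ← pd_horiz hd, ← pd_horiz hd, pd_apply_four hU hf h4 hu,
      pd_apply_four hU hf h4 hu] at inner_pd
    rw [eq_sub_of_add_eq inner_pd]
    fin_cases i <;> fin_cases j <;>
      simp [coordVec, EuclideanSpace.inner_single_left, ← sq, ← eq_sub_of_add_eq hκ]

section MinimalSurface

variable {M : Type*} [TopologicalSpace M] [ChartedSpace Plane M] [IsManifold (𝓡 2) ∞ M]
  {F : M → S3xR} {e : OpenPartialHomeomorph M Plane} {p : M} {c κ θ τ : ℝ}

theorem trans_mem_maximalAtlas (he : e ∈ IsManifold.maximalAtlas (𝓡 2) ∞ M)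
    {τ : OpenPartialHomeomorph Plane Plane} (hτ : ContDiffOn ℝ ∞ τ τ.source)
    (hτ' : ContDiffOn ℝ ∞ τ.symm τ.target) :
    e.trans τ ∈ IsManifold.maximalAtlas (𝓡 2) ∞ M :=
  OpenPartialHomeomorph.mem_maximalAtlas_of_contMDiffOn _
    ((contMDiffOn_iff_contDiffOn.2 hτ).comp
      ((contMDiffOn_of_mem_maximalAtlas he).mono fun _ hx => hx.1) fun _ hx => hx.2)
    ((contMDiffOn_symm_of_mem_maximalAtlas he).comp
      ((contMDiffOn_iff_contDiffOn.2 hτ').mono fun _ hx => hx.1) fun _ hx => hx.2)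

theorem exists_isPreconnected_target (he : e ∈ IsManifold.maximalAtlas (𝓡 2) ∞ M)
    (hp : p ∈ e.source) :
    ∃ e' ∈ IsManifold.maximalAtlas (𝓡 2) ∞ M, p ∈ e'.source ∧ IsPreconnected e'.target ∧
      e'.target ⊆ e.target ∧ ⇑e'.symm = e.symm := by
  obtain ⟨r, hr, hball⟩ := Metric.isOpen_iff.1 e.open_target _ (e.map_source hp)
  set ball := OpenPartialHomeomorph.ofSet _ (Metric.isOpen_ball (x := e p) (ε := r))
  have htarget : (e.trans ball).target = Metric.ball (e p) r := Set.inter_eq_left.2 hball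
  refine ⟨e.trans ball, trans_mem_maximalAtlas he contDiffOn_id contDiffOn_id,
    ⟨hp, Metric.mem_ball_self hr⟩, ?_, ?_, rfl⟩
  · rw [htarget]
    exact (convex_ball _ _).isPreconnected
  · rwa [htarget]

theorem angleSurface_param (hF : IsImmersed F) (hmin : IsMinimal F) (hang : HasConstantAngle F θ)
    (he : e ∈ IsManifold.maximalAtlas (𝓡 2) ∞ M) :
    AngleSurface dt (Real.sin θ) (Real.cos θ) (param F e) e.target := by
  have hs := contDiffOn_param he hF.1
  refine ⟨e.open_target, hs, fun u hu => ?_, fun u hu => ?_⟩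
  · rw [← e.right_inv hu]
    exact (injective_mfderiv_iff he hs (e.map_target hu)).1 (hF.2 _)
  · have hrange := tangentPlane_eq_range he hs (e.map_target hu)
    have hcurv v := meanCurvature_eq_zero_iff he hs (e.map_target hu) (v := v)
    rw [e.right_inv hu] at hrange hcurv
    obtain ⟨T, hT, ξ, hξ, hT1, -, hdt⟩ := hang (e.symm u)
    obtain ⟨v, rfl⟩ := hrange ▸ hT
    rw [ContinuousLinearMap.coe_coe] at hT1 hdt
    refine ⟨v, ξ, ⟨by rw [real_inner_self_eq_norm_sq, hT1, one_pow], fun z => ?_, hdt⟩,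
      fun w hvw hw => ?_⟩
    · rw [real_inner_comm]
      exact (mem_normalPlane_iff.1 hξ).2 _ (hrange ▸ ⟨z, rfl⟩)
    · have hw1 : ‖fderiv ℝ (param F e) u w‖ = 1 := by
        rw [norm_eq_sqrt_real_inner, hw, Real.sqrt_one]
      have horth : Orthonormal ℝ (fderiv ℝ (param F e) u ∘ ![v, w]) := by
        refine orthonormal_iff_ite.2 fun i j => ?_
        fin_cases i <;> fin_cases j <;>
          simp [hT1, hw1, hvw, (real_inner_comm _ _).trans hvw]
      simpa [real_inner_comm ξ] using (hcurv _ horth).1 (hmin _) ξ hξ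

theorem FlatSpherical.flatMinimal_of_isMinimal
    (h : FlatSpherical !![c ^ 2, 0; 0, 1] (fun u => horiz (param F e u)) e.target)
    (he : e ∈ IsManifold.maximalAtlas (𝓡 2) ∞ M) (hmin : IsMinimal F)
    (h4 : ∀ u ∈ e.target, param F e u 4 = κ * u 0 + τ) (hκ : c ^ 2 + κ ^ 2 = 1) :
    FlatMinimal c (fun u => horiz (param F e u)) e.target := by
  refine ⟨h, fun u hu => ?_⟩
  have hs := contDiffOn_of_horiz h.smooth h4
  set f := param F e
  set X := pd 0 (pd 0 f) u + pd 1 (pd 1 f) u with hX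
  set R := X + (1 + c ^ 2) • unitN (f u) with hR
  have inner_N_R : ⟪unitN (f u), R⟫_ℝ = 0 := by
    rw [hR, hX, inner_add_right, inner_add_right, inner_smul_right, h.inner_unitN_pd_pd h4 hu,
      h.inner_unitN_pd_pd h4 hu, inner_unitN, horiz_unitN, h.unit u hu]
    simp
  have inner_pd_R : ∀ i, ⟪pd i f u, R⟫_ℝ = 0 := fun i => by
    have inner_pd_N : ⟪pd i f u, unitN (f u)⟫_ℝ = 0 :=
      (real_inner_comm _ _).trans (h.inner_unitN_pd h4 hu i)
    rw [hR, hX, inner_add_right, inner_add_right, inner_smul_right, inner_pd_N,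
      h.inner_pd_pd_pd_of_horiz h4 hu, h.inner_pd_pd_pd_of_horiz h4 hu, mul_zero, add_zero,
      add_zero]
  have R_mem : R ∈ normalPlane F (e.symm u) := by
    refine mem_normalPlane_iff.2 ⟨inner_N_R, ?_⟩
    rw [tangentPlane_eq_range he hs (e.map_target hu), e.right_inv hu]
    rintro _ ⟨z, rfl⟩
    rw [ContinuousLinearMap.coe_coe, fderiv_apply_eq_pd, inner_add_left, inner_smul_left,
      inner_smul_left, inner_pd_R, inner_pd_R, mul_zero, mul_zero, add_zero]
  have inner_X_R : ⟪X, R⟫_ℝ = 0 := by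
    have hcurv := meanCurvature_eq_zero_iff he hs (e.map_target hu) (v := coordVec)
    rw [e.right_inv hu] at hcurv
    have := (hcurv (h.orthonormal_pd h4 hκ hu)).1 (hmin _) R R_mem
    rwa [Fin.sum_univ_two, ← pd_pd_eq_fderiv_fderiv e.open_target hs hu,
      ← pd_pd_eq_fderiv_fderiv e.open_target hs hu] at this
  have R_eq_zero : R = 0 := by
    rw [← inner_self_eq_zero (𝕜 := ℝ), hR, inner_add_left, ← hR, inner_X_R, inner_smul_left,
      inner_N_R, mul_zero, add_zero]
  rw [pd_pd_horiz e.open_target hs hu, pd_pd_horiz e.open_target hs hu, ← horiz_add, ← hX,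
    eq_neg_of_add_eq_zero_left R_eq_zero, ← neg_smul, horiz_smul, horiz_unitN]

theorem exists_isometric_chart (hs : Real.sin θ ≠ 0) (hc : Real.cos θ ≠ 0) (hF : IsImmersed F)
    (hmin : IsMinimal F) (hang : HasConstantAngle F θ) (p : M) :
    ∃ e ∈ IsManifold.maximalAtlas (𝓡 2) ∞ M, p ∈ e.source ∧ ∀ u ∈ e.target,
      param F e u 4 = Real.sin θ * u 0 ∧ ∀ z, ‖fderiv ℝ (param F e) u z‖ = ‖z‖ := by
  have hφ := IsManifold.chart_mem_maximalAtlas (I := 𝓡 2) (n := ∞) p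
  have hp := mem_chart_source Plane p
  set φ := chartAt Plane p
  have hA := angleSurface_param hF hmin hang hφ
  obtain ⟨V, hVφ, hpV, hV, ψ, sψ, hψ⟩ := hA.exists_coordinates hs hc (φ.map_source hp)
  have hinj : ∀ u ∈ V, Function.Injective (fderiv ℝ ψ u) := fun u hu => by
    refine (injective_iff_map_eq_zero _).2 fun z hz => hA.injective u (hVφ hu) ?_
    rw [map_zero, ← norm_eq_zero, (hψ u hu).2, hz, norm_zero]
  obtain ⟨τ, hpτ, hτV, rfl, hτ'⟩ := exists_openPartialHomeomorph hV sψ hinj hpV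
  refine ⟨φ.trans τ, trans_mem_maximalAtlas hφ (sψ.mono hτV) hτ', ⟨hp, hpτ⟩, fun u hu => ?_⟩
  have hu' := hτV (τ.map_target hu.1)
  refine ⟨?_, norm_fderiv_comp_symm hu.1 (differentiableAt_of_contDiffOn hA.isOpen hA.smooth
    (hVφ hu')) (differentiableAt_of_contDiffOn hV sψ hu')
    (differentiableAt_of_contDiffOn τ.open_target hτ' hu.1) (hψ _ hu').2⟩
  have height := (hψ _ hu').1
  rwa [inner_dt, τ.right_inv hu.1] at height

theorem exists_flat_chart (hs : Real.sin θ ≠ 0) (hc : Real.cos θ ≠ 0) (hF : IsImmersed F)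
    (hmin : IsMinimal F) (hang : HasConstantAngle F θ) (p : M) :
    ∃ e ∈ IsManifold.maximalAtlas (𝓡 2) ∞ M, p ∈ e.source ∧ IsPreconnected e.target ∧
      FlatMinimal (Real.cos θ) (fun u => horiz (param F e u)) e.target ∧
      ∀ u ∈ e.target, param F e u 4 = Real.sin θ * u 0 := by
  obtain ⟨e, he, hp, hiso⟩ := exists_isometric_chart hs hc hF hmin hang p
  obtain ⟨e', he', hp', hpre, hsub, hsymm⟩ := exists_isPreconnected_target he hp
  have hparam : param F e' = param F e := by
    unfold param
    rw [hsymm]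
  have h4 : ∀ u ∈ e'.target, param F e' u 4 = Real.sin θ * u 0 + 0 := fun u hu => by
    rw [hparam, add_zero, (hiso u (hsub hu)).1]
  have hsph := flatSpherical_of_isometric e'.open_target (contDiffOn_param he' hF.1)
    (fun u _ => norm_horiz_param F e' u) (fun u hu => hparam ▸ (hiso u (hsub hu)).2) h4
    (Real.cos_sq_add_sin_sq θ)
  exact ⟨e', he', hp', hpre,
    hsph.flatMinimal_of_isMinimal he' hmin h4 (Real.cos_sq_add_sin_sq θ), by simpa using h4⟩

theorem eq_model_of_eq_modelS3 {L : E4 ≃ₗᵢ[ℝ] E4} {ν : ℝ} {x : S3xR} {u : Plane}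
    (hL : L (horiz x) = modelS3 θ ν u) (h4 : (x : E5) 4 = Real.sin θ * u 0) :
    ((Isom.ofLinearIsometry L).toEquiv x : E5) = model θ ν (u 0) (u 1) := by
  rw [Isom.coe_ofLinearIsometry, model_eq_pair, hL, h4, mul_comm]

theorem exists_isModelNear (hs : Real.sin θ ≠ 0) (hc : Real.cos θ ≠ 0) (hF : IsImmersed F)
    (hmin : IsMinimal F) (hang : HasConstantAngle F θ) (p : M) :
    ∃ ν ∈ Set.Icc 1 √(1 + Real.cos θ ^ 2), ∃ Φ : Isom, IsModelNear F Φ θ ν p := by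
  obtain ⟨e, he, hp, hpre, hg, h4⟩ := exists_flat_chart hs hc hF hmin hang p
  have hu := e.map_source hp
  obtain ⟨ν, hν, hr⟩ := exists_inner_pd_pd_modelS3_eq hc (hg.inner_pd_pd_mem_Icc hc hpre hu)
  obtain ⟨L, hL⟩ := hg.exists_isometry_or_reflect (flatMinimal_modelS3 hc
    (zero_le_one.trans hν.1) (sq_le_of_mem_Icc hν)) hc hpre hu (hr 0).symm
  refine ⟨ν, hν, Isom.ofLinearIsometry L, ?_⟩
  rcases hL with hL | hL
  · refine ⟨e, he, hp, fun q hq => eq_model_of_eq_modelS3 ?_ ?_⟩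
    · simpa only [param_apply F hq, incl] using hL _ (e.map_source hq)
    · simpa only [param_apply F hq, incl] using h4 _ (e.map_source hq)
  · refine ⟨e.trans reflect.toHomeomorph.toOpenPartialHomeomorph,
      trans_mem_maximalAtlas he reflect.contDiff.contDiffOn reflect.symm.contDiff.contDiffOn,
      ⟨hp, trivial⟩, fun q hq => eq_model_of_eq_modelS3 (u := reflect (e q)) ?_ ?_⟩
    · simpa only [param_apply F hq.1, incl] using hL _ (e.map_source hq.1)
    · simpa only [param_apply F hq.1, incl, reflect_apply_zero] using h4 _ (e.map_source hq.1)

end MinimalSurface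

section Congruence

/-- The map `(x, y) ↦ (κx + x₀, ly + y₀)` of the plane, for signs `κ` and `l`: the form of the
coordinate changes between two representations of a surface by explicit maps. -/
noncomputable def signedTranslation {κ l : ℝ} (hκ : κ ^ 2 = 1) (hl : l ^ 2 = 1) (x₀ y₀ : ℝ) :
    Plane ≃ₜ Plane where
  toFun u := !₂[κ * u 0 + x₀, l * u 1 + y₀]
  invFun u := !₂[κ * (u 0 - x₀), l * (u 1 - y₀)]
  left_inv u := by
    ext i
    fin_cases i
    · change κ * (κ * u 0 + x₀ - x₀) = u 0
      linear_combination u 0 * hκ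
    · change l * (l * u 1 + y₀ - y₀) = u 1
      linear_combination u 1 * hl
  right_inv u := by
    ext i
    fin_cases i
    · change κ * (κ * (u 0 - x₀)) + x₀ = u 0
      linear_combination (u 0 - x₀) * hκ
    · change l * (l * (u 1 - y₀)) + y₀ = u 1
      linear_combination (u 1 - y₀) * hl
  continuous_toFun := by fun_prop
  continuous_invFun := by fun_prop

section

variable {κ l : ℝ} (hκ : κ ^ 2 = 1) (hl : l ^ 2 = 1) (x₀ y₀ : ℝ) {n : WithTop ℕ∞}

theorem contDiff_signedTranslation : ContDiff ℝ n (signedTranslation hκ hl x₀ y₀) := by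
  refine contDiff_euclidean.2 fun i => ?_
  fin_cases i
  · change ContDiff ℝ n fun u : Plane => κ * u 0 + x₀
    fun_prop
  · change ContDiff ℝ n fun u : Plane => l * u 1 + y₀
    fun_prop

theorem contDiff_signedTranslation_symm :
    ContDiff ℝ n (signedTranslation hκ hl x₀ y₀).symm := by
  refine contDiff_euclidean.2 fun i => ?_
  fin_cases i
  · change ContDiff ℝ n fun u : Plane => κ * (u 0 - x₀)
    fun_prop
  · change ContDiff ℝ n fun u : Plane => l * (u 1 - y₀)
    fun_prop

end

variable {c κ : ℝ} {g g' : Plane → E4} {U B : Set Plane} {u : Plane}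

theorem FlatSpherical.inner_fderiv (h : FlatSpherical !![c ^ 2, 0; 0, 1] g U) (hu : u ∈ U)
    (z : Plane) : ⟪fderiv ℝ g u z, fderiv ℝ g u z⟫_ℝ = c ^ 2 * z 0 ^ 2 + z 1 ^ 2 := by
  simp only [fderiv_apply_eq_pd, inner_add_left, inner_add_right, real_inner_smul_left,
    real_inner_smul_right, h.metric u hu, Matrix.of_apply, Matrix.cons_val]
  ring

theorem pd_sq_eq_of_congruent (hκ : κ ^ 2 = 1) (hg : FlatSpherical !![c ^ 2, 0; 0, 1] g U)
    (hg' : FlatSpherical !![c ^ 2, 0; 0, 1] g' B) {L : E4 ≃ₗᵢ[ℝ] E4} {τ : Plane → Plane} {x₀ : ℝ}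
    (hτ : DifferentiableAt ℝ τ u) (hτU : τ u ∈ U) (hu : u ∈ B)
    (h0 : ∀ v ∈ B, τ v 0 = κ * v 0 + x₀) (hL : ∀ v ∈ B, g (τ v) = L (g' v)) (i : Fin 2) :
    pd i (fun v => τ v 1) u ^ 2 = coordVec i 1 ^ 2 := by
  have hτ0 : pd i τ u 0 = κ * coordVec i 0 := by
    rw [pd_apply hτ, pd_congr hg'.isOpen h0 hu, pd_affine]
    fin_cases i <;> simp [coordVec]
  have hchain : pd i (fun v => g (τ v)) u = fderiv ℝ g (τ u) (pd i τ u) :=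
    congr($(fderiv_comp u (differentiableAt_of_contDiffOn hg.isOpen hg.smooth hτU) hτ)
      (coordVec i))
  have hlin : pd i (fun v => L (g' v)) u = L (pd i g' u) :=
    congr($(L.toContinuousLinearEquiv.comp_fderiv (f := g') (x := u)) (coordVec i))
  have hmetric : ⟪fderiv ℝ g (τ u) (pd i τ u), fderiv ℝ g (τ u) (pd i τ u)⟫_ℝ
      = ⟪pd i g' u, pd i g' u⟫_ℝ := by
    rw [← hchain, pd_congr hg'.isOpen hL hu, hlin, L.inner_map_map]
  rw [hg.inner_fderiv hτU, hτ0, pd_apply hτ, pd, pd, hg'.inner_fderiv hu, ← pd] at hmetric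
  linear_combination hmetric - c ^ 2 * coordVec i 0 ^ 2 * hκ

theorem pd_phase (k l : ℝ) (i : Fin 2) (u : Plane) : pd i (phase k l) u = ![k, l] i := by
  rw [pd, ContinuousLinearMap.fderiv, phase_coordVec]

theorem exists_eq_of_pd_sq_eq (hB : IsOpen B) (hBc : IsPreconnected B) {t : Plane → ℝ}
    (ht : ContDiffOn ℝ 1 t B) (hsq : ∀ u ∈ B, ∀ i, pd i t u ^ 2 = coordVec i 1 ^ 2) :
    ∃ l y₀ : ℝ, l ^ 2 = 1 ∧ ∀ u ∈ B, t u = l * u 1 + y₀ := by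
  have hcont : ContinuousOn (pd 1 t) B :=
    (ht.continuousOn_fderiv_of_isOpen hB le_rfl).clm_apply continuousOn_const
  have hd : ∀ u ∈ B, DifferentiableAt ℝ t u := fun u hu =>
    (ht.contDiffAt (hB.mem_nhds hu)).differentiableAt one_ne_zero
  have hpd0 : ∀ u ∈ B, pd 0 t u = 0 := fun u hu => by simpa [coordVec] using hsq u hu 0
  have hpd1 : ∀ u ∈ B, pd 1 t u ^ 2 = 1 := fun u hu => by simpa [coordVec] using hsq u hu 1
  obtain ⟨l, hl, hlB⟩ : ∃ l : ℝ, l ^ 2 = 1 ∧ ∀ u ∈ B, pd 1 t u = l := by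
    rcases hBc.eq_one_or_eq_neg_one_of_sq_eq hcont hpd1 with h | h
    · exact ⟨1, by norm_num, h⟩
    · exact ⟨-1, by norm_num, h⟩
  obtain ⟨y₀, hy₀⟩ := exists_const_of_pd_eq_zero (h := fun u => t u - phase 0 l u) hB hBc
    (fun u hu => ((hd u hu).sub (phase 0 l).differentiableAt).differentiableWithinAt)
    fun u hu i => by
      rw [pd_sub (hd u hu) (phase 0 l).differentiableAt, sub_eq_zero, pd_phase]
      fin_cases i
      · exact hpd0 u hu
      · exact hlB u hu
  refine ⟨l, y₀, hl, fun u hu => ?_⟩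
  have := hy₀ u hu
  rw [phase_apply] at this
  linarith

theorem exists_eq_signedTranslation {x₀ : ℝ} (hκ : κ ^ 2 = 1)
    (hg : FlatSpherical !![c ^ 2, 0; 0, 1] g Set.univ)
    (hg' : FlatSpherical !![c ^ 2, 0; 0, 1] g' U) {L : E4 ≃ₗᵢ[ℝ] E4} {τ : Plane → Plane}
    (hu : u ∈ U) (hτ : ContDiffAt ℝ ∞ τ u)
    (h : ∀ᶠ v in nhds u, τ v 0 = κ * v 0 + x₀ ∧ g (τ v) = L (g' v)) :
    ∃ (l y₀ : ℝ) (hl : l ^ 2 = 1), ∀ᶠ v in nhds u, τ v = signedTranslation hκ hl x₀ y₀ v := by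
  have h1 : (1 : WithTop ℕ∞) ≤ ∞ := WithTop.coe_le_coe.2 le_top
  obtain ⟨r, hr, hball⟩ := Metric.eventually_nhds_iff_ball.1
    ((h.and ((hτ.of_le h1).eventually (by simp))).and (hg'.isOpen.mem_nhds hu))
  have hsmooth : ∀ v ∈ Metric.ball u r, ContDiffAt ℝ 1 τ v := fun v hv => (hball v hv).1.2
  obtain ⟨l, y₀, hl, hy⟩ := exists_eq_of_pd_sq_eq Metric.isOpen_ball
    (convex_ball u r).isPreconnected (t := fun v => τ v 1)
    (fun v hv => (contDiffAt_euclidean.1 (hsmooth v hv) 1).contDiffWithinAt)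
    fun v hv => pd_sq_eq_of_congruent hκ hg
      (hg'.mono Metric.isOpen_ball fun w hw => (hball w hw).2)
      ((hsmooth v hv).differentiableAt one_ne_zero) (Set.mem_univ _) hv
      (fun w hw => (hball w hw).1.1.1) fun w hw => (hball w hw).1.1.2
  refine ⟨l, y₀, hl, Metric.eventually_nhds_iff_ball.2 ⟨r, hr, fun v hv => ?_⟩⟩
  ext i
  fin_cases i
  · exact (hball v hv).1.1.1
  · exact hy v hv

theorem contDiff_modelS3 (θ ν : ℝ) {n : WithTop ℕ∞} : ContDiff ℝ n (modelS3 θ ν) := by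
  rw [modelS3_eq]
  exact contDiff_torus _ _ _ _

theorem modelS3_comp_eq_of_eventuallyEq {θ ν ν' : ℝ} {σ : Plane → Plane} {L : E4 ≃ₗᵢ[ℝ] E4}
    (hσ : ContDiff ℝ ω σ) (h : ∀ᶠ v in nhds u, modelS3 θ ν (σ v) = L (modelS3 θ ν' v))
    (v : Plane) : modelS3 θ ν (σ v) = L (modelS3 θ ν' v) := by
  have hleft : ContDiff ℝ ω fun v => modelS3 θ ν (σ v) := (contDiff_modelS3 θ ν).comp hσ
  have hright : ContDiff ℝ ω fun v => L (modelS3 θ ν' v) :=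
    L.toContinuousLinearEquiv.contDiff.comp (contDiff_modelS3 θ ν')
  exact congrFun (AnalyticOnNhd.eq_of_eventuallyEq (fun w _ => hleft.contDiffAt.analyticAt)
    (fun w _ => hright.contDiffAt.analyticAt) h) v

end Congruence

section Globalization

theorem Isom.exists_eq_of_eq_model {θ ν : ℝ} (hs : Real.sin θ ≠ 0) (Φ Ψ : Isom) :
    ∃ (L : E4 ≃ₗᵢ[ℝ] E4) (κ x₀ : ℝ), κ ^ 2 = 1 ∧
      ∀ (x : S3xR) (u : Plane), (Ψ.toEquiv x : E5) = model θ ν (u 0) (u 1) →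
        (Φ.toEquiv x : E5) = pair (L (modelS3 θ ν u)) ((κ * u 0 + x₀) * Real.sin θ) := by
  obtain ⟨L₁, ε₁, τ₁, hε₁, hΦ⟩ := Φ.exists_eq
  obtain ⟨L₂, ε₂, τ₂, hε₂, hΨ⟩ := Ψ.exists_eq
  refine ⟨L₂.symm.trans L₁, ε₁ * ε₂, (τ₁ - ε₁ * ε₂ * τ₂) / Real.sin θ,
    by rw [mul_pow, hε₁, hε₂, one_mul], fun x u hx => ?_⟩
  obtain ⟨hhoriz, hheight⟩ := hΨ x
  rw [hx, model_eq_pair, horiz_pair] at hhoriz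
  rw [hx, model_apply_four] at hheight
  refine ext_horiz ?_ ?_
  · rw [(hΦ x).1, horiz_pair, hhoriz, LinearIsometryEquiv.trans_apply,
      LinearIsometryEquiv.symm_apply_apply]
  · rw [(hΦ x).2, pair_apply_four, add_mul, div_mul_cancel₀ _ hs]
    linear_combination -(ε₁ * ε₂) * hheight - ε₁ * (x : E5) 4 * hε₂

variable {M : Type*} [TopologicalSpace M] [ChartedSpace Plane M] [IsManifold (𝓡 2) ∞ M]
  {F : M → S3xR} {θ ν ν' : ℝ} {Φ Ψ : Isom}

theorem IsModelNear.of_mem_source (hs : Real.sin θ ≠ 0) (hc : Real.cos θ ≠ 0)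
    (hν : ν ∈ Set.Icc 1 √(1 + Real.cos θ ^ 2)) (hν' : ν' ∈ Set.Icc 1 √(1 + Real.cos θ ^ 2))
    {q r : M} (hr : IsModelNear F Φ θ ν r) {e' : OpenPartialHomeomorph M Plane}
    (he' : e' ∈ IsManifold.maximalAtlas (𝓡 2) ∞ M) (hre' : r ∈ e'.source)
    (hΨ : ∀ x ∈ e'.source, (Ψ.toEquiv (F x) : E5) = model θ ν' (e' x 0) (e' x 1))
    (hq : q ∈ e'.source) : IsModelNear F Φ θ ν q := by
  obtain ⟨e, he, hre, hΦ⟩ := hr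
  obtain ⟨L, κ, x₀, hκ, hL⟩ := Isom.exists_eq_of_eq_model (ν := ν') hs Φ Ψ
  have hflat {ν} (hν : ν ∈ Set.Icc 1 √(1 + Real.cos θ ^ 2)) := (flatMinimal_modelS3 hc
    (zero_le_one.trans hν.1) (sq_le_of_mem_Icc hν)).toFlatSpherical
  have htrans : ∀ᶠ u in nhds (e' r), (e ∘ e'.symm) u 0 = κ * u 0 + x₀ ∧
      modelS3 θ ν ((e ∘ e'.symm) u) = L (modelS3 θ ν' u) := by
    filter_upwards [eventually_symm_mem_source hre hre'] with u hu
    have hpair := hL _ _ (hΨ _ (e'.map_target hu.1))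
    rw [e'.right_inv hu.1, hΦ _ hu.2, model_eq_pair] at hpair
    refine ⟨mul_right_cancel₀ hs ?_, ?_⟩
    · simpa only [Function.comp_apply, pair_apply_four] using congr($hpair 4)
    · simpa only [Function.comp_apply, horiz_pair] using congr(horiz $hpair)
  obtain ⟨l, y₀, hl, hσ⟩ := exists_eq_signedTranslation hκ (hflat hν) (hflat hν')
    (Set.mem_univ _) (contDiffAt_transition he he' hre hre') htrans
  have hmodel := modelS3_comp_eq_of_eventuallyEq (contDiff_signedTranslation hκ hl x₀ y₀)
    (hσ.mp (htrans.mono fun u hu hσu => hσu ▸ hu.2))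
  refine ⟨e'.trans (signedTranslation hκ hl x₀ y₀).toOpenPartialHomeomorph,
    trans_mem_maximalAtlas he' (contDiff_signedTranslation hκ hl x₀ y₀).contDiffOn
      (contDiff_signedTranslation_symm hκ hl x₀ y₀).contDiffOn, ⟨hq, trivial⟩, fun x hx => ?_⟩
  rw [hL _ _ (hΨ x hx.1), ← hmodel]
  exact (model_eq_pair θ ν (signedTranslation hκ hl x₀ y₀ (e' x))).symm

theorem exists_forall_isModelNear [ConnectedSpace M] (hs : Real.sin θ ≠ 0) (hc : Real.cos θ ≠ 0)
    (h : ∀ p : M, ∃ ν ∈ Set.Icc 1 √(1 + Real.cos θ ^ 2), ∃ Φ : Isom, IsModelNear F Φ θ ν p) :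
    ∃ ν ∈ Set.Icc 1 √(1 + Real.cos θ ^ 2), ∃ Φ : Isom, ∀ p, IsModelNear F Φ θ ν p := by
  obtain ⟨p₀⟩ := (inferInstance : Nonempty M)
  obtain ⟨ν, hν, Φ, hp₀⟩ := h p₀
  have hclopen : IsClopen {p | IsModelNear F Φ θ ν p} := by
    constructor
    · refine isClosed_of_closure_subset fun q hq => ?_
      obtain ⟨ν', hν', Ψ, e', he', hqe', hΨ⟩ := h q
      obtain ⟨r, hre', hr⟩ := mem_closure_iff.1 hq _ e'.open_source hqe'
      exact IsModelNear.of_mem_source hs hc hν hν' hr he' hre' hΨ hqe'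
    · refine isOpen_iff_mem_nhds.2 fun q ⟨e, he, hqe, hΦ⟩ => ?_
      filter_upwards [e.open_source.mem_nhds hqe] with x hx
      exact ⟨e, he, hx, hΦ⟩
  exact ⟨ν, hν, Φ, Set.eq_univ_iff_forall.1 (hclopen.eq_univ ⟨p₀, hp₀⟩)⟩

end Globalization

end S3R

theorem theorem2_general {M : Type*} [TopologicalSpace M] [ChartedSpace S3R.Plane M]
    [IsManifold (𝓡 2) ∞ M] (F : M → S3R.S3xR) (θ : ℝ) (hs : Real.sin θ ≠ 0)
    (hc : Real.cos θ ≠ 0) :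
    ((S3R.IsImmersed F ∧ S3R.IsMinimal F ∧ S3R.HasConstantAngle F θ) ↔
      ∀ p : M, ∃ ν₁ ∈ Set.Icc 1 (√(1 + Real.cos θ ^ 2)), ∃ Φ : S3R.Isom,
        S3R.IsModelNear F Φ θ ν₁ p) ∧
    (ConnectedSpace M →
      ((S3R.IsImmersed F ∧ S3R.IsMinimal F ∧ S3R.HasConstantAngle F θ) ↔
        ∃ ν₁ ∈ Set.Icc 1 (√(1 + Real.cos θ ^ 2)), ∃ Φ : S3R.Isom,
          ∀ p : M, S3R.IsModelNear F Φ θ ν₁ p)) := by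
  have local_iff : (S3R.IsImmersed F ∧ S3R.IsMinimal F ∧ S3R.HasConstantAngle F θ) ↔
      ∀ p : M, ∃ ν₁ ∈ Set.Icc 1 (√(1 + Real.cos θ ^ 2)), ∃ Φ : S3R.Isom,
        S3R.IsModelNear F Φ θ ν₁ p :=
    ⟨fun ⟨hF, hmin, hang⟩ => S3R.exists_isModelNear hs hc hF hmin hang,
      S3R.minimal_of_isModelNear hc⟩
  exact ⟨local_iff, fun _ => local_iff.trans ⟨S3R.exists_forall_isModelNear hs hc,
    fun ⟨ν₁, hν₁, Φ, h⟩ p => ⟨ν₁, hν₁, Φ, h p⟩⟩⟩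

theorem theorem2 {M : Type*} [TopologicalSpace M] [ChartedSpace S3R.Plane M]
    [IsManifold (𝓡 2) ∞ M] (F : M → S3R.S3xR) (θ : ℝ) (hθ : θ ∈ Set.Ioo 0 (Real.pi / 2)) :
    ((S3R.IsImmersed F ∧ S3R.IsMinimal F ∧ S3R.HasConstantAngle F θ) ↔
      ∀ p : M, ∃ ν₁ ∈ Set.Icc 1 (√(1 + Real.cos θ ^ 2)), ∃ Φ : S3R.Isom,
        S3R.IsModelNear F Φ θ ν₁ p) ∧
    (ConnectedSpace M →
      ((S3R.IsImmersed F ∧ S3R.IsMinimal F ∧ S3R.HasConstantAngle F θ) ↔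
        ∃ ν₁ ∈ Set.Icc 1 (√(1 + Real.cos θ ^ 2)), ∃ Φ : S3R.Isom,
          ∀ p : M, S3R.IsModelNear F Φ θ ν₁ p)) :=
  theorem2_general F θ
    (Real.sin_pos_of_pos_of_lt_pi hθ.1 (by linarith [hθ.1, hθ.2])).ne'
    (Real.cos_pos_of_mem_Ioo ⟨by linarith [hθ.1, hθ.2], hθ.2⟩).ne'
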